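/- **Setting.** Let $0<i_0<n-1$. Subsets of the projective sphere $\mathbb S^m=(\mathbb R^{m+1}\setminus\{0\})/\mathbb R_{>0}$ are used throughout. Let $\mathcal O=\tilde{\mathcal O}/\Gamma$ be a properly convex real projective $n$-orbifold: $\tilde{\mathcal O}\subset\mathbb S^n$ is a properly convex open domain and $\Gamma\subset \mathrm{SL}_\pm(n+1,\mathbb R)$ acts properly discontinuously on it. Let $\tilde E$ be a radial pseudo-end of $\mathcal O$ with vertex $v_{\tilde E}=[0,\dots,0,1]$: there is an open connected set $U\subset\tilde{\mathcal O}$ (a p-end neighborhood), equal to or disjoint from each of its $\Gamma$-translates, foliated by open projective geodesics ending at $v_{\tilde E}$ that are properly embedded in $\mathcal O$ (locally uniformly), and $\Gamma_{\tilde E}=\{g\in\Gamma: gU=U\}$ acts properly discontinuously and cocompactly on the space $\tilde\Sigma_{\tilde E}$ of directions of $U$ at $v_{\tilde E}$. The end is assumed to be neither properly convex nor complete affine, of fiber dimension $i_0$: with $\mathbb S^{i_0}_\infty=\{x_1=\dots=x_{n-i_0}=0\}$ and $\Pi_K:\mathbb S^n\setminus\mathbb S^{i_0}_\infty\to\mathbb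 S^{n-i_0-1}$ the projection to the first $n-i_0$ coordinates, there is a properly convex compact $K\subset\mathbb S^{n-i_0-1}$ such that $\tilde\Sigma_{\tilde E}$ is the full inverse image of $K^o$ in the sphere of directions at $v_{\tilde E}$. Assume: 1. All $g\in\Gamma_{\tilde E}$ have, in these coordinates, the block form (block sizes $n-i_0-1,\,1,\,i_0,\,1$) $$g=\begin{pmatrix} S(g)&s_1(g)&0&0\\ s_2(g)&a_1(g)&0&0\\ C_1(g)&a_4(g)&A_5(g)&0\\ c_2(g)&a_7(g)&a_8(g)&a_9(g)\end{pmatrix},\qquad \hat S(g)=\begin{pmatrix}S(g)&s_1(g)\\ s_2(g)&a_1(g)\end{pmatrix},\qquad a_5(g)=|\det A_5(g)|^{1/i_0},$$ and $K^o/N_K$ is compact, where $N_K$ is the group of transformations of $K$ induced by the $\hat S(g)$. 2. (Weak middle eigenvalue condition) For every $g\in\Gamma_{\tilde E}$, $\bar\lambda(g)\ge\lambda_1(g)\ge a_9(g)$, where $\bar\lambda(g)$ is the largest norm of an eigenvalue of $g$, and $\lambda_1(g)$ is the largest $r$ such that the sum of the real Jordan subspaces of $g$ for the eigenvalues of norm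 $r$ is not contained in $\{x_1=\dots=x_{n-i_0}=0\}$. 3. There is a group $\mathcal N=\{\mathcal N(v): v\in\mathbb R^{i_0}\}$, $\mathcal N(v)\mathcal N(w)=\mathcal N(v+w)$, of matrices $$\mathcal N(v)=\begin{pmatrix} I&0&0&0\\0&1&0&0\\ C_1(v)&v^T&I&0\\ c_2(v)&\tfrac12\|v\|^2&v&1\end{pmatrix}$$ with $C_1$ linear and $c_2$ continuous in $v$, which is normalized by $\Gamma_{\tilde E}$ and satisfies $\mathcal N(v)U=U$ for all $v$. 4. $K=\{k\}*K''$ is a strict join, where $k=[0,\dots,0,1]\in\mathbb S^{n-i_0-1}$ is the image under $\Pi_K$ of the great $(i_0+1)$-sphere $\{x_1=\dots=x_{n-i_0-1}=0\}$. 5. $a_1(g)\ge a_5(g)$ and $a_1(g)\ge a_9(g)$ for every $g\in\Gamma_{\tilde E}$ for which $a_1(g)$ is an eigenvalue of $\hat S(g)$ of largest norm. 6. Some subgroup of the center of $\Gamma_{\tilde E}$ maps, under $g\mapsto\hat S(g)$, onto a Zariski dense subgroup of the virtual center of $\mathrm{Aut}(K)$. Here, if $K=K_1*\cdots*K_l$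 is the decomposition of $K$ into join-indecomposable factors, the virtual center is the group $\cong\mathbb R^{l-1}$ of projective transformations acting on the span of each $K_j$ as a positive scalar. **Conclusion (Splitting).** There is a projective embedding $\sigma$ of $K''$ into $\mathrm{Bd}\,\tilde{\mathcal O}$ with $\Pi_K\circ\sigma=\mathrm{id}$ whose image is $\Gamma_{\tilde E}$-invariant. Moreover there are new coordinates, obtained by a linear change of coordinates of the same block lower triangular form, in which $\sigma(K'')$ lies in the span of the first $n-i_0-1$ coordinate vectors, every $\mathcal N(v)$ has the above form with $C_1(v)=0$ and $c_2(v)=0$, and every $g\in\Gamma_{\tilde E}$ has the above form with $C_1(g)=0$, $c_2(g)=0$, and also $s_1(g)=0$, $s_2(g)=0$. So the representation of $\Gamma_{\tilde E}$ splits as $S(g)$ plus the lower right $(i_0+2)\times(i_0+2)$ block. -/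

import Mathlib

open scoped Pointwise

noncomputable section

/-! ## Convex domains of the projective sphere, as cones

The projective sphere `S(W)` of a real vector space `W` is the set of rays of `W`.  A subset of
`S(W)` is represented by the union of the corresponding open rays, a subset of `W \ {0}` that is
stable under positive scalars (closed domains are represented together with the origin). -/

/-- The cone over a nonempty properly convex open domain of the projective sphere. -/
structure IsProperlyConvexCone {κ : Type*} (C : Set (κ → ℝ)) : Prop where
  isOpen : IsOpen C
  nonempty : C.Nonempty
  convex : Convex ℝ C
  smul_mem : ∀ r : ℝ, 0 < r → ∀ x ∈ C, r • x ∈ C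
  pointed : ∀ x ∈ closure C, -x ∈ closure C → x = 0

/-- Proper discontinuity of the projective action of a set `Γ` of elements of `G` (acting through
the matrices `ρ g`) on the domain of the projective sphere whose cone is `C`. -/
def ActsProperlyDiscontinuously {G κ : Type*} [Fintype κ] (ρ : G → Matrix κ κ ℝ) (Γ : Set G)
    (C : Set (κ → ℝ)) : Prop :=
  ∀ D ⊆ C, IsCompact D → {g ∈ Γ | ∃ x ∈ D, ∃ r : ℝ, 0 < r ∧ r • (ρ g).mulVec x ∈ D}.Finite

/-- Compactness of the quotient of the domain of the projective sphere whose cone is `C`: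
the translates of some compact subset cover the domain. -/
def ActsCocompactly {G κ : Type*} [Fintype κ] (ρ : G → Matrix κ κ ℝ) (Γ : Set G)
    (C : Set (κ → ℝ)) : Prop :=
  ∃ D ⊆ C, IsCompact D ∧ ∀ x ∈ C, ∃ g ∈ Γ, ∃ r : ℝ, 0 < r ∧ r • (ρ g).mulVec x ∈ D

/-- The cone `K` is the strict join `A * B`: the spans of `A` and `B` are independent, and `K` is
the union of the segments from points of `A` to points of `B`. -/
def IsStrictJoin {W : Type*} [AddCommGroup W] [Module ℝ W] (A B K : Set W) : Prop :=
  Disjoint (Submodule.span ℝ A) (Submodule.span ℝ B) ∧ K = A + B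

/-- The cone `A` over a nonempty set is not a strict join of two nonempty sets. -/
def IsJoinIndecomposable {W : Type*} [AddCommGroup W] [Module ℝ W] (A : Set W) : Prop :=
  ¬ A ⊆ {0} ∧ ∀ B₁ B₂ : Set W, IsStrictJoin B₁ B₂ A → B₁ ⊆ {0} ∨ B₂ ⊆ {0}

/-- The cone `K` is the strict join `A 0 * ⋯ * A (l-1)` of join-indecomposable cones. -/
structure IsJoinDecomposition {W : Type*} [AddCommGroup W] [Module ℝ W] {l : ℕ}
    (A : Fin l → Set W) (K : Set W) : Prop where
  independent : iSupIndep fun j => Submodule.span ℝ (A j)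
  eq_sum : K = {x | ∃ y : Fin l → W, (∀ j, y j ∈ A j) ∧ x = ∑ j, y j}
  indecomposable : ∀ j, IsJoinIndecomposable (A j)

/-- The virtual center of `Aut(K)` (together with the positive homotheties, which act trivially
on the projective sphere): the diagonalizable group `ℝ^(l-1)` of the decomposition
`K = K₁ * ⋯ * K_l`, acting on the span of each `K_j` as a positive scalar. -/
def virtualCenter {κ : Type*} [Fintype κ] (K : Set (κ → ℝ)) : Set (Matrix κ κ ℝ) :=
  {M | ∃ (l : ℕ) (A : Fin l → Set (κ → ℝ)) (c : Fin l → ℝ), IsJoinDecomposition A K ∧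
    (∀ j, 0 < c j) ∧ ∀ j, ∀ x ∈ A j, M.mulVec x = c j • x}

/-- `H` is a Zariski dense subset of `T`, as sets of projective transformations: every
homogeneous polynomial in the matrix entries that vanishes on `H` vanishes on `T`. -/
def IsZariskiDenseIn {κ : Type*} (H T : Set (Matrix κ κ ℝ)) : Prop :=
  H ⊆ T ∧ ∀ (d : ℕ) (f : MvPolynomial (κ × κ) ℝ), f.IsHomogeneous d →
    (∀ M ∈ H, MvPolynomial.eval (fun q => M q.1 q.2) f = 0) →
    ∀ M ∈ T, MvPolynomial.eval (fun q => M q.1 q.2) f = 0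

/-! ## Block coordinates

With `i = i₀` and `n = p + i + 1`, so that `p = n - i₀ - 1`, the `n + 1` coordinates are grouped in
blocks of sizes `p`, `1`, `i`, `1`. -/

/-- The index set of the `n + 1` coordinates. -/
abbrev BlockIdx (p i : ℕ) : Type := (Fin p ⊕ Unit) ⊕ (Fin i ⊕ Unit)

section Blocks

variable {p i : ℕ}

/-- The semisimple part `Ŝ(g)`, the action on the sphere of dimension `n - i₀ - 1`. -/
def semisimplePart (M : Matrix (BlockIdx p i) (BlockIdx p i) ℝ) :
    Matrix (Fin p ⊕ Unit) (Fin p ⊕ Unit) ℝ := M.toBlocks₁₁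

def blockS1 (M : Matrix (BlockIdx p i) (BlockIdx p i) ℝ) : Matrix (Fin p) Unit ℝ :=
  M.toBlocks₁₁.toBlocks₁₂

def blockS2 (M : Matrix (BlockIdx p i) (BlockIdx p i) ℝ) : Matrix Unit (Fin p) ℝ :=
  M.toBlocks₁₁.toBlocks₂₁

/-- The entry `a₁(g)`. -/
def entryA1 (M : Matrix (BlockIdx p i) (BlockIdx p i) ℝ) : ℝ := M.toBlocks₁₁.toBlocks₂₂ () ()

def blockC1 (M : Matrix (BlockIdx p i) (BlockIdx p i) ℝ) : Matrix (Fin i) (Fin p) ℝ :=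
  M.toBlocks₂₁.toBlocks₁₁

def blockC2 (M : Matrix (BlockIdx p i) (BlockIdx p i) ℝ) : Matrix Unit (Fin p) ℝ :=
  M.toBlocks₂₁.toBlocks₂₁

def blockA5 (M : Matrix (BlockIdx p i) (BlockIdx p i) ℝ) : Matrix (Fin i) (Fin i) ℝ :=
  M.toBlocks₂₂.toBlocks₁₁

/-- The number `a₅(g) = |det A₅(g)|^(1/i₀)`. -/
def numberA5 (M : Matrix (BlockIdx p i) (BlockIdx p i) ℝ) : ℝ :=
  |(blockA5 M).det| ^ (1 / (i : ℝ))

/-- The entry `a₉(g)`, the eigenvalue `λ_v(g)` at the end vertex. -/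
def entryA9 (M : Matrix (BlockIdx p i) (BlockIdx p i) ℝ) : ℝ := M.toBlocks₂₂.toBlocks₂₂ () ()

/-- The standard block lower triangular form
`(S s₁ 0 0; s₂ a₁ 0 0; C₁ a₄ A₅ 0; c₂ a₇ a₈ a₉)`. -/
def IsStandardForm (M : Matrix (BlockIdx p i) (BlockIdx p i) ℝ) : Prop :=
  M.toBlocks₁₂ = 0 ∧ M.toBlocks₂₂.toBlocks₁₂ = 0

/-- The matrix `𝒩(v) = (I 0 0 0; 0 1 0 0; C₁(v) vᵀ I 0; c₂(v) ‖v‖²/2 v 1)`, where `C` and `c` are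
the values `C₁(v)` and `c₂(v)`. -/
def cuspMatrix (C : Matrix (Fin i) (Fin p) ℝ) (c : Fin p → ℝ) (v : Fin i → ℝ) :
    Matrix (BlockIdx p i) (BlockIdx p i) ℝ :=
  Matrix.fromBlocks 1 0
    (Matrix.fromBlocks C (Matrix.replicateCol Unit v) (Matrix.replicateRow Unit c)
      (Matrix.of fun _ _ => (∑ j, v j ^ 2) / 2))
    (Matrix.fromBlocks 1 0 (Matrix.replicateRow Unit v) 1)

/-- The vector over the end vertex `v_E = [0, …, 0, 1]`. -/
def endVertex (p i : ℕ) : BlockIdx p i → ℝ := Pi.single (Sum.inr (Sum.inr ())) 1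

/-- The linear map `ℝ^(n+1) → ℝ^(n-i₀)` inducing the projection `Π_K` from `S^{i₀}_∞`, the subspace
on which the first `n - i₀` coordinates vanish. -/
def projK (p i : ℕ) : (BlockIdx p i → ℝ) →ₗ[ℝ] (Fin p ⊕ Unit → ℝ) :=
  LinearMap.funLeft ℝ ℝ Sum.inl

/-- The point `k = [0, …, 0, 1]` of the sphere of dimension `n - i₀ - 1`, with the origin added
to its ray.  It is the image under `Π_K` of the great sphere on which the first `n - i₀ - 1`
coordinates vanish, where the matrices `𝒩(v)` restrict to a standard cusp group. -/
def apexRay (p : ℕ) : Set (Fin p ⊕ Unit → ℝ) :=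
  {x | ∃ t : ℝ, 0 ≤ t ∧ x = Pi.single (Sum.inr ()) t}

/-- The inclusion of all coordinates but the last. -/
def linkIncl (p i : ℕ) : (Fin p ⊕ Unit) ⊕ Fin i → BlockIdx p i := Sum.map id Sum.inl

/-- The projection onto the space of directions at the end vertex (dropping the last
coordinate). -/
def linkProj (x : BlockIdx p i → ℝ) : (Fin p ⊕ Unit) ⊕ Fin i → ℝ := x ∘ linkIncl p i

/-- The induced action on the space of directions at the end vertex. -/
def linkMatrix (M : Matrix (BlockIdx p i) (BlockIdx p i) ℝ) :
    Matrix ((Fin p ⊕ Unit) ⊕ Fin i) ((Fin p ⊕ Unit) ⊕ Fin i) ℝ :=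
  M.submatrix (linkIncl p i) (linkIncl p i)

/-! ## Eigenvalues -/

/-- The norms of the complex eigenvalues of a real matrix. -/
def eigenvalueNorms {κ : Type*} [Fintype κ] [DecidableEq κ] (M : Matrix κ κ ℝ) : Set ℝ :=
  (fun z : ℂ => ‖z‖) '' spectrum ℂ (M.map Complex.ofReal)

/-- The real vector `x` lies in the sum of the real Jordan subspaces of the eigenvalues of `M` of
norm `r`. -/
def IsAffiliated {κ : Type*} [Fintype κ] [DecidableEq κ] (M : Matrix κ κ ℝ) (x : κ → ℝ) (r : ℝ) :
    Prop :=
  (fun j => (x j : ℂ)) ∈ ⨆ z ∈ {z : ℂ | ‖z‖ = r},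
    Module.End.maxGenEigenspace (Matrix.toLin' (M.map Complex.ofReal)) z

/-- `λ̄(g)`: the largest norm of the eigenvalues. -/
def lambdaBar (M : Matrix (BlockIdx p i) (BlockIdx p i) ℝ) : ℝ := sSup (eigenvalueNorms M)

/-- `λ₁(g)`: the largest norm of the eigenvalues affiliated with a vector outside the subspace
of `S^{i₀}_∞`. -/
def lambdaOne (M : Matrix (BlockIdx p i) (BlockIdx p i) ℝ) : ℝ :=
  sSup {r | ∃ x : BlockIdx p i → ℝ, projK p i x ≠ 0 ∧ IsAffiliated M x r}

end Blocks

/-! ## Orbifolds and ends -/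

/-- The image of a set under the linear action of `GL`. -/
def moveSet {κ : Type*} [Fintype κ] [DecidableEq κ] (g : GL κ ℝ) (X : Set (κ → ℝ)) :
    Set (κ → ℝ) :=
  (fun x => (g : Matrix κ κ ℝ).mulVec x) '' X

/-- A properly convex real projective orbifold: its universal cover, developed onto a properly
convex open domain of the projective sphere (with cone `domain`), and the holonomy group of deck
transformations, a properly discontinuous group of matrices of determinant `±1`. -/
structure ConvexProjectiveOrbifold (κ : Type*) [Fintype κ] [DecidableEq κ] where
  domain : Set (κ → ℝ)
  group : Subgroup (GL κ ℝ)
  properlyConvex : IsProperlyConvexCone domain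
  abs_det : ∀ g ∈ group, |(g : Matrix κ κ ℝ).det| = 1
  invariant : ∀ g ∈ group, moveSet g domain = domain
  properlyDiscontinuous :
    ActsProperlyDiscontinuously (fun g : GL κ ℝ => (g : Matrix κ κ ℝ)) group domain

/-- A p-R-end with end vertex `[0, …, 0, 1]` that is convex, but neither properly convex nor
complete affine, of fiber dimension `i`, in coordinates adapted to it: `nbhd` is (the cone over) a
p-end neighborhood, `endGroup` the p-end fundamental group, and `leafSpace` (the cone over) the
properly convex open domain `K°`. -/
structure NPCCEnd {p i : ℕ} (O : ConvexProjectiveOrbifold (BlockIdx p i)) where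
  nbhd : Set (BlockIdx p i → ℝ)
  endGroup : Subgroup (GL (BlockIdx p i) ℝ)
  leafSpace : Set (Fin p ⊕ Unit → ℝ)
  /-- The fiber dimension `i` satisfies `0 < i < n - 1`. -/
  fiberDim_pos : 0 < i
  leafDim_pos : 0 < p
  nbhd_subset : nbhd ⊆ O.domain
  nbhd_open : IsOpen nbhd
  nbhd_connected : IsConnected nbhd
  nbhd_smul : ∀ r : ℝ, 0 < r → ∀ x ∈ nbhd, r • x ∈ nbhd
  mem_endGroup : ∀ g, g ∈ endGroup ↔ g ∈ O.group ∧ moveSet g nbhd = nbhd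
  /-- `nbhd` is a component of the inverse image of a neighborhood of an end. -/
  preciselyInvariant : ∀ g ∈ O.group, g ∈ endGroup ∨ Disjoint (moveSet g nbhd) nbhd
  /-- `nbhd` is foliated by geodesics ending at the end vertex, -/
  radial : ∀ x ∈ nbhd, ∀ t : ℝ, 0 ≤ t → x + t • endVertex p i ∈ nbhd
  vertex_notMem : endVertex p i ∉ O.domain
  /-- which leave the compact subsets of the orbifold, locally uniformly. -/
  radial_proper : ∀ B ⊆ nbhd, IsCompact B → ∀ D ⊆ O.domain, IsCompact D →
    ∃ T : ℝ, ∀ x ∈ B, ∀ t ≥ T, ∀ g ∈ O.group, ∀ r : ℝ, 0 < r →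
      r • (g : Matrix (BlockIdx p i) (BlockIdx p i) ℝ).mulVec (x + t • endVertex p i) ∉ D
  /-- The elements of the end group preserve `S^{i₀}_∞` and the end vertex. -/
  standardForm : ∀ g ∈ endGroup, IsStandardForm (g : Matrix (BlockIdx p i) (BlockIdx p i) ℝ)
  leafSpace_properlyConvex : IsProperlyConvexCone leafSpace
  /-- The space of directions of `nbhd` is the union of the complete affine leaves of dimension
  `i` parametrized by `leafSpace`. -/
  directions_eq : linkProj '' nbhd = {y | y ∘ Sum.inl ∈ leafSpace}
  /-- The end orbifold, the quotient of the space of directions, is a closed orbifold. -/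
  directions_properlyDiscontinuous : ActsProperlyDiscontinuously
    (fun g : GL (BlockIdx p i) ℝ => linkMatrix (g : Matrix (BlockIdx p i) (BlockIdx p i) ℝ))
    endGroup (linkProj '' nbhd)
  directions_cocompact : ActsCocompactly
    (fun g : GL (BlockIdx p i) ℝ => linkMatrix (g : Matrix (BlockIdx p i) (BlockIdx p i) ℝ))
    endGroup (linkProj '' nbhd)

/-- The weak middle eigenvalue condition `λ̄(g) ≥ λ₁(g) ≥ λ_v(g)`. -/
def WeakMiddleEigenvalueCondition {p i : ℕ} {O : ConvexProjectiveOrbifold (BlockIdx p i)}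
    (E : NPCCEnd O) : Prop :=
  ∀ g ∈ E.endGroup, lambdaOne (g : Matrix (BlockIdx p i) (BlockIdx p i) ℝ) ≤ lambdaBar g.val ∧
    entryA9 (g : Matrix (BlockIdx p i) (BlockIdx p i) ℝ) ≤ lambdaOne g.val

/-- The matrices `𝒩(v)` built from `C₁(v)` and `c₂(v)` form a nilpotent group isomorphic to
`ℝ^i` that is normalized by the end group and acts on the p-end neighborhood.  (By their form they
act trivially on the space of leaves, preserve each hemisphere bounded by `S^{i₀}_∞`, and fix the
end vertex.) -/
structure IsNormalizedCuspGroup {p i : ℕ} {O : ConvexProjectiveOrbifold (BlockIdx p i)}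
    (E : NPCCEnd O) (C : (Fin i → ℝ) →ₗ[ℝ] Matrix (Fin i) (Fin p) ℝ)
    (c : (Fin i → ℝ) → Fin p → ℝ) : Prop where
  continuous : Continuous c
  mul : ∀ v w, cuspMatrix (C v) (c v) v * cuspMatrix (C w) (c w) w =
    cuspMatrix (C (v + w)) (c (v + w)) (v + w)
  normalized : ∀ g ∈ E.endGroup, ∀ v, ∃ w,
    (g : Matrix (BlockIdx p i) (BlockIdx p i) ℝ) * cuspMatrix (C v) (c v) v =
      cuspMatrix (C w) (c w) w * (g : Matrix (BlockIdx p i) (BlockIdx p i) ℝ)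
  acts : ∀ v, (fun x => (cuspMatrix (C v) (c v) v).mulVec x) '' E.nbhd = E.nbhd

/-- `a₁(g)` is the largest eigenvalue of the semisimple part of `g`. -/
def IsTopA1 {p i : ℕ} (M : Matrix (BlockIdx p i) (BlockIdx p i) ℝ) : Prop :=
  (entryA1 M : ℂ) ∈ spectrum ℂ ((semisimplePart M).map Complex.ofReal) ∧
    ∀ r ∈ eigenvalueNorms (semisimplePart M), r ≤ entryA1 M

end

/-!
Write `Ω` for the domain, `Γ` for the end group, `V` for the span of `K''`, and `α` for the linear
form on `ℝ^(n-i₀)` that vanishes on `V` and is `1` on the apex.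

*The separating element.* The apex is one of the indecomposable factors of the cone over the leaf
space, so that the virtual center contains elements acting on `V` and on the apex by different
scalars.  The determinant of `Ŝ(g) - c` on `V`, where `c` is the factor on the apex, is a
homogeneous polynomial, so by Zariski density some central `g₀` acts on each factor by a scalar,
with no factor on `K''` equal to the one on the apex (`exists_separating_of_isZariskiDenseIn`).

*The cusp group.* The map `b ↦ T b`, where `T b v = C₁(v) x + x_k v` for `b = (x, x_k)`, satisfies
`A₅ T(b) A₅ᵀ = a₉ T(Ŝ b)` because the cusp group is normalized.  As `T` of the apex is the identity,
`A₅(g₀)` is a similarity; comparing Frobenius norms, `T` vanishes on every eigenvector of `Ŝ(g₀)` in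
`K''`.  Hence `T b = α b • 1` (`IsNormalizedCuspGroup.cuspForm_eq`).  It follows that `Γ` preserves
`V` and the apex and acts on the fibers by similarities, and that a shear of the `ℝ^(i₀)`-coordinates
makes `C₁`, `c₂` of the cusp group and `C₁` of `Γ` vanish (`IsNormalizedCuspGroup.exists_isAdapted`).

*The last coordinate.* If `a₁(g₀) ≠ a₉(g₀)`, then `g₀` acts on `ℝ^(i₀)` with a unique fixed point,
which is fixed by `Γ`; this contradicts the cocompact and properly discontinuous action on the space
of directions (`IsAdapted.entryA1_eq_entryA9`).  So `a₉(g₀)` is not an eigenvalue of `Ŝ(g₀)` on `V`,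
the vector `c₂(g₀)` can be removed by a shear, and then `c₂(g) = 0` for every `g` in `Γ`, as `g`
commutes with `g₀` (`IsAdapted.exists_shear`).

*The boundary.* Over a point `b` of the leaf space, the convex hull of the p-end neighborhood, cut
down by the cusp group, is a half-line in the last coordinate.  By cocompactness and the weak middle
eigenvalue condition its end point grows at most linearly when `b` goes to infinity in a direction
of `K''` with fixed height (`IsAdapted.exists_doubling`), so that each `s` in `K''` has a lift to the
closed hull.  Powers of `g₀` contract the last coordinate of the lift relative to the eigenvectors in
`K''`, so the lift with vanishing last coordinate is in the closure of `Ω`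
(`IsAdapted.shearVec_mem_hull`).  It is not in `Ω`, since infinitely many elements of `Γ` return the
lift of an interior point of `K''` to a compact set (`IsAdapted.shearVec_mem_frontier`).
-/

noncomputable section

/-! ### Properly convex cones and spectral bounds -/

namespace IsProperlyConvexCone

variable {κ : Type*} {C : Set (κ → ℝ)}

theorem add_mem (hC : IsProperlyConvexCone C) {x y : κ → ℝ} (hx : x ∈ C) (hy : y ∈ C) :
    x + y ∈ C := by
  have h := hC.convex hx hy (a := 1 / 2) (b := 1 / 2) (by norm_num) (by norm_num) (by norm_num)
  have h2 := hC.smul_mem 2 (by norm_num) _ h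
  convert h2 using 1
  module

theorem closure_smul_mem (hC : IsProperlyConvexCone C) {r : ℝ} (hr : 0 < r) {x : κ → ℝ}
    (hx : x ∈ closure C) : r • x ∈ closure C :=
  map_mem_closure (continuous_const_smul r) hx fun y hy => hC.smul_mem r hr y hy

theorem zero_mem_closure (hC : IsProperlyConvexCone C) : (0 : κ → ℝ) ∈ closure C := by
  obtain ⟨x, hx⟩ := hC.nonempty
  have h : Filter.Tendsto (fun n : ℕ => (1 / ((n : ℝ) + 1)) • x) Filter.atTop (nhds ((0 : ℝ) • x)) :=
    tendsto_one_div_add_atTop_nhds_zero_nat.smul_const x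
  rw [zero_smul] at h
  exact mem_closure_of_tendsto h
    (Filter.Eventually.of_forall fun n => hC.smul_mem _ (by positivity) x hx)

theorem closure_smul_mem_of_nonneg (hC : IsProperlyConvexCone C) {r : ℝ} (hr : 0 ≤ r) {x : κ → ℝ}
    (hx : x ∈ closure C) : r • x ∈ closure C := by
  rcases hr.eq_or_lt with rfl | hr
  · rw [zero_smul]
    exact hC.zero_mem_closure
  · exact hC.closure_smul_mem hr hx

theorem closure_add_mem (hC : IsProperlyConvexCone C) {x y : κ → ℝ} (hx : x ∈ closure C)
    (hy : y ∈ closure C) : x + y ∈ closure C :=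
  map_mem_closure₂ continuous_add hx hy fun _ ha _ hb => hC.add_mem ha hb

/-- An open convex set is the interior of its closure. -/
theorem interior_closure [Finite κ] (hC : IsProperlyConvexCone C) :
    interior (closure C) = C := by
  have := Fintype.ofFinite κ
  rw [hC.convex.interior_closure_eq_interior_of_nonempty_interior
    (by rw [hC.isOpen.interior_eq]; exact hC.nonempty), hC.isOpen.interior_eq]

theorem sum_mem_closure {ι : Type*} (s : Finset ι) (hC : IsProperlyConvexCone C)
    {f : ι → κ → ℝ} (hf : ∀ j ∈ s, f j ∈ closure C) : ∑ j ∈ s, f j ∈ closure C := by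
  classical
  induction s using Finset.induction_on with
  | empty => simpa using hC.zero_mem_closure
  | insert a s ha ih =>
    rw [Finset.sum_insert ha]
    exact hC.closure_add_mem (hf a (by simp)) (ih fun j hj => hf j (by simp [hj]))

/-- The order interval `[-b, b]` of a pointed closed cone is bounded. -/
theorem exists_norm_le_of_mem_closure [Fintype κ] (hC : IsProperlyConvexCone C) (b : κ → ℝ) :
    ∃ R : ℝ, ∀ z, b + z ∈ closure C → b - z ∈ closure C → ‖z‖ ≤ R := by
  by_contra! hcon
  choose z hz1 hz2 hz3 using fun n : ℕ => hcon (n + 1)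
  have hpos : ∀ n, 0 < ‖z n‖ := fun n => lt_trans (by positivity) (hz3 n)
  have hu : ∀ n, (‖z n‖⁻¹ • z n) ∈ Metric.sphere (0 : κ → ℝ) 1 := fun n => by
    simp [norm_smul, (hpos n).ne']
  obtain ⟨u, hu1, φ, hφ, hlim⟩ := (isCompact_sphere (0 : κ → ℝ) 1).tendsto_subseq hu
  have hinv : Filter.Tendsto (fun n => ‖z (φ n)‖⁻¹) Filter.atTop (nhds 0) := by
    refine Filter.Tendsto.comp tendsto_inv_atTop_zero ?_
    refine Filter.tendsto_atTop_mono (fun n => ?_)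
      ((tendsto_natCast_atTop_atTop (R := ℝ)).comp hφ.tendsto_atTop)
    have := hz3 (φ n)
    simp only [Function.comp]
    linarith
  have hb : Filter.Tendsto (fun n => ‖z (φ n)‖⁻¹ • b) Filter.atTop (nhds ((0 : ℝ) • b)) :=
    hinv.smul_const b
  have h1 : u ∈ closure C := by
    have := hb.add hlim
    rw [zero_smul, zero_add] at this
    refine isClosed_closure.mem_of_tendsto this (Filter.Eventually.of_forall fun n => ?_)
    have := hC.closure_smul_mem (inv_pos.2 (hpos (φ n))) (hz1 (φ n))
    rwa [smul_add] at this
  have h2 : -u ∈ closure C := by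
    have := hb.sub hlim
    rw [zero_smul, zero_sub] at this
    refine isClosed_closure.mem_of_tendsto this (Filter.Eventually.of_forall fun n => ?_)
    have := hC.closure_smul_mem (inv_pos.2 (hpos (φ n))) (hz2 (φ n))
    rwa [smul_sub] at this
  have := hC.pointed u h1 h2
  simp [this] at hu1

end IsProperlyConvexCone

/-- A matrix that preserves a properly convex cone and multiplies an interior vector `b` by at
most `c`, for the order of the cone, has powers of order `c ^ n`: the order unit norm defined by
`b` is equivalent to the given one. -/
theorem exists_norm_pow_mulVec_le {κ : Type*} [Fintype κ] [DecidableEq κ] {C : Set (κ → ℝ)}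
    (hC : IsProperlyConvexCone C) {M : Matrix κ κ ℝ} (hM : ∀ x ∈ closure C, M.mulVec x ∈ closure C)
    {b : κ → ℝ} (hb : b ∈ C) {c : ℝ} (hc : 0 < c) (hMb : c • b - M.mulVec b ∈ closure C) :
    ∃ R : ℝ, 0 ≤ R ∧ ∀ (n : ℕ) (x : κ → ℝ), ‖(M ^ n).mulVec x‖ ≤ R * c ^ n * ‖x‖ := by
  obtain ⟨R, hR⟩ := hC.exists_norm_le_of_mem_closure b
  obtain ⟨δ, hδ, hball⟩ := Metric.isOpen_iff.1 hC.isOpen b hb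
  have hpow : ∀ (n : ℕ), ∀ x ∈ closure C, (M ^ n).mulVec x ∈ closure C := by
    intro n
    induction n with
    | zero => simp
    | succ n ih =>
      intro x hx
      rw [pow_succ, ← Matrix.mulVec_mulVec]
      exact ih _ (hM x hx)
  have hpowb : ∀ n : ℕ, c ^ n • b - (M ^ n).mulVec b ∈ closure C := by
    intro n
    induction n with
    | zero => simpa using hC.zero_mem_closure
    | succ n ih =>
      have h1 := hC.closure_smul_mem hc ih
      have h2 := hpow n _ hMb
      have := hC.closure_add_mem h1 h2
      rw [Matrix.mulVec_sub, Matrix.mulVec_smul, Matrix.mulVec_mulVec, ← pow_succ] at this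
      convert this using 1
      rw [pow_succ' c, mul_smul]
      module
  -- Vectors of norm below `δ` stay in the order interval `[-c ^ n • b, c ^ n • b]`.
  have key : ∀ (n : ℕ) (x : κ → ℝ), ‖x‖ < δ → ‖(M ^ n).mulVec x‖ ≤ R * c ^ n := by
    intro n x hx
    have hp : b + x ∈ closure C := subset_closure (hball (by simpa [dist_eq_norm] using hx))
    have hm : b - x ∈ closure C := subset_closure (hball (by simpa [dist_eq_norm] using hx))
    have hcn : 0 < c ^ n := pow_pos hc n
    have h := hR ((c ^ n)⁻¹ • (M ^ n).mulVec x) ?_ ?_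
    · rw [norm_smul, Real.norm_of_nonneg (by positivity)] at h
      rw [inv_mul_le_iff₀ hcn] at h
      linarith
    · have := hC.closure_smul_mem (inv_pos.2 hcn) (hC.closure_add_mem (hpowb n) (hpow n _ hp))
      rw [Matrix.mulVec_add] at this
      convert this using 1
      rw [← add_assoc, sub_add_cancel, smul_add, inv_smul_smul₀ hcn.ne']
    · have := hC.closure_smul_mem (inv_pos.2 hcn) (hC.closure_add_mem (hpowb n) (hpow n _ hm))
      rw [Matrix.mulVec_sub] at this
      convert this using 1
      rw [sub_add_sub_cancel, smul_sub, inv_smul_smul₀ hcn.ne']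
  have hR0 : 0 ≤ R := by simpa using key 0 0 (by simpa using hδ)
  refine ⟨2 * R / δ, by positivity, fun n x => ?_⟩
  rcases eq_or_ne x 0 with rfl | hx
  · simp
  have hx' : 0 < ‖x‖ := norm_pos_iff.2 hx
  have h := key n ((δ / (2 * ‖x‖)) • x) (by
    rw [norm_smul, Real.norm_of_nonneg (by positivity)]
    field_simp
    linarith)
  rw [Matrix.mulVec_smul, norm_smul, Real.norm_of_nonneg (by positivity), div_mul_eq_mul_div,
    div_le_iff₀ (by positivity)] at h
  rw [div_mul_eq_mul_div, div_mul_eq_mul_div, le_div_iff₀ hδ]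
  linarith

theorem map_ofReal_mulVec {κ κ' : Type*} [Fintype κ'] (M : Matrix κ κ' ℝ)
    (u v : κ' → ℝ) :
    (M.map Complex.ofReal).mulVec (fun j => (u j : ℂ) + v j * Complex.I) =
      fun j => ((M.mulVec u j : ℝ) : ℂ) + (M.mulVec v j : ℝ) * Complex.I := by
  ext j
  simp only [Matrix.mulVec, dotProduct, Matrix.map_apply, mul_add, Finset.sum_add_distrib,
    Complex.ofReal_sum, Complex.ofReal_mul, Finset.sum_mul]
  congr 1
  exact Finset.sum_congr rfl fun k _ => by ring

/-- The eigenvalues of a matrix that preserves a properly convex cone are bounded by any factor by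
which it expands an interior vector, for the order of the cone. -/
theorem norm_le_of_hasEigenvalue_of_cone {κ : Type*} [Fintype κ] [DecidableEq κ]
    {C : Set (κ → ℝ)} (hC : IsProperlyConvexCone C) {M : Matrix κ κ ℝ}
    (hM : ∀ x ∈ closure C, M.mulVec x ∈ closure C)
    {b : κ → ℝ} (hb : b ∈ C) {c : ℝ} (hc : 0 < c) (hMb : c • b - M.mulVec b ∈ closure C)
    {z : ℂ} (hz : Module.End.HasEigenvalue (Matrix.toLin' (M.map Complex.ofReal)) z) :
    ‖z‖ ≤ c := by
  obtain ⟨R, hR0, hR⟩ := exists_norm_pow_mulVec_le hC hM hb hc hMb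
  obtain ⟨w, hw⟩ := hz.exists_hasEigenvector
  have hw0 : w ≠ 0 := hw.2
  have hwn : 0 < ‖w‖ := norm_pos_iff.2 hw0
  set u : κ → ℝ := fun j => (w j).re
  set v : κ → ℝ := fun j => (w j).im
  have hwuv : w = fun j => (u j : ℂ) + v j * Complex.I := by
    ext j
    exact (Complex.re_add_im (w j)).symm
  have hmap : ∀ n : ℕ, (M ^ n).map Complex.ofReal = (M.map Complex.ofReal) ^ n := fun n =>
    map_pow (Complex.ofRealHom.mapMatrix) M n
  have hwn' : ∀ n : ℕ, ((M ^ n).map Complex.ofReal).mulVec w = z ^ n • w := by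
    intro n
    rw [hmap]
    have h1 : (M.map Complex.ofReal).mulVec w = z • w := by
      have := hw.apply_eq_smul
      rwa [Matrix.toLin'_apply] at this
    induction n with
    | zero => simp
    | succ n ih =>
      rw [pow_succ, ← Matrix.mulVec_mulVec, h1, Matrix.mulVec_smul, ih, smul_smul, pow_succ' z]
  have hbound : ∀ n : ℕ, ‖z‖ ^ n * ‖w‖ ≤ (R * (‖u‖ + ‖v‖)) * c ^ n := by
    intro n
    have h1 : ‖z‖ ^ n * ‖w‖ = ‖((M ^ n).map Complex.ofReal).mulVec w‖ := by
      rw [hwn', norm_smul, norm_pow]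
    rw [h1, hwuv, map_ofReal_mulVec]
    refine (pi_norm_le_iff_of_nonneg (by positivity)).2 fun j => ?_
    refine (norm_add_le _ _).trans ?_
    rw [norm_mul, Complex.norm_I, mul_one, Complex.norm_real, Complex.norm_real]
    have h2 := (norm_le_pi_norm ((M ^ n).mulVec u) j).trans (hR n u)
    have h3 := (norm_le_pi_norm ((M ^ n).mulVec v) j).trans (hR n v)
    linarith
  by_contra! hcon
  have hq : 1 < ‖z‖ / c := (one_lt_div hc).2 hcon
  obtain ⟨n, hn⟩ := pow_unbounded_of_one_lt (R * (‖u‖ + ‖v‖) / ‖w‖) hq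
  rw [div_pow, div_lt_div_iff₀ hwn (by positivity)] at hn
  exact absurd (hbound n) (not_le.2 hn)

section Affiliated

variable {p i : ℕ}

theorem IsStandardForm.semisimplePart_projK {M : Matrix (BlockIdx p i) (BlockIdx p i) ℝ}
    (hM : IsStandardForm M) (x : BlockIdx p i → ℝ) :
    projK p i (M.mulVec x) = (semisimplePart M).mulVec (projK p i x) := by
  ext j
  have h : ∀ k, M (Sum.inl j) (Sum.inr k) = 0 := fun k => congrFun (congrFun hM.1 j) k
  simp [projK, LinearMap.funLeft_apply, Matrix.mulVec, dotProduct, Fintype.sum_sum_type,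
    semisimplePart, Matrix.toBlocks₁₁, h]

/-- A norm affiliated with a vector outside `S^{i₀}_∞` is the norm of an eigenvalue of the
semisimple part. -/
theorem exists_hasEigenvalue_of_isAffiliated {M : Matrix (BlockIdx p i) (BlockIdx p i) ℝ}
    (hM : IsStandardForm M) {x : BlockIdx p i → ℝ} {r : ℝ} (hx : projK p i x ≠ 0)
    (hr : IsAffiliated M x r) :
    ∃ z : ℂ, ‖z‖ = r ∧ Module.End.HasEigenvalue
      (Matrix.toLin' ((semisimplePart M).map Complex.ofReal)) z := by
  by_contra! hcon
  set f := Matrix.toLin' (M.map Complex.ofReal)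
  set f' := Matrix.toLin' ((semisimplePart M).map Complex.ofReal)
  let π : (BlockIdx p i → ℂ) →ₗ[ℂ] (Fin p ⊕ Unit → ℂ) := LinearMap.funLeft ℂ ℂ Sum.inl
  have hinter : ∀ y, π (f y) = f' (π y) := by
    intro y
    ext j
    have h : ∀ k, M (Sum.inl j) (Sum.inr k) = 0 := fun k => congrFun (congrFun hM.1 j) k
    simp [π, f, f', LinearMap.funLeft_apply, Matrix.mulVec, dotProduct, Fintype.sum_sum_type,
      semisimplePart, Matrix.toBlocks₁₁, h]
  have hpow : ∀ (z : ℂ) (n : ℕ) (y), π (((f - algebraMap ℂ _ z) ^ n) y) =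
      ((f' - algebraMap ℂ _ z) ^ n) (π y) := by
    intro z n
    induction n with
    | zero => simp
    | succ n ih =>
      intro y
      rw [pow_succ, pow_succ, Module.End.mul_apply, Module.End.mul_apply, ih]
      simp [hinter, Module.algebraMap_end_apply]
  have hle : (⨆ z ∈ {z : ℂ | ‖z‖ = r}, Module.End.maxGenEigenspace f z) ≤ LinearMap.ker π := by
    refine iSup₂_le fun z hz y hy => ?_
    rw [Module.End.mem_maxGenEigenspace] at hy
    obtain ⟨k, hk⟩ := hy
    have hk' : ((f' - algebraMap ℂ _ z) ^ k) (π y) = 0 := by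
      rw [← hpow]
      have : ((f - algebraMap ℂ _ z) ^ k) y = 0 := hk
      rw [this, map_zero]
    have hinj : Function.Injective (f' - algebraMap ℂ (Module.End ℂ (Fin p ⊕ Unit → ℂ)) z) := by
      rw [← LinearMap.ker_eq_bot]
      have h1 := hcon z hz
      rw [Module.End.hasEigenvalue_iff, not_not, Module.End.eigenspace_def] at h1
      exact h1
    have hinjk : Function.Injective ((f' - algebraMap ℂ (Module.End ℂ (Fin p ⊕ Unit → ℂ)) z) ^ k) := by
      rw [Module.End.coe_pow]
      exact hinj.iterate k
    rw [LinearMap.mem_ker]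
    exact hinjk (by rw [hk', map_zero])
  have h0 := hle hr
  rw [LinearMap.mem_ker] at h0
  apply hx
  ext j
  have := congrFun h0 j
  simpa [π, projK, LinearMap.funLeft_apply] using this

end Affiliated

/-! ### The strict join of the apex and `K''` -/

/-- The vector `[0, …, 0, 1]` spanning the ray `k`. -/
def apex (p : ℕ) : Fin p ⊕ Unit → ℝ := Pi.single (Sum.inr ()) 1

theorem mem_apexRay_iff {p : ℕ} {x : Fin p ⊕ Unit → ℝ} :
    x ∈ apexRay p ↔ ∃ t : ℝ, 0 ≤ t ∧ x = t • apex p := by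
  have h : ∀ t : ℝ, t • apex p = Pi.single (Sum.inr ()) t := fun t => by
    rw [apex, ← Pi.single_smul, smul_eq_mul, mul_one]
  simp only [apexRay, h, Set.mem_ofPred_eq]

theorem apex_mem_apexRay {p : ℕ} : apex p ∈ apexRay p :=
  mem_apexRay_iff.2 ⟨1, zero_le_one, (one_smul _ _).symm⟩

/-- `α` is the coordinate along the apex in the strict join of the apex ray and `K''`. -/
structure IsJoinHeight {p : ℕ} (L K'' : Set (Fin p ⊕ Unit → ℝ))
    (α : (Fin p ⊕ Unit → ℝ) →ₗ[ℝ] ℝ) : Prop where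
  properlyConvex : IsProperlyConvexCone L
  apply_apex : α (apex p) = 1
  mem_span_iff : ∀ s, s ∈ Submodule.span ℝ K'' ↔ α s = 0
  mem_iff : ∀ s, s ∈ K'' ↔ s ∈ closure L ∧ α s = 0
  nonneg : ∀ b ∈ closure L, 0 ≤ α b
  base_mem : ∀ b ∈ closure L, b - α b • apex p ∈ K''
  add_mem : ∀ s ∈ K'', ∀ t : ℝ, 0 ≤ t → s + t • apex p ∈ closure L

theorem exists_isJoinHeight {p : ℕ} {L K'' : Set (Fin p ⊕ Unit → ℝ)}
    (hL : IsProperlyConvexCone L) (hj : IsStrictJoin (apexRay p) K'' (closure L)) :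
    ∃ α, IsJoinHeight L K'' α := by
  obtain ⟨hdis, hsum⟩ := hj
  have hne : apex p ∉ Submodule.span ℝ K'' := by
    intro h
    have := Submodule.disjoint_def.1 hdis _ (Submodule.subset_span apex_mem_apexRay) h
    have := congrFun this (Sum.inr ())
    simp [apex] at this
  obtain ⟨f, hf1, hf2⟩ := Submodule.exists_le_ker_of_notMem hne
  have hα1 : ((f (apex p))⁻¹ • f) (apex p) = 1 := by simp [hf1]
  have hα0 : ∀ s ∈ Submodule.span ℝ K'', ((f (apex p))⁻¹ • f) s = 0 := fun s hs => by
    have : f s = 0 := hf2 hs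
    simp [this]
  set α := (f (apex p))⁻¹ • f
  have hdecomp : ∀ b ∈ closure L, ∃ t : ℝ, 0 ≤ t ∧ ∃ s ∈ K'', b = t • apex p + s ∧ α b = t := by
    intro b hb
    rw [hsum] at hb
    obtain ⟨x, hx, s, hs, rfl⟩ := hb
    obtain ⟨t, ht, rfl⟩ := mem_apexRay_iff.1 hx
    exact ⟨t, ht, s, hs, rfl, by simp [hα1, hα0 s (Submodule.subset_span hs)]⟩
  have hadd : ∀ s ∈ K'', ∀ t : ℝ, 0 ≤ t → s + t • apex p ∈ closure L := by
    intro s hs t ht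
    rw [hsum, add_comm s]
    exact ⟨_, mem_apexRay_iff.2 ⟨t, ht, rfl⟩, _, hs, rfl⟩
  have htop : Submodule.span ℝ K'' ⊔ Submodule.span ℝ {apex p} = ⊤ := by
    apply Submodule.eq_top_of_nonempty_interior'
    refine hL.nonempty.mono (interior_maximal (fun b hb => ?_) hL.isOpen)
    obtain ⟨t, -, s, hs, rfl, -⟩ := hdecomp b (subset_closure hb)
    exact add_mem (Submodule.mem_sup_right (Submodule.smul_mem _ _ (Submodule.mem_span_singleton_self _)))
      (Submodule.mem_sup_left (Submodule.subset_span hs))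
  refine ⟨α, hL, hα1, fun s => ⟨hα0 s, fun h => ?_⟩, fun s => ⟨fun h => ⟨?_, ?_⟩, fun h => ?_⟩, ?_, ?_,
    hadd⟩
  · have hs : s ∈ Submodule.span ℝ K'' ⊔ Submodule.span ℝ {apex p} := htop ▸ Submodule.mem_top
    obtain ⟨v, hv, w, hw, rfl⟩ := Submodule.mem_sup.1 hs
    obtain ⟨t, rfl⟩ := Submodule.mem_span_singleton.1 hw
    have : t = 0 := by simpa [hα0 v hv, hα1] using h
    simpa [this] using hv
  · simpa using hadd s h 0 le_rfl
  · exact hα0 s (Submodule.subset_span h)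
  · obtain ⟨t, -, u, hu, rfl, h2⟩ := hdecomp s h.1
    rw [h.2] at h2
    simpa [← h2] using hu
  · intro b hb
    obtain ⟨t, ht, s, hs, rfl, h2⟩ := hdecomp b hb
    rwa [h2]
  · intro b hb
    obtain ⟨t, ht, s, hs, rfl, h2⟩ := hdecomp b hb
    rw [h2]
    simpa using hs

namespace IsJoinHeight

variable {p : ℕ} {L K'' : Set (Fin p ⊕ Unit → ℝ)} {α : (Fin p ⊕ Unit → ℝ) →ₗ[ℝ] ℝ}

theorem subset_closure (h : IsJoinHeight L K'' α) {s} (hs : s ∈ K'') : s ∈ closure L :=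
  ((h.mem_iff s).1 hs).1

theorem apply_eq_zero (h : IsJoinHeight L K'' α) {s} (hs : s ∈ K'') : α s = 0 :=
  ((h.mem_iff s).1 hs).2

theorem zero_mem (h : IsJoinHeight L K'' α) : (0 : Fin p ⊕ Unit → ℝ) ∈ K'' :=
  (h.mem_iff 0).2 ⟨h.properlyConvex.zero_mem_closure, map_zero α⟩

theorem smul_mem (h : IsJoinHeight L K'' α) {r : ℝ} (hr : 0 ≤ r) {s} (hs : s ∈ K'') :
    r • s ∈ K'' :=
  (h.mem_iff _).2 ⟨h.properlyConvex.closure_smul_mem_of_nonneg hr (h.subset_closure hs),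
    by simp [h.apply_eq_zero hs]⟩

theorem add_mem' (h : IsJoinHeight L K'' α) {s t} (hs : s ∈ K'') (ht : t ∈ K'') :
    s + t ∈ K'' :=
  (h.mem_iff _).2 ⟨h.properlyConvex.closure_add_mem (h.subset_closure hs) (h.subset_closure ht),
    by simp [h.apply_eq_zero hs, h.apply_eq_zero ht]⟩

theorem apex_mem (h : IsJoinHeight L K'' α) : apex p ∈ closure L := by
  simpa using h.add_mem 0 h.zero_mem 1 zero_le_one

theorem mem_span_range (h : IsJoinHeight L K'' α) (b : Fin p ⊕ Unit → ℝ) :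
    b - α b • apex p ∈ Submodule.span ℝ K'' := by
  rw [h.mem_span_iff]
  simp [h.apply_apex]

/-- Rescaling the height by a positive factor preserves the open cone. -/
theorem scale_mem (h : IsJoinHeight L K'' α) {b} (hb : b ∈ L) {r : ℝ} (hr : 0 < r) :
    b - α b • apex p + (r * α b) • apex p ∈ L := by
  -- The rescaling is a linear homeomorphism that preserves the closure of the cone.
  have hα : Continuous α := α.continuous_of_finiteDimensional
  let F : ℝ → (Fin p ⊕ Unit → ℝ) → (Fin p ⊕ Unit → ℝ) := fun r b =>
    b - α b • apex p + (r * α b) • apex p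
  have hF : ∀ r, Continuous (F r) := fun r => by fun_prop
  have hcl : ∀ r : ℝ, 0 < r → ∀ b ∈ closure L, F r b ∈ closure L := fun r hr b hb =>
    h.add_mem _ (h.base_mem b hb) _ (mul_nonneg hr.le (h.nonneg b hb))
  have hinv : ∀ r : ℝ, 0 < r → ∀ b, F r⁻¹ (F r b) = b := by
    intro r hr b
    simp only [F, map_add, map_sub, map_smul, h.apply_apex, smul_eq_mul]
    have : r⁻¹ * (α b - α b * 1 + r * α b * 1) = α b := by field_simp; ring
    rw [this]
    module
  have hopen : IsOpen (F r⁻¹ ⁻¹' L) := h.properlyConvex.isOpen.preimage (hF _)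
  have hsub : F r⁻¹ ⁻¹' L ⊆ closure L := fun x hx => by
    have := hcl r hr _ (_root_.subset_closure hx)
    have h2 := hinv r⁻¹ (inv_pos.2 hr) x
    rw [inv_inv] at h2
    rwa [h2] at this
  have := interior_maximal hsub hopen (show F r b ∈ _ by
    rw [Set.mem_preimage, hinv r hr b]
    exact hb)
  rwa [h.properlyConvex.interior_closure] at this

theorem pos (h : IsJoinHeight L K'' α) {b} (hb : b ∈ L) : 0 < α b := by
  have hcont : Continuous fun t : ℝ => b - t • apex p := by fun_prop
  have h1 : ∀ᶠ t in nhds (0 : ℝ), b - t • apex p ∈ L :=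
    hcont.continuousAt.eventually (h.properlyConvex.isOpen.mem_nhds (by simpa using hb))
  obtain ⟨ε, hε, hball⟩ := Metric.eventually_nhds_iff.1 h1
  have h2 := h.nonneg _ (_root_.subset_closure (hball (y := ε / 2) (by
    rw [dist_zero_right, Real.norm_of_nonneg (by positivity)]
    linarith)))
  simp only [map_sub, map_smul, h.apply_apex, smul_eq_mul] at h2
  linarith

end IsJoinHeight

section Decomposition

variable {p l : ℕ} {L K'' : Set (Fin p ⊕ Unit → ℝ)} {α : (Fin p ⊕ Unit → ℝ) →ₗ[ℝ] ℝ}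
  {A : Fin l → Set (Fin p ⊕ Unit → ℝ)}

theorem IsJoinDecomposition.unique (hA : IsJoinDecomposition A (closure L))
    {y z : Fin l → Fin p ⊕ Unit → ℝ} (hy : ∀ j, y j ∈ Submodule.span ℝ (A j))
    (hz : ∀ j, z j ∈ Submodule.span ℝ (A j)) (h : ∑ j, y j = ∑ j, z j) (j) : y j = z j :=
  (iSupIndep_iff_finsetSum_eq_imp_eq _).1 hA.independent Finset.univ y z
    (fun j _ => ⟨hy j, hz j⟩) h j (Finset.mem_univ j)

theorem IsJoinDecomposition.mem_iff (hL : IsProperlyConvexCone L)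
    (hA : IsJoinDecomposition A (closure L)) (j) (x) :
    x ∈ A j ↔ x ∈ closure L ∧ x ∈ Submodule.span ℝ (A j) := by
  have hzero : ∀ j, (0 : Fin p ⊕ Unit → ℝ) ∈ A j := by
    have h0 := hL.zero_mem_closure
    rw [hA.eq_sum] at h0
    obtain ⟨y, hy, hsum⟩ := h0
    intro j
    have := hA.unique (y := y) (z := 0) (fun j => Submodule.subset_span (hy j))
      (fun j => Submodule.zero_mem _) (by simpa using hsum.symm) j
    simpa [this] using hy j
  constructor
  · intro hx
    refine ⟨?_, Submodule.subset_span hx⟩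
    rw [hA.eq_sum]
    refine ⟨Pi.single j x, fun k => ?_, by simp⟩
    rcases eq_or_ne k j with rfl | hk
    · simpa using hx
    · simpa [hk] using hzero k
  · rintro ⟨h1, h2⟩
    rw [hA.eq_sum] at h1
    obtain ⟨y, hy, rfl⟩ := h1
    have := hA.unique (y := y) (z := Pi.single j (∑ j, y j))
      (fun j => Submodule.subset_span (hy j)) (fun k => by
        rcases eq_or_ne k j with rfl | hk
        · simpa using h2
        · simp [hk]) (by simp) j
    rw [Pi.single_eq_same] at this
    rw [← this]
    exact hy j

/-- The decomposition of `{k} * K''` into join-indecomposable factors refines the given join: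
the apex is one of the factors and the others are contained in `K''`. -/
theorem IsJoinDecomposition.exists_eq_apexRay (h : IsJoinHeight L K'' α)
    (hj : Disjoint (Submodule.span ℝ (apexRay p)) (Submodule.span ℝ K''))
    (hA : IsJoinDecomposition A (closure L)) :
    ∃ j₀, A j₀ = apexRay p ∧ ∀ j, j ≠ j₀ → A j ⊆ K'' := by
  have hL := h.properlyConvex
  obtain ⟨y, hy, hsum⟩ := hA.eq_sum ▸ h.apex_mem
  have hyL : ∀ j, y j ∈ closure L := fun j => ((hA.mem_iff hL j _).1 (hy j)).1
  -- The apex ray is extreme, so that all components of the apex are multiples of it.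
  have hmul : ∀ j, y j = α (y j) • apex p := by
    have h0 : ∑ j, (y j - α (y j) • apex p) = 0 := by
      rw [Finset.sum_sub_distrib, ← Finset.sum_smul, ← map_sum, ← hsum, h.apply_apex, one_smul,
        sub_self]
    intro j
    rw [← Finset.add_sum_erase _ _ (Finset.mem_univ j)] at h0
    rw [← sub_eq_zero]
    refine hL.pointed _ (h.subset_closure (h.base_mem _ (hyL j))) ?_
    rw [neg_eq_of_add_eq_zero_right h0]
    exact IsProperlyConvexCone.sum_mem_closure _ hL
      fun k _ => h.subset_closure (h.base_mem _ (hyL k))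
  obtain ⟨j₀, hj₀⟩ : ∃ j, α (y j) ≠ 0 := by
    by_contra! hcon
    have : apex p = 0 := by
      rw [hsum]
      exact Finset.sum_eq_zero fun j _ => by rw [hmul j, hcon j, zero_smul]
    have := congrFun this (Sum.inr ())
    simp [apex] at this
  have hspan : apex p ∈ Submodule.span ℝ (A j₀) := by
    have h1 := Submodule.smul_mem _ (α (y j₀))⁻¹ (Submodule.subset_span (R := ℝ) (hy j₀))
    rw [hmul j₀] at h1
    simpa [h.apply_apex, smul_smul, hj₀] using h1
  have hA₀ : A j₀ = apexRay p := by
    have hstrict : IsStrictJoin (apexRay p) (A j₀ ∩ K'') (A j₀) := by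
      refine ⟨hj.mono_right (Submodule.span_mono Set.inter_subset_right), ?_⟩
      ext x
      constructor
      · intro hx
        have hxL := ((hA.mem_iff hL _ _).1 hx).1
        have hb := h.base_mem x hxL
        refine ⟨_, mem_apexRay_iff.2 ⟨α x, h.nonneg x hxL, rfl⟩, x - α x • apex p, ⟨?_, hb⟩, by simp⟩
        exact (hA.mem_iff hL _ _).2 ⟨h.subset_closure hb,
          Submodule.sub_mem _ (Submodule.subset_span hx) (Submodule.smul_mem _ _ hspan)⟩
      · rintro ⟨u, hu, w, ⟨hw1, hw2⟩, rfl⟩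
        obtain ⟨t, ht, rfl⟩ := mem_apexRay_iff.1 hu
        refine (hA.mem_iff hL _ _).2 ⟨?_, add_mem (Submodule.smul_mem _ _ hspan)
          (Submodule.subset_span hw1)⟩
        show t • apex p + w ∈ _
        rw [add_comm]
        exact h.add_mem w hw2 t ht
    rcases (hA.indecomposable j₀).2 _ _ hstrict with h1 | h1
    · have := h1 apex_mem_apexRay
      have := congrFun (Set.mem_singleton_iff.1 this) (Sum.inr ())
      simp [apex] at this
    · ext x
      constructor
      · intro hx
        rw [hstrict.2] at hx
        obtain ⟨u, hu, w, hw, rfl⟩ := hx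
        have : w = 0 := h1 hw
        simpa [this] using hu
      · intro hx
        obtain ⟨t, ht, rfl⟩ := mem_apexRay_iff.1 hx
        exact (hA.mem_iff hL _ _).2 ⟨hL.closure_smul_mem_of_nonneg ht h.apex_mem,
          Submodule.smul_mem _ _ hspan⟩
  refine ⟨j₀, hA₀, fun j hjne x hx => ?_⟩
  have hxL := ((hA.mem_iff hL _ _).1 hx).1
  have hb := h.base_mem x hxL
  obtain ⟨w, hw, hwsum⟩ := hA.eq_sum ▸ h.subset_closure hb
  have huniq := hA.unique (y := Pi.single j x) (z := w + Pi.single j₀ (α x • apex p))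
    (fun k => by
      rcases eq_or_ne k j with rfl | hk
      · simpa using Submodule.subset_span hx
      · simp [hk])
    (fun k => by
      refine add_mem (Submodule.subset_span (hw k)) ?_
      rcases eq_or_ne k j₀ with rfl | hk
      · simpa using Submodule.smul_mem _ _ hspan
      · simp [hk])
    (by simp [Finset.sum_add_distrib, ← hwsum]) j₀
  rw [Pi.single_eq_of_ne hjne.symm, Pi.add_apply, Pi.single_eq_same] at huniq
  have h1 := congrArg α huniq
  simp only [map_zero, map_add, map_smul, h.apply_apex, smul_eq_mul, mul_one] at h1
  have h2 := h.nonneg _ ((hA.mem_iff hL _ _).1 (hw j₀)).1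
  have h3 := h.nonneg x hxL
  exact (h.mem_iff x).2 ⟨hxL, by linarith⟩

/-- A linear automorphism of the cone that preserves the hyperplane of `K''` fixes the apex. -/
theorem IsJoinHeight.map_apex (h : IsJoinHeight L K'' α)
    (f : (Fin p ⊕ Unit → ℝ) ≃ₗ[ℝ] (Fin p ⊕ Unit → ℝ))
    (hf : ∀ x, f x ∈ closure L ↔ x ∈ closure L) {a : ℝ} (hfα : ∀ x, α (f x) = a * α x) :
    f (apex p) = a • apex p ∧ 0 < a := by
  have hL := h.properlyConvex
  have ha0 : a ≠ 0 := by
    rintro rfl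
    have := hfα (f.symm (apex p))
    rw [f.apply_symm_apply, h.apply_apex, zero_mul] at this
    exact one_ne_zero this
  have hfe := (hf _).2 h.apex_mem
  have hae : α (f (apex p)) = a := by rw [hfα, h.apply_apex, mul_one]
  have ha : 0 < a := lt_of_le_of_ne (hae ▸ h.nonneg _ hfe) ha0.symm
  refine ⟨?_, ha⟩
  -- Both `w` and `-w` are in the closed cone, where `f⁻¹ w` is the `K''`-part of `f⁻¹ apex`.
  have hb := h.base_mem _ hfe
  rw [hae] at hb
  have hg : f.symm (apex p) ∈ closure L := by
    rw [← hf, f.apply_symm_apply]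
    exact h.apex_mem
  have hga : α (f.symm (apex p)) = a⁻¹ := by
    have := hfα (f.symm (apex p))
    rw [f.apply_symm_apply, h.apply_apex] at this
    field_simp
    linarith
  have hb' := (hf _).2 (h.subset_closure (h.base_mem _ hg))
  rw [hga, map_sub, f.apply_symm_apply, map_smul] at hb'
  have hb'' := hL.closure_smul_mem ha hb'
  rw [smul_sub, smul_inv_smul₀ ha0] at hb''
  have := hL.pointed _ (h.subset_closure hb) (by rwa [neg_sub])
  exact sub_eq_zero.1 this

end Decomposition

/-! ### An element of the virtual center separating the apex from `K''` -/

/-- The projection of `ℝ^(p+1)` onto the span of `K''` along the apex. -/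
def baseProj {p : ℕ} (α : (Fin p ⊕ Unit → ℝ) →ₗ[ℝ] ℝ) :
    Matrix (Fin p ⊕ Unit) (Fin p ⊕ Unit) ℝ :=
  1 - Matrix.vecMulVec (apex p) fun b => α (Pi.single b 1)

theorem baseProj_mulVec {p : ℕ} (α : (Fin p ⊕ Unit → ℝ) →ₗ[ℝ] ℝ) (x : Fin p ⊕ Unit → ℝ) :
    (baseProj α).mulVec x = x - α x • apex p := by
  have h : (fun b => α (Pi.single b 1)) ⬝ᵥ x = α x := by
    conv_rhs => rw [pi_eq_sum_univ' x, map_sum]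
    refine Finset.sum_congr rfl fun b _ => ?_
    rw [map_smul, smul_eq_mul, mul_comm]
  rw [baseProj, Matrix.sub_mulVec, Matrix.one_mulVec, Matrix.vecMulVec_mulVec, h]
  ext j
  simp [mul_comm]

/-- A Zariski dense subset of the virtual center contains an element that multiplies the apex by a
positive number `c` which is not an eigenvalue on the span of `K''`. -/
theorem exists_separating_of_isZariskiDenseIn {p : ℕ} {L K'' : Set (Fin p ⊕ Unit → ℝ)}
    {α : (Fin p ⊕ Unit → ℝ) →ₗ[ℝ] ℝ} (h : IsJoinHeight L K'' α)
    (hj : Disjoint (Submodule.span ℝ (apexRay p)) (Submodule.span ℝ K''))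
    {H : Set (Matrix (Fin p ⊕ Unit) (Fin p ⊕ Unit) ℝ)} (hH : H.Nonempty)
    (hd : IsZariskiDenseIn H (virtualCenter (closure L))) :
    ∃ M ∈ H, ∃ (l : ℕ) (A : Fin l → Set (Fin p ⊕ Unit → ℝ)) (c : Fin l → ℝ) (j₀ : Fin l),
      IsJoinDecomposition A (closure L) ∧ (∀ j, 0 < c j) ∧
      (∀ j, ∀ x ∈ A j, M.mulVec x = c j • x) ∧ A j₀ = apexRay p ∧ (∀ j, j ≠ j₀ → A j ⊆ K'') ∧
      ∀ s, α s = 0 → M.mulVec s = c j₀ • s → s = 0 := by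
  classical
  obtain ⟨hsub, hzar⟩ := hd
  set k : Fin p ⊕ Unit := Sum.inr ()
  -- On `M` with `M apex = c • apex`, this polynomial is `det (M - c • baseProj α)`.
  let X : Matrix (Fin p ⊕ Unit) (Fin p ⊕ Unit)
      (MvPolynomial ((Fin p ⊕ Unit) × (Fin p ⊕ Unit)) ℝ) := Matrix.of fun a b =>
    MvPolynomial.X (a, b) - MvPolynomial.C (baseProj α a b) * MvPolynomial.X (k, k)
  have heval : ∀ M : Matrix (Fin p ⊕ Unit) (Fin p ⊕ Unit) ℝ,
      MvPolynomial.eval (fun q => M q.1 q.2) X.det = (M - M k k • baseProj α).det := by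
    intro M
    rw [RingHom.map_det]
    congr 1
    ext a b
    simp [X, mul_comm]
  have hhom : X.det.IsHomogeneous (Fintype.card (Fin p ⊕ Unit)) := by
    rw [Matrix.det_apply]
    refine MvPolynomial.IsHomogeneous.sum _ _ _ fun σ _ => ?_
    have h1 : (∏ a, X (σ a) a).IsHomogeneous (Fintype.card (Fin p ⊕ Unit)) := by
      have := MvPolynomial.IsHomogeneous.prod Finset.univ (fun a => X (σ a) a) (fun _ => 1)
        fun a _ => (MvPolynomial.isHomogeneous_X _ _).sub (MvPolynomial.isHomogeneous_C_mul_X _ _)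
      simpa using this
    rcases Int.units_eq_one_or (Equiv.Perm.sign σ) with h2 | h2
    · simpa [h2] using h1
    · simpa [h2] using h1.neg
  have hex : ∃ M ∈ H, MvPolynomial.eval (fun q => M q.1 q.2) X.det ≠ 0 := by
    by_contra! hcon
    obtain ⟨M₁, hM₁⟩ := hH
    obtain ⟨l, A, -, hA, -, -⟩ := hsub hM₁
    obtain ⟨j₀, hj₀, hjs⟩ := hA.exists_eq_apexRay h hj
    -- The element with factors `1` on the apex and `2` on `K''`.
    have hmem : 1 + baseProj α ∈ virtualCenter (closure L) := by
      refine ⟨l, A, fun j => if j = j₀ then 1 else 2, hA, fun j => ?_, fun j x hx => ?_⟩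
      · dsimp only
        split_ifs <;> norm_num
      · rw [Matrix.add_mulVec, Matrix.one_mulVec, baseProj_mulVec]
        dsimp only
        split_ifs with hjj
        · subst hjj
          rw [hj₀] at hx
          obtain ⟨t, -, rfl⟩ := mem_apexRay_iff.1 hx
          simp [h.apply_apex]
        · rw [h.apply_eq_zero (hjs j hjj hx)]
          module
    have h0 := hzar _ _ hhom hcon _ hmem
    rw [heval] at h0
    have hkk : (1 + baseProj α) k k = 1 := by
      have := congrFun (baseProj_mulVec α (apex p)) k
      rw [h.apply_apex, one_smul, sub_self, apex, Matrix.mulVec_single_one] at this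
      simpa using this
    rw [hkk, one_smul, add_sub_cancel_right, Matrix.det_one] at h0
    exact one_ne_zero h0
  obtain ⟨M, hM, hne⟩ := hex
  obtain ⟨l, A, c, hA, hc, hMA⟩ := hsub hM
  obtain ⟨j₀, hj₀, hjs⟩ := hA.exists_eq_apexRay h hj
  refine ⟨M, hM, l, A, c, j₀, hA, hc, hMA, hj₀, hjs, fun s hs hMs => ?_⟩
  have hMe : M.mulVec (apex p) = c j₀ • apex p := hMA j₀ _ (hj₀ ▸ apex_mem_apexRay)
  have hkk : M k k = c j₀ := by
    have := congrFun hMe k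
    rw [apex, Matrix.mulVec_single_one] at this
    simpa [k] using this
  by_contra hs0
  apply hne
  rw [heval]
  refine Matrix.exists_mulVec_eq_zero_iff.1 ⟨s, hs0, ?_⟩
  rw [Matrix.sub_mulVec, Matrix.smul_mulVec, baseProj_mulVec, hs, hkk, hMs]
  simp

/-! ### The action of the end group on the leaf space and the end vertex -/

namespace NPCCEnd

variable {p i : ℕ} {O : ConvexProjectiveOrbifold (BlockIdx p i)} (E : NPCCEnd O)

theorem mulVec_mem_of_moveSet_eq {κ : Type*} [Fintype κ] [DecidableEq κ] {g : GL κ ℝ}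
    {X : Set (κ → ℝ)} (h : moveSet g X = X) {x : κ → ℝ} : g.val.mulVec x ∈ X ↔ x ∈ X := by
  constructor
  · intro hx
    rw [← h] at hx
    obtain ⟨y, hy, hyx⟩ := hx
    have := congrArg (g⁻¹).val.mulVec hyx
    simp only [Matrix.mulVec_mulVec] at this
    rw [← Units.val_mul, inv_mul_cancel, Units.val_one, Matrix.one_mulVec, Matrix.one_mulVec] at this
    rwa [← this]
  · intro hx
    rw [← h]
    exact ⟨x, hx, rfl⟩

@[simp] theorem projK_elim (b : Fin p ⊕ Unit → ℝ) (y : Fin i ⊕ Unit → ℝ) :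
    projK p i (Sum.elim b y) = b := rfl

theorem mulVec_mem_nbhd {g : GL (BlockIdx p i) ℝ} (hg : g ∈ E.endGroup) {x} :
    g.val.mulVec x ∈ E.nbhd ↔ x ∈ E.nbhd :=
  mulVec_mem_of_moveSet_eq ((E.mem_endGroup g).1 hg).2

theorem mulVec_mem_domain {g : GL (BlockIdx p i) ℝ} (hg : g ∈ E.endGroup) {x} :
    g.val.mulVec x ∈ O.domain ↔ x ∈ O.domain :=
  mulVec_mem_of_moveSet_eq (O.invariant g ((E.mem_endGroup g).1 hg).1)

theorem projK_mem {x : BlockIdx p i → ℝ} (hx : x ∈ E.nbhd) : projK p i x ∈ E.leafSpace := by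
  have : linkProj x ∈ linkProj '' E.nbhd := ⟨x, hx, rfl⟩
  rw [E.directions_eq] at this
  exact this

/-- Every vector over the leaf space is, up to its last coordinate, in the p-end neighborhood. -/
theorem exists_mem_nbhd {b : Fin p ⊕ Unit → ℝ} (hb : b ∈ E.leafSpace) (y : Fin i → ℝ) :
    ∃ z : ℝ, Sum.elim b (Sum.elim y fun _ => z) ∈ E.nbhd := by
  have : (Sum.elim b y : (Fin p ⊕ Unit) ⊕ Fin i → ℝ) ∈ linkProj '' E.nbhd := by
    rw [E.directions_eq]
    show (Sum.elim b y) ∘ Sum.inl ∈ E.leafSpace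
    rwa [Sum.elim_comp_inl]
  obtain ⟨x, hx, hxy⟩ := this
  refine ⟨x (Sum.inr (Sum.inr ())), ?_⟩
  convert hx using 1
  ext j
  rcases j with j | j | j
  · exact (congrFun hxy (Sum.inl j)).symm
  · exact (congrFun hxy (Sum.inr j)).symm
  · rfl

theorem semisimplePart_mem_iff {g : GL (BlockIdx p i) ℝ} (hg : g ∈ E.endGroup)
    {b : Fin p ⊕ Unit → ℝ} : (semisimplePart g.val).mulVec b ∈ E.leafSpace ↔ b ∈ E.leafSpace := by
  have h1 : ∀ g ∈ E.endGroup, ∀ b ∈ E.leafSpace,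
      (semisimplePart g.val).mulVec b ∈ E.leafSpace := by
    intro g hg b hb
    obtain ⟨z, hz⟩ := E.exists_mem_nbhd hb 0
    have := E.projK_mem ((E.mulVec_mem_nbhd hg).2 hz)
    rw [(E.standardForm g hg).semisimplePart_projK] at this
    rwa [projK_elim] at this
  refine ⟨fun h => ?_, h1 g hg b⟩
  have h2 := h1 g⁻¹ (inv_mem hg) _ h
  have h3 : ∀ x : BlockIdx p i → ℝ, (semisimplePart (g⁻¹).val).mulVec
      ((semisimplePart g.val).mulVec (projK p i x)) = projK p i x := by
    intro x
    rw [← (E.standardForm g hg).semisimplePart_projK,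
      ← (E.standardForm _ (inv_mem hg)).semisimplePart_projK, Matrix.mulVec_mulVec,
      ← Units.val_mul, inv_mul_cancel, Units.val_one, Matrix.one_mulVec]
  have h4 := h3 (Sum.elim b 0)
  rw [projK_elim] at h4
  rwa [h4] at h2

/-- The semisimple part of an element of the end group, as a linear automorphism. -/
def semisimpleEquiv {g : GL (BlockIdx p i) ℝ} (hg : g ∈ E.endGroup) :
    (Fin p ⊕ Unit → ℝ) ≃ₗ[ℝ] (Fin p ⊕ Unit → ℝ) :=
  have key : ∀ g ∈ E.endGroup, semisimplePart (g⁻¹).val * semisimplePart g.val = 1 := by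
    intro g hg
    refine Matrix.ext_of_mulVec_single fun j => ?_
    rw [← projK_elim (i := i) (Pi.single j 1) 0, ← Matrix.mulVec_mulVec,
      ← (E.standardForm g hg).semisimplePart_projK,
      ← (E.standardForm _ (inv_mem hg)).semisimplePart_projK, Matrix.mulVec_mulVec,
      ← Units.val_mul, inv_mul_cancel, Units.val_one, Matrix.one_mulVec, Matrix.one_mulVec]
  Matrix.toLin'OfInv (M := semisimplePart (g⁻¹).val) (M' := semisimplePart g.val)
    (key g hg) (by simpa using key _ (inv_mem hg))

@[simp] theorem semisimpleEquiv_apply {g : GL (BlockIdx p i) ℝ} (hg : g ∈ E.endGroup) (b) :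
    E.semisimpleEquiv hg b = (semisimplePart g.val).mulVec b := by
  simp [semisimpleEquiv, Matrix.toLin'OfInv]

theorem semisimplePart_mem_closure_iff {g : GL (BlockIdx p i) ℝ} (hg : g ∈ E.endGroup)
    {b : Fin p ⊕ Unit → ℝ} :
    (semisimplePart g.val).mulVec b ∈ closure E.leafSpace ↔ b ∈ closure E.leafSpace := by
  let f := (E.semisimpleEquiv hg).toContinuousLinearEquiv
  have h1 : f ⁻¹' E.leafSpace = E.leafSpace := Set.ext fun b => by
    rw [Set.mem_preimage]
    exact (E.semisimpleEquiv_apply hg b).symm ▸ E.semisimplePart_mem_iff hg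
  have h2 : f ⁻¹' closure E.leafSpace = closure E.leafSpace := by
    have := f.toHomeomorph.preimage_closure E.leafSpace
    rw [show (f.toHomeomorph ⁻¹' E.leafSpace) = E.leafSpace from h1] at this
    exact this
  rw [← Set.ext_iff.1 h2 b, Set.mem_preimage]
  exact (E.semisimpleEquiv_apply hg b).symm ▸ Iff.rfl

theorem endVertex_mem_closure_nbhd : endVertex p i ∈ closure E.nbhd := by
  obtain ⟨x, hx⟩ := E.nbhd_connected.nonempty
  have h : Filter.Tendsto (fun n : ℕ => (1 / ((n : ℝ) + 1)) • x + endVertex p i) Filter.atTop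
      (nhds ((0 : ℝ) • x + endVertex p i)) :=
    (tendsto_one_div_add_atTop_nhds_zero_nat.smul_const x).add_const _
  rw [zero_smul, zero_add] at h
  refine mem_closure_of_tendsto h (Filter.Eventually.of_forall fun n => ?_)
  have hn : (0 : ℝ) < (n : ℝ) + 1 := by positivity
  have := E.nbhd_smul _ (one_div_pos.2 hn) _ (E.radial x hx _ hn.le)
  rwa [smul_add, smul_smul, one_div_mul_cancel hn.ne', one_smul] at this

theorem endVertex_ne_zero : endVertex p i ≠ 0 := fun h => by
  have := congrFun h (Sum.inr (Sum.inr ()))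
  simp [endVertex] at this

theorem neg_endVertex_notMem (E : NPCCEnd O) : -endVertex p i ∉ closure O.domain := fun h =>
  endVertex_ne_zero (O.properlyConvex.pointed _
    (closure_mono E.nbhd_subset E.endVertex_mem_closure_nbhd) h)

theorem mulVec_endVertex {M : Matrix (BlockIdx p i) (BlockIdx p i) ℝ} (hM : IsStandardForm M) :
    M.mulVec (endVertex p i) = entryA9 M • endVertex p i := by
  rw [endVertex, Matrix.mulVec_single_one]
  ext j
  rcases j with j | j | j
  · simpa [Matrix.toBlocks₁₂] using congrFun (congrFun hM.1 j) (Sum.inr ())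
  · simpa [Matrix.toBlocks₂₂, Matrix.toBlocks₁₂] using congrFun (congrFun hM.2 j) ()
  · simp [entryA9, Matrix.toBlocks₂₂]

theorem entryA9_pos {g : GL (BlockIdx p i) ℝ} (hg : g ∈ E.endGroup) : 0 < entryA9 g.val := by
  have h1 := mulVec_endVertex (E.standardForm g hg)
  have hcl : g.val.mulVec (endVertex p i) ∈ closure O.domain :=
    map_mem_closure (f := fun x => g.val.mulVec x)
      (Continuous.matrix_mulVec continuous_const continuous_id)
      (closure_mono E.nbhd_subset E.endVertex_mem_closure_nbhd)
      fun x hx => (E.mulVec_mem_domain hg).2 hx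
  rw [h1] at hcl
  rcases lt_trichotomy 0 (entryA9 g.val) with h | h | h
  · exact h
  · exfalso
    rw [← h, zero_smul] at h1
    have := congrArg (g⁻¹).val.mulVec h1
    rw [Matrix.mulVec_mulVec, ← Units.val_mul, inv_mul_cancel, Units.val_one, Matrix.one_mulVec,
      Matrix.mulVec_zero] at this
    exact endVertex_ne_zero this
  · exfalso
    have := O.properlyConvex.closure_smul_mem (r := (-entryA9 g.val)⁻¹)
      (inv_pos.2 (by linarith)) hcl
    rw [smul_smul, inv_neg, neg_mul, inv_mul_cancel₀ h.ne, neg_smul, one_smul] at this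
    exact E.neg_endVertex_notMem this

/-- The weak middle eigenvalue condition bounds the eigenvalue at the end vertex by any factor by
which the semisimple part expands an interior vector of the cone over the leaf space. -/
theorem entryA9_le (hmec : WeakMiddleEigenvalueCondition E) {g : GL (BlockIdx p i) ℝ}
    (hg : g ∈ E.endGroup) {b : Fin p ⊕ Unit → ℝ} (hb : b ∈ E.leafSpace) {c : ℝ} (hc : 0 < c)
    (hle : c • b - (semisimplePart g.val).mulVec b ∈ closure E.leafSpace) :
    entryA9 g.val ≤ c := by
  refine (hmec g hg).2.trans (Real.sSup_le ?_ hc.le)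
  rintro r ⟨x, hx, hr⟩
  obtain ⟨z, rfl, hz⟩ := exists_hasEigenvalue_of_isAffiliated (E.standardForm g hg) hx hr
  exact norm_le_of_hasEigenvalue_of_cone E.leafSpace_properlyConvex
    (fun x hx => (E.semisimplePart_mem_closure_iff hg).2 hx) hb hc hle hz

end NPCCEnd

/-! ### The quadratic form of the cusp group -/

section Vectors

variable {p i : ℕ}

/-- The vector with components `b` in `ℝ^(n-i₀)`, `y` in `ℝ^(i₀)` and `z` along the end vertex. -/
def blockVec (b : Fin p ⊕ Unit → ℝ) (y : Fin i → ℝ) (z : ℝ) : BlockIdx p i → ℝ :=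
  Sum.elim b (Sum.elim y fun _ => z)

theorem blockVec_inj {b b' : Fin p ⊕ Unit → ℝ} {y y' : Fin i → ℝ} {z z' : ℝ} :
    blockVec b y z = blockVec b' y' z' ↔ b = b' ∧ y = y' ∧ z = z' := by
  constructor
  · intro h
    exact ⟨funext fun j => congrFun h (Sum.inl j), funext fun j => congrFun h (Sum.inr (Sum.inl j)),
      congrFun h (Sum.inr (Sum.inr ()))⟩
  · rintro ⟨rfl, rfl, rfl⟩
    rfl

theorem exists_eq_blockVec (x : BlockIdx p i → ℝ) :
    ∃ y z, x = blockVec (projK p i x) y z := by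
  refine ⟨fun j => x (Sum.inr (Sum.inl j)), x (Sum.inr (Sum.inr ())), ?_⟩
  ext j
  rcases j with j | j | j <;> rfl

theorem blockVec_add (b b' : Fin p ⊕ Unit → ℝ) (y y' : Fin i → ℝ) (z z' : ℝ) :
    blockVec b y z + blockVec b' y' z' = blockVec (b + b') (y + y') (z + z') := by
  ext j
  rcases j with j | j | j <;> rfl

theorem smul_blockVec (r : ℝ) (b : Fin p ⊕ Unit → ℝ) (y : Fin i → ℝ) (z : ℝ) :
    r • blockVec b y z = blockVec (r • b) (r • y) (r * z) := by
  ext j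
  rcases j with j | j | j <;> rfl

theorem blockVec_zero_zero (z : ℝ) : blockVec 0 0 z = z • endVertex p i := by
  ext j
  rcases j with j | j | j <;> simp [blockVec, endVertex]

/-- The part of `M` that maps the first `n - i₀` coordinates to `ℝ^(i₀)`. -/
def lowerY (M : Matrix (BlockIdx p i) (BlockIdx p i) ℝ) :
    (Fin p ⊕ Unit → ℝ) →ₗ[ℝ] (Fin i → ℝ) :=
  LinearMap.funLeft ℝ ℝ Sum.inl ∘ₗ M.toBlocks₂₁.mulVecLin

/-- The part of `M` that maps the first `n - i₀` coordinates to the end vertex. -/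
def lowerZ (M : Matrix (BlockIdx p i) (BlockIdx p i) ℝ) :
    (Fin p ⊕ Unit → ℝ) →ₗ[ℝ] ℝ :=
  LinearMap.proj (Sum.inr ()) ∘ₗ M.toBlocks₂₁.mulVecLin

/-- The block `a₈`. -/
def blockA8 (M : Matrix (BlockIdx p i) (BlockIdx p i) ℝ) : Fin i → ℝ :=
  M.toBlocks₂₂.toBlocks₂₁ ()

theorem IsStandardForm.mulVec_blockVec {M : Matrix (BlockIdx p i) (BlockIdx p i) ℝ}
    (hM : IsStandardForm M) (b : Fin p ⊕ Unit → ℝ) (y : Fin i → ℝ) (z : ℝ) :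
    M.mulVec (blockVec b y z) = blockVec ((semisimplePart M).mulVec b)
      (lowerY M b + (blockA5 M).mulVec y) (lowerZ M b + blockA8 M ⬝ᵥ y + entryA9 M * z) := by
  have h1 : ∀ j k, M (Sum.inl j) (Sum.inr k) = 0 := fun j k => congrFun (congrFun hM.1 j) k
  have h2 : ∀ j k, M (Sum.inr (Sum.inl j)) (Sum.inr (Sum.inr k)) = 0 :=
    fun j k => congrFun (congrFun hM.2 j) k
  ext j
  rcases j with j | j | j
  · simp [blockVec, Matrix.mulVec, dotProduct, Fintype.sum_sum_type, semisimplePart,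
      Matrix.toBlocks₁₁, h1]
  · simp [blockVec, Matrix.mulVec, dotProduct, Fintype.sum_sum_type, lowerY, blockA5,
      Matrix.toBlocks₂₁, Matrix.toBlocks₂₂, Matrix.toBlocks₁₁, LinearMap.funLeft_apply, h2]
  · simp [blockVec, Matrix.mulVec, dotProduct, Fintype.sum_sum_type, lowerZ, blockA8, entryA9,
      Matrix.toBlocks₂₁, Matrix.toBlocks₂₂, add_assoc]

/-- The quadratic form `b ↦ T b`, where `T b v = C₁(v) x + x_k v` for `b = (x, x_k)`: up to terms
of lower order, `𝒩(v)` translates a point over `b` by `T b v` in `ℝ^(i₀)` and by `⟨v, T b v⟩ / 2`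
along the end vertex. -/
def cuspForm (C : (Fin i → ℝ) →ₗ[ℝ] Matrix (Fin i) (Fin p) ℝ) :
    (Fin p ⊕ Unit → ℝ) →ₗ[ℝ] Matrix (Fin i) (Fin i) ℝ :=
  LinearMap.toMatrix'.toLinearMap ∘ₗ
    { toFun := fun b =>
        { toFun := fun v => (C v).mulVec (b ∘ Sum.inl) + b (Sum.inr ()) • v
          map_add' := fun v w => by
            rw [map_add, Matrix.add_mulVec, smul_add]
            abel
          map_smul' := fun r v => by
            rw [map_smul, Matrix.smul_mulVec, smul_comm, smul_add, RingHom.id_apply] }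
      map_add' := fun b b' => by
        ext1 v
        ext k
        simp only [LinearMap.coe_comp, LinearMap.coe_single, LinearMap.coe_mk, AddHom.coe_mk,
          Function.comp_apply, LinearMap.add_apply, Pi.add_apply, Pi.smul_apply, smul_eq_mul]
        rw [show (b + b') ∘ Sum.inl = b ∘ Sum.inl + b' ∘ Sum.inl from rfl, Matrix.mulVec_add,
          Pi.add_apply]
        ring
      map_smul' := fun r b => by
        ext1 v
        ext k
        simp only [LinearMap.coe_comp, LinearMap.coe_single, LinearMap.coe_mk, AddHom.coe_mk,
          Function.comp_apply, LinearMap.smul_apply, Pi.add_apply, Pi.smul_apply, smul_eq_mul,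
          RingHom.id_apply]
        rw [show (r • b) ∘ Sum.inl = r • (b ∘ Sum.inl) from rfl, Matrix.mulVec_smul,
          Pi.smul_apply, smul_eq_mul]
        ring }

theorem cuspForm_mulVec (C : (Fin i → ℝ) →ₗ[ℝ] Matrix (Fin i) (Fin p) ℝ)
    (b : Fin p ⊕ Unit → ℝ) (v : Fin i → ℝ) :
    (cuspForm C b).mulVec v = (C v).mulVec (b ∘ Sum.inl) + b (Sum.inr ()) • v := by
  rw [cuspForm, LinearMap.comp_apply, LinearEquiv.coe_coe, LinearMap.toMatrix'_mulVec]
  rfl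

theorem cuspForm_apex (C : (Fin i → ℝ) →ₗ[ℝ] Matrix (Fin i) (Fin p) ℝ) :
    cuspForm C (apex p) = 1 := by
  refine Matrix.ext_of_mulVec_single fun j => ?_
  have : apex p ∘ Sum.inl = 0 := by
    ext k
    simp [apex]
  rw [cuspForm_mulVec, this, Matrix.mulVec_zero, Matrix.one_mulVec]
  simp [apex]

theorem cuspMatrix_mulVec (C : (Fin i → ℝ) →ₗ[ℝ] Matrix (Fin i) (Fin p) ℝ)
    (c : (Fin i → ℝ) → Fin p → ℝ) (v : Fin i → ℝ) (b : Fin p ⊕ Unit → ℝ) (y : Fin i → ℝ) (z : ℝ) :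
    (cuspMatrix (C v) (c v) v).mulVec (blockVec b y z) = blockVec b (y + (cuspForm C b).mulVec v)
      (z + v ⬝ᵥ y + c v ⬝ᵥ (b ∘ Sum.inl) + (v ⬝ᵥ v) / 2 * b (Sum.inr ())) := by
  rw [cuspForm_mulVec]
  have hv : ∑ j, v j ^ 2 = v ⬝ᵥ v := Finset.sum_congr rfl fun j _ => pow_two (v j)
  ext j
  rcases j with j | j | j
  · simp [blockVec, cuspMatrix, Matrix.fromBlocks_mulVec]
  · simp [blockVec, cuspMatrix, Matrix.mulVec, dotProduct, Matrix.one_apply]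
    ring
  · simp [blockVec, cuspMatrix, Matrix.mulVec, dotProduct, hv]
    simp only [← pow_two]
    ring

end Vectors

namespace IsNormalizedCuspGroup

variable {p i : ℕ} {O : ConvexProjectiveOrbifold (BlockIdx p i)} {E : NPCCEnd O}
  {C : (Fin i → ℝ) →ₗ[ℝ] Matrix (Fin i) (Fin p) ℝ} {c : (Fin i → ℝ) → Fin p → ℝ}

theorem cocycle_add (hN : IsNormalizedCuspGroup E C c) (v w : Fin i → ℝ) (b : Fin p ⊕ Unit → ℝ) :
    c (v + w) ⬝ᵥ (b ∘ Sum.inl) =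
      c v ⬝ᵥ (b ∘ Sum.inl) + c w ⬝ᵥ (b ∘ Sum.inl) + v ⬝ᵥ (cuspForm C b).mulVec w -
        b (Sum.inr ()) * (v ⬝ᵥ w) := by
  have h := congrArg (fun M => M.mulVec (blockVec b 0 0)) (hN.mul v w)
  simp only [← Matrix.mulVec_mulVec, cuspMatrix_mulVec] at h
  obtain ⟨-, -, h⟩ := blockVec_inj.1 h
  simp only [dotProduct_add, add_dotProduct, dotProduct_zero, dotProduct_comm w v] at h
  linarith

/-- Conjugation by `g` transports the cusp group by the transpose inverse of `A₅(g)`. -/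
theorem exists_conj (hN : IsNormalizedCuspGroup E C c) {g : GL (BlockIdx p i) ℝ}
    (hg : g ∈ E.endGroup) (v : Fin i → ℝ) : ∃ w,
    (g : Matrix (BlockIdx p i) (BlockIdx p i) ℝ) * cuspMatrix (C v) (c v) v =
      cuspMatrix (C w) (c w) w * (g : Matrix (BlockIdx p i) (BlockIdx p i) ℝ) ∧
    (blockA5 g.val).transpose.mulVec w = entryA9 g.val • v ∧
    ∀ b, (blockA5 g.val).mulVec ((cuspForm C b).mulVec v) =
      (cuspForm C ((semisimplePart g.val).mulVec b)).mulVec w := by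
  obtain ⟨w, hw⟩ := hN.normalized g hg v
  have hst := E.standardForm g hg
  refine ⟨w, hw, ?_, fun b => ?_⟩
  · refine dotProduct_eq _ _ fun y => ?_
    have h := congrArg (fun M => M.mulVec (blockVec 0 y 0)) hw
    simp only [← Matrix.mulVec_mulVec, cuspMatrix_mulVec, hst.mulVec_blockVec] at h
    obtain ⟨-, -, h⟩ := blockVec_inj.1 h
    simp only [map_zero, Matrix.mulVec_zero, Matrix.zero_mulVec, add_zero, zero_add,
      Pi.zero_apply, mul_zero, Pi.zero_comp, dotProduct_zero] at h
    rw [smul_dotProduct, smul_eq_mul, Matrix.mulVec_transpose, ← Matrix.dotProduct_mulVec]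
    linarith
  · have h := congrArg (fun M => M.mulVec (blockVec b 0 0)) hw
    simp only [← Matrix.mulVec_mulVec, cuspMatrix_mulVec, hst.mulVec_blockVec] at h
    obtain ⟨-, h, -⟩ := blockVec_inj.1 h
    simpa only [zero_add, Matrix.mulVec_zero, add_zero, add_right_inj] using h

theorem transpose_mulVec_injective (hN : IsNormalizedCuspGroup E C c) {g : GL (BlockIdx p i) ℝ}
    (hg : g ∈ E.endGroup) : Function.Injective (blockA5 g.val).transpose.mulVecLin := by
  refine LinearMap.injective_iff_surjective.2 fun v => ?_
  obtain ⟨w, -, hw, -⟩ := hN.exists_conj hg ((entryA9 g.val)⁻¹ • v)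
  rw [smul_inv_smul₀ (E.entryA9_pos hg).ne'] at hw
  exact ⟨w, hw⟩

/-- Every `w` is the transport of some `v` under conjugation by `g`. -/
theorem exists_conj_eq (hN : IsNormalizedCuspGroup E C c) {g : GL (BlockIdx p i) ℝ}
    (hg : g ∈ E.endGroup) (w : Fin i → ℝ) : ∃ v,
    (g : Matrix (BlockIdx p i) (BlockIdx p i) ℝ) * cuspMatrix (C v) (c v) v =
      cuspMatrix (C w) (c w) w * (g : Matrix (BlockIdx p i) (BlockIdx p i) ℝ) ∧
    (blockA5 g.val).transpose.mulVec w = entryA9 g.val • v ∧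
    ∀ b, (blockA5 g.val).mulVec ((cuspForm C b).mulVec v) =
      (cuspForm C ((semisimplePart g.val).mulVec b)).mulVec w := by
  set v := (entryA9 g.val)⁻¹ • (blockA5 g.val).transpose.mulVec w with hv
  obtain ⟨w', h1, h2, h3⟩ := hN.exists_conj hg v
  have hw : w' = w := by
    apply hN.transpose_mulVec_injective hg
    rw [Matrix.mulVecLin_apply, Matrix.mulVecLin_apply, h2, hv,
      smul_inv_smul₀ (E.entryA9_pos hg).ne']
  subst hw
  exact ⟨v, h1, h2, h3⟩

/-- Equivariance of the quadratic form of the cusp group. -/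
theorem cuspForm_equivariant (hN : IsNormalizedCuspGroup E C c) {g : GL (BlockIdx p i) ℝ}
    (hg : g ∈ E.endGroup) (b : Fin p ⊕ Unit → ℝ) :
    blockA5 g.val * cuspForm C b * (blockA5 g.val).transpose =
      entryA9 g.val • cuspForm C ((semisimplePart g.val).mulVec b) := by
  refine Matrix.ext_of_mulVec_single fun j => ?_
  obtain ⟨v, -, h2, h3⟩ := hN.exists_conj_eq hg (Pi.single j 1)
  rw [← Matrix.mulVec_mulVec, h2, Matrix.mulVec_smul, ← Matrix.mulVec_mulVec, h3,
    Matrix.smul_mulVec]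

/-- The elements of the end group that fix the apex act on `ℝ^(i₀)` by similarities. -/
theorem blockA5_similarity (hN : IsNormalizedCuspGroup E C c) {g : GL (BlockIdx p i) ℝ}
    (hg : g ∈ E.endGroup) {a : ℝ} (ha : (semisimplePart g.val).mulVec (apex p) = a • apex p) :
    blockA5 g.val * (blockA5 g.val).transpose = (a * entryA9 g.val) • 1 := by
  have := hN.cuspForm_equivariant hg (apex p)
  rw [ha, map_smul, cuspForm_apex, mul_one, smul_smul, mul_comm _ a] at this
  exact this

end IsNormalizedCuspGroup

theorem transpose_mul_self_of_mul_transpose {i : ℕ} {A : Matrix (Fin i) (Fin i) ℝ} {r : ℝ}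
    (hr : r ≠ 0) (h : A * A.transpose = r • 1) : A.transpose * A = r • 1 := by
  have h1 : A * (r⁻¹ • A.transpose) = 1 := by
    rw [Matrix.mul_smul, h, smul_smul, inv_mul_cancel₀ hr, one_smul]
  have h2 := mul_eq_one_comm.1 h1
  rw [Matrix.smul_mul] at h2
  rw [← h2, smul_smul, mul_inv_cancel₀ hr, one_smul]

/-- A similarity of ratio `√r` multiplies the squared Frobenius norm of `T` by `r ^ 2` when it acts
by congruence, so that `T` vanishes if it is scaled by a different factor. -/
theorem eq_zero_of_congruence_eq_smul {i : ℕ} {A T : Matrix (Fin i) (Fin i) ℝ} {r s : ℝ}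
    (hr : 0 < r) (hs : 0 < s) (hrs : s ≠ r) (hA : A * A.transpose = r • 1)
    (h : A * T * A.transpose = s • T) : T = 0 := by
  have hA' := transpose_mul_self_of_mul_transpose hr.ne' hA
  have h1 : (A * T * A.transpose) * (A * T * A.transpose).transpose =
      r • (A * (T * T.transpose) * A.transpose) := by
    rw [Matrix.transpose_mul, Matrix.transpose_mul, Matrix.transpose_transpose]
    calc A * T * A.transpose * (A * (T.transpose * A.transpose))
        = A * T * (A.transpose * A) * T.transpose * A.transpose := by simp only [Matrix.mul_assoc]
      _ = _ := by rw [hA']; simp [Matrix.mul_assoc]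
  have h2 : (A * (T * T.transpose) * A.transpose).trace = r * (T * T.transpose).trace := by
    rw [Matrix.trace_mul_comm, ← Matrix.mul_assoc, hA']
    simp
  have h3 := congrArg Matrix.trace h1
  rw [h, Matrix.trace_smul, h2, Matrix.transpose_smul, Matrix.smul_mul, Matrix.mul_smul,
    Matrix.trace_smul, Matrix.trace_smul] at h3
  simp only [smul_eq_mul] at h3
  have h4 : (T * T.transpose).trace = 0 := by
    have : (s ^ 2 - r ^ 2) * (T * T.transpose).trace = 0 := by linarith
    rcases mul_eq_zero.1 this with h | h
    · exfalso
      apply hrs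
      have : (s - r) * (s + r) = 0 := by linarith
      rcases mul_eq_zero.1 this with h | h <;> linarith
    · exact h
  rw [← Matrix.conjTranspose_eq_transpose_of_trivial] at h4
  exact Matrix.trace_mul_conjTranspose_self_eq_zero_iff.1 h4

/-! ### Coordinates adapted to the cusp group -/

section Adapted

variable {p i : ℕ} {O : ConvexProjectiveOrbifold (BlockIdx p i)} {E : NPCCEnd O}
  {C : (Fin i → ℝ) →ₗ[ℝ] Matrix (Fin i) (Fin p) ℝ} {c : (Fin i → ℝ) → Fin p → ℝ}
  {K'' : Set (Fin p ⊕ Unit → ℝ)} {α : (Fin p ⊕ Unit → ℝ) →ₗ[ℝ] ℝ}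

/-- `g` is an element of the end group acting on each factor of the join as a scalar, by a factor
on the apex that differs from those on `K''`. -/
structure IsSeparating (E : NPCCEnd O) (K'' : Set (Fin p ⊕ Unit → ℝ))
    (α : (Fin p ⊕ Unit → ℝ) →ₗ[ℝ] ℝ) (g : GL (BlockIdx p i) ℝ) : Prop where
  mem : g ∈ E.endGroup
  map_apex : ∃ a : ℝ, 0 < a ∧ (semisimplePart g.val).mulVec (apex p) = a • apex p
  /-- Every vector of `K''` is a sum of eigenvectors in `K''`. -/
  exists_sum : ∀ s ∈ K'', ∃ (l : ℕ) (y : Fin l → Fin p ⊕ Unit → ℝ) (r : Fin l → ℝ),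
    s = ∑ j, y j ∧ ∀ j, y j ∈ K'' ∧ 0 < r j ∧ (semisimplePart g.val).mulVec (y j) = r j • y j
  separated : ∀ (s : Fin p ⊕ Unit → ℝ) (a : ℝ), α s = 0 →
    (semisimplePart g.val).mulVec (apex p) = a • apex p →
    (semisimplePart g.val).mulVec s = a • s → s = 0

theorem apex_ne_zero : apex p ≠ 0 := fun h => by
  have := congrFun h (Sum.inr ())
  simp [apex] at this

theorem exists_isSeparating (h : IsJoinHeight E.leafSpace K'' α)
    (hj : Disjoint (Submodule.span ℝ (apexRay p)) (Submodule.span ℝ K''))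
    (hcenter : ∃ Z : Subgroup E.endGroup, Z ≤ Subgroup.center E.endGroup ∧
      IsZariskiDenseIn ((fun g : E.endGroup => semisimplePart g.val.val) '' Z)
        (virtualCenter (closure E.leafSpace))) :
    ∃ g, IsSeparating E K'' α g ∧ ∀ g' ∈ E.endGroup, g * g' = g' * g := by
  obtain ⟨Z, hZ, hd⟩ := hcenter
  obtain ⟨_, ⟨g, hg, rfl⟩, l, A, r, j₀, hA, hr, hM, hA₀, hAK, hsep⟩ :=
    exists_separating_of_isZariskiDenseIn h hj (Set.Nonempty.image _ ⟨1, Z.one_mem⟩) hd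
  have hapex := hM j₀ _ (hA₀ ▸ apex_mem_apexRay)
  refine ⟨g.val, ⟨g.2, ⟨r j₀, hr j₀, hapex⟩, fun s hs => ?_, fun s a hs ha hsa => ?_⟩,
    fun g' hg' => ?_⟩
  · obtain ⟨y, hy, hsum⟩ := hA.eq_sum ▸ h.subset_closure hs
    obtain ⟨t, ht, hyt⟩ := mem_apexRay_iff.1 (hA₀ ▸ hy j₀)
    -- The component of `s` along the apex vanishes, by comparison of heights.
    have hyj : y j₀ = 0 := by
      have h0 := h.apply_eq_zero hs
      rw [hsum, map_sum, ← Finset.add_sum_erase _ _ (Finset.mem_univ j₀),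
        Finset.sum_eq_zero (s := Finset.univ.erase j₀) fun k hk =>
          h.apply_eq_zero (hAK k (Finset.ne_of_mem_erase hk) (hy k)), hyt, map_smul,
        h.apply_apex] at h0
      have : t = 0 := by simpa using h0
      rw [hyt, this, zero_smul]
    refine ⟨l, y, r, hsum, fun j => ⟨?_, hr j, hM j _ (hy j)⟩⟩
    rcases eq_or_ne j j₀ with rfl | hjj
    · rw [hyj]
      exact h.zero_mem
    · exact hAK j hjj (hy j)
  · have : a = r j₀ := smul_left_injective ℝ apex_ne_zero (ha.symm.trans hapex)
    exact hsep s hs (this ▸ hsa)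
  · have := Subgroup.mem_center_iff.1 (hZ hg) ⟨g', hg'⟩
    exact (congrArg Subtype.val this).symm

theorem one_ne_zero_matrix (E : NPCCEnd O) : (1 : Matrix (Fin i) (Fin i) ℝ) ≠ 0 := fun h => by
  have := congrFun (congrFun h ⟨0, E.fiberDim_pos⟩) ⟨0, E.fiberDim_pos⟩
  simp at this

/-- The quadratic form of the cusp group vanishes on `K''`, because a separating element scales
its values on each factor of the join by a factor other than that of the similarity `A₅`. -/
theorem IsNormalizedCuspGroup.cuspForm_eq (hN : IsNormalizedCuspGroup E C c)
    (h : IsJoinHeight E.leafSpace K'' α) {g : GL (BlockIdx p i) ℝ} (hg : IsSeparating E K'' α g)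
    (b : Fin p ⊕ Unit → ℝ) : cuspForm C b = α b • 1 := by
  obtain ⟨a, ha, hapex⟩ := hg.map_apex
  have h9 := E.entryA9_pos hg.mem
  have hsim := hN.blockA5_similarity hg.mem hapex
  have hK : K'' ⊆ LinearMap.ker (cuspForm C) := by
    intro s hs
    obtain ⟨l, y, r, rfl, hy⟩ := hg.exists_sum s hs
    rw [SetLike.mem_coe, LinearMap.mem_ker, map_sum]
    refine Finset.sum_eq_zero fun j _ => ?_
    obtain ⟨hyK, hr, hyr⟩ := hy j
    rcases eq_or_ne (r j) a with hra | hra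
    · rw [hg.separated (y j) a (h.apply_eq_zero hyK) hapex (hra ▸ hyr), map_zero]
    · have heq := hN.cuspForm_equivariant hg.mem (y j)
      rw [hyr, map_smul, smul_smul] at heq
      refine eq_zero_of_congruence_eq_smul (mul_pos ha h9) (mul_pos h9 hr) (fun h' => hra ?_)
        hsim heq
      rw [mul_comm] at h'
      exact mul_right_cancel₀ h9.ne' h'
  have hspan : Submodule.span ℝ K'' ≤ LinearMap.ker (cuspForm C) := Submodule.span_le.2 hK
  have := hspan (h.mem_span_range b)
  rw [LinearMap.mem_ker, map_sub, map_smul, cuspForm_apex, sub_eq_zero] at this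
  exact this

/-- The semisimple parts preserve the join. -/
theorem IsNormalizedCuspGroup.semisimplePart_join (hN : IsNormalizedCuspGroup E C c)
    (h : IsJoinHeight E.leafSpace K'' α) (hT : ∀ b, cuspForm C b = α b • 1)
    {g : GL (BlockIdx p i) ℝ} (hg : g ∈ E.endGroup) :
    (semisimplePart g.val).mulVec (apex p) = entryA1 g.val • apex p ∧ 0 < entryA1 g.val ∧
      ∀ b, α ((semisimplePart g.val).mulVec b) = entryA1 g.val * α b := by
  have h9 := E.entryA9_pos hg
  set a := α ((semisimplePart g.val).mulVec (apex p))
  have heq := fun b => hN.cuspForm_equivariant hg b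
  simp only [hT, Matrix.mul_smul, Matrix.smul_mul, mul_one, smul_smul] at heq
  have h1 := heq (apex p)
  rw [h.apply_apex, one_smul] at h1
  have hα : ∀ b, α ((semisimplePart g.val).mulVec b) = a * α b := by
    intro b
    have h2 := heq b
    rw [h1, smul_smul] at h2
    have h3 := smul_left_injective ℝ (one_ne_zero_matrix E) h2
    exact mul_left_cancel₀ h9.ne' (by linarith)
  obtain ⟨h2, h3⟩ := h.map_apex (E.semisimpleEquiv hg) (a := a)
    (fun x => by rw [E.semisimpleEquiv_apply, E.semisimplePart_mem_closure_iff hg])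
    (fun x => by rw [E.semisimpleEquiv_apply, hα])
  rw [E.semisimpleEquiv_apply] at h2
  have h4 : entryA1 g.val = a := by
    have := congrFun h2 (Sum.inr ())
    rw [apex, Matrix.mulVec_single_one] at this
    simpa [entryA1, semisimplePart, Matrix.toBlocks₂₂, Matrix.toBlocks₁₁] using this
  rw [h4]
  exact ⟨h2, h3, hα⟩

/-- The part of `c₂` that is linear in `v` is represented by a linear map to `ℝ^(i₀)`. -/
theorem IsNormalizedCuspGroup.exists_shift (hN : IsNormalizedCuspGroup E C c)
    (hα : α (apex p) = 1) (hT : ∀ b, cuspForm C b = α b • 1) :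
    ∃ D : (Fin p ⊕ Unit → ℝ) →ₗ[ℝ] (Fin i → ℝ), D (apex p) = 0 ∧ ∀ v b, v ⬝ᵥ D b =
      c v ⬝ᵥ (b ∘ Sum.inl) + (v ⬝ᵥ v) / 2 * (b (Sum.inr ()) - α b) := by
  let f : (Fin p ⊕ Unit → ℝ) → (Fin i → ℝ) → ℝ := fun b v =>
    c v ⬝ᵥ (b ∘ Sum.inl) + (v ⬝ᵥ v) / 2 * (b (Sum.inr ()) - α b)
  have hadd : ∀ b v w, f b (v + w) = f b v + f b w := by
    intro b v w
    simp only [f, hN.cocycle_add, hT, Matrix.smul_mulVec, Matrix.one_mulVec, dotProduct_smul,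
      add_dotProduct, dotProduct_add, smul_eq_mul, dotProduct_comm w v]
    ring
  have hcont : ∀ b, Continuous (f b) := fun b => by
    have := hN.continuous
    simp only [f, dotProduct]
    fun_prop
  let F : (Fin p ⊕ Unit → ℝ) → (Fin i → ℝ) →L[ℝ] ℝ := fun b =>
    (AddMonoidHom.mk' (f b) (hadd b)).toRealLinearMap (hcont b)
  have hF : ∀ b v, F b v = f b v := fun b v => rfl
  refine ⟨{ toFun := fun b j => F b (Pi.single j 1), map_add' := fun b b' => ?_,
            map_smul' := fun r b => ?_ }, ?_, fun v b => ?_⟩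
  · ext j
    simp only [hF, f, Pi.add_apply, map_add]
    rw [show (b + b') ∘ Sum.inl = b ∘ Sum.inl + b' ∘ Sum.inl from rfl, dotProduct_add]
    ring
  · ext j
    simp only [hF, f, Pi.smul_apply, map_smul, smul_eq_mul, RingHom.id_apply]
    rw [show (r • b) ∘ Sum.inl = r • (b ∘ Sum.inl) from rfl, dotProduct_smul, smul_eq_mul]
    ring
  · ext j
    have : apex p ∘ Sum.inl = 0 := by
      ext k
      simp [apex]
    simp [hF, f, this, hα]
    simp [apex]
  · have := LinearMap.pi_apply_eq_sum_univ (F b).toLinearMap v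
    simp only [ContinuousLinearMap.coe_coe, hF] at this
    change _ = f b v
    rw [this]
    refine Finset.sum_congr rfl fun j _ => ?_
    rw [smul_eq_mul]
    congr 1
    show f b _ = f b _
    congr 1
    ext k
    simp [Pi.single_apply, eq_comm]

/-- The vector with coordinates `b`, `y`, `z` after the change of coordinates
`(b, y, z) ↦ (b, y + D b, z + d b)`. -/
def shearVec (D : (Fin p ⊕ Unit → ℝ) →ₗ[ℝ] (Fin i → ℝ)) (d : (Fin p ⊕ Unit → ℝ) →ₗ[ℝ] ℝ)
    (b : Fin p ⊕ Unit → ℝ) (y : Fin i → ℝ) (z : ℝ) : BlockIdx p i → ℝ :=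
  blockVec b (y - D b) (z - d b)

/-- The linear map by which `M` contributes to the last of the sheared coordinates. -/
def shearLowerZ (D : (Fin p ⊕ Unit → ℝ) →ₗ[ℝ] (Fin i → ℝ)) (d : (Fin p ⊕ Unit → ℝ) →ₗ[ℝ] ℝ)
    (M : Matrix (BlockIdx p i) (BlockIdx p i) ℝ) : (Fin p ⊕ Unit → ℝ) →ₗ[ℝ] ℝ :=
  lowerZ M - (dotProductBilin ℝ ℝ (blockA8 M)) ∘ₗ D - entryA9 M • d + d ∘ₗ (semisimplePart M).mulVecLin

/-- `α` and `D` define coordinates in which the cusp group and the end group have the standard form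
with vanishing `C₁`, and the cusp group has vanishing `c₂` as well. -/
structure IsAdapted (E : NPCCEnd O) (C : (Fin i → ℝ) →ₗ[ℝ] Matrix (Fin i) (Fin p) ℝ)
    (c : (Fin i → ℝ) → Fin p → ℝ) (K'' : Set (Fin p ⊕ Unit → ℝ))
    (α : (Fin p ⊕ Unit → ℝ) →ₗ[ℝ] ℝ) (D : (Fin p ⊕ Unit → ℝ) →ₗ[ℝ] (Fin i → ℝ)) : Prop where
  height : IsJoinHeight E.leafSpace K'' α
  map_apex : ∀ g ∈ E.endGroup,
    (semisimplePart g.val).mulVec (apex p) = entryA1 g.val • apex p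
  entryA1_pos : ∀ g ∈ E.endGroup, 0 < entryA1 g.val
  height_map : ∀ g ∈ E.endGroup, ∀ b,
    α ((semisimplePart g.val).mulVec b) = entryA1 g.val * α b
  similarity : ∀ g ∈ E.endGroup,
    blockA5 g.val * (blockA5 g.val).transpose = (entryA1 g.val * entryA9 g.val) • 1
  cusp_mulVec : ∀ d v b y z, (cuspMatrix (C v) (c v) v).mulVec (shearVec D d b y z) =
    shearVec D d b (y + α b • v) (z + v ⬝ᵥ y + (v ⬝ᵥ v) / 2 * α b)
  mulVec : ∀ g ∈ E.endGroup, ∀ d b y z, g.val.mulVec (shearVec D d b y z) =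
    shearVec D d ((semisimplePart g.val).mulVec b)
      (α b • lowerY g.val (apex p) + (blockA5 g.val).mulVec y)
      (shearLowerZ D d g.val b + blockA8 g.val ⬝ᵥ y + entryA9 g.val * z)

theorem shearVec_inj {D : (Fin p ⊕ Unit → ℝ) →ₗ[ℝ] (Fin i → ℝ)} {d : (Fin p ⊕ Unit → ℝ) →ₗ[ℝ] ℝ}
    {b b' : Fin p ⊕ Unit → ℝ} {y y' : Fin i → ℝ} {z z' : ℝ} :
    shearVec D d b y z = shearVec D d b' y' z' ↔ b = b' ∧ y = y' ∧ z = z' := by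
  rw [shearVec, shearVec, blockVec_inj]
  constructor
  · rintro ⟨rfl, h1, h2⟩
    exact ⟨rfl, sub_left_injective h1, sub_left_injective h2⟩
  · rintro ⟨rfl, rfl, rfl⟩
    exact ⟨rfl, rfl, rfl⟩

theorem shearVec_add (D : (Fin p ⊕ Unit → ℝ) →ₗ[ℝ] (Fin i → ℝ)) (d : (Fin p ⊕ Unit → ℝ) →ₗ[ℝ] ℝ)
    (b b' : Fin p ⊕ Unit → ℝ) (y y' : Fin i → ℝ) (z z' : ℝ) :
    shearVec D d b y z + shearVec D d b' y' z' = shearVec D d (b + b') (y + y') (z + z') := by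
  simp only [shearVec, blockVec_add, map_add]
  congr 1 <;> abel

theorem smul_shearVec (D : (Fin p ⊕ Unit → ℝ) →ₗ[ℝ] (Fin i → ℝ)) (d : (Fin p ⊕ Unit → ℝ) →ₗ[ℝ] ℝ)
    (r : ℝ) (b : Fin p ⊕ Unit → ℝ) (y : Fin i → ℝ) (z : ℝ) :
    r • shearVec D d b y z = shearVec D d (r • b) (r • y) (r * z) := by
  simp only [shearVec, smul_blockVec, map_smul, smul_sub, mul_sub, smul_eq_mul]

theorem exists_eq_shearVec (D : (Fin p ⊕ Unit → ℝ) →ₗ[ℝ] (Fin i → ℝ))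
    (d : (Fin p ⊕ Unit → ℝ) →ₗ[ℝ] ℝ) (x : BlockIdx p i → ℝ) :
    ∃ y z, x = shearVec D d (projK p i x) y z := by
  obtain ⟨y, z, h⟩ := exists_eq_blockVec x
  refine ⟨y + D (projK p i x), z + d (projK p i x), ?_⟩
  rw [shearVec, add_sub_cancel_right, add_sub_cancel_right]
  exact h

theorem shearVec_zero_zero (D : (Fin p ⊕ Unit → ℝ) →ₗ[ℝ] (Fin i → ℝ))
    (d : (Fin p ⊕ Unit → ℝ) →ₗ[ℝ] ℝ) (z : ℝ) : shearVec D d 0 0 z = z • endVertex p i := by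
  simp [shearVec, blockVec_zero_zero]

theorem IsNormalizedCuspGroup.exists_isAdapted (hN : IsNormalizedCuspGroup E C c)
    (h : IsJoinHeight E.leafSpace K'' α) {g₀ : GL (BlockIdx p i) ℝ}
    (hg₀ : IsSeparating E K'' α g₀) : ∃ D, IsAdapted E C c K'' α D := by
  have hT := hN.cuspForm_eq h hg₀
  obtain ⟨D, hD0, hD⟩ := hN.exists_shift h.apply_apex hT
  have hcusp : ∀ d v b y z, (cuspMatrix (C v) (c v) v).mulVec (shearVec D d b y z) =
      shearVec D d b (y + α b • v) (z + v ⬝ᵥ y + (v ⬝ᵥ v) / 2 * α b) := by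
    intro d v b y z
    rw [shearVec, cuspMatrix_mulVec, shearVec, blockVec_inj]
    refine ⟨rfl, ?_, ?_⟩
    · rw [hT, Matrix.smul_mulVec, Matrix.one_mulVec]
      abel
    · rw [dotProduct_sub, hD]
      ring
  have hmul : ∀ g ∈ E.endGroup, ∀ d b y z, g.val.mulVec (shearVec D d b y z) =
      shearVec D d ((semisimplePart g.val).mulVec b)
        (lowerY g.val b - (blockA5 g.val).mulVec (D b) + D ((semisimplePart g.val).mulVec b) +
          (blockA5 g.val).mulVec y)
        (shearLowerZ D d g.val b + blockA8 g.val ⬝ᵥ y + entryA9 g.val * z) := by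
    intro g hg d b y z
    rw [shearVec, (E.standardForm g hg).mulVec_blockVec, shearVec, blockVec_inj]
    refine ⟨rfl, ?_, ?_⟩
    · rw [Matrix.mulVec_sub]
      abel
    · simp only [shearLowerZ, LinearMap.add_apply, LinearMap.sub_apply, LinearMap.smul_apply,
        LinearMap.comp_apply, dotProductBilin_apply_apply, dotProduct_sub, smul_eq_mul,
        Matrix.mulVecLin_apply]
      ring
  have hjoin := fun g hg => hN.semisimplePart_join h hT (g := g) hg
  refine ⟨D, h, fun g hg => (hjoin g hg).1, fun g hg => (hjoin g hg).2.1,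
    fun g hg => (hjoin g hg).2.2, fun g hg => hN.blockA5_similarity hg (hjoin g hg).1, hcusp, ?_⟩
  intro g hg d b y z
  rw [hmul g hg, shearVec_inj]
  refine ⟨rfl, ?_, rfl⟩
  congr 1
  -- On the span of `K''`, the image in `ℝ^(i₀)` is orthogonal to all `w` because the cusp group
  -- is normalized.
  let F : (Fin p ⊕ Unit → ℝ) →ₗ[ℝ] (Fin i → ℝ) :=
    lowerY g.val - (blockA5 g.val).mulVecLin ∘ₗ D + D ∘ₗ (semisimplePart g.val).mulVecLin
  have hF : ∀ b, F b = lowerY g.val b - (blockA5 g.val).mulVec (D b) +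
      D ((semisimplePart g.val).mulVec b) := fun b => rfl
  have hker : ∀ s, α s = 0 → F s = 0 := by
    intro s hs
    have hαS : α ((semisimplePart g.val).mulVec s) = 0 := by rw [(hjoin g hg).2.2, hs, mul_zero]
    refine dotProduct_self_eq_zero.1 ?_
    obtain ⟨v, hv, -, -⟩ := hN.exists_conj_eq hg (F s)
    have h1 := congrArg (fun M => M.mulVec (shearVec D 0 s 0 0)) hv
    simp only [← Matrix.mulVec_mulVec, hcusp, hmul g hg, ← hF, hαS, hs] at h1
    obtain ⟨-, -, h1⟩ := shearVec_inj.1 h1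
    simp only [zero_smul, dotProduct_zero, mul_zero, add_zero, Matrix.mulVec_zero] at h1
    linarith
  have h1 : F (b - α b • apex p) = 0 := hker _ (by simp [h.apply_apex])
  rw [map_sub, map_smul, sub_eq_zero] at h1
  have h2 : F (apex p) = lowerY g.val (apex p) := by
    rw [hF, hD0, (hjoin g hg).1, map_smul, hD0]
    simp
  rw [← hF, h1, h2]

end Adapted

/-! ### The center acts on the fibers by isometries -/

section Link

variable {p i : ℕ} {O : ConvexProjectiveOrbifold (BlockIdx p i)} {E : NPCCEnd O}
  {K'' : Set (Fin p ⊕ Unit → ℝ)} {α : (Fin p ⊕ Unit → ℝ) →ₗ[ℝ] ℝ}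

theorem linkProj_blockVec (b : Fin p ⊕ Unit → ℝ) (y : Fin i → ℝ) (z : ℝ) :
    linkProj (blockVec b y z) = Sum.elim b y := by
  ext j
  rcases j with j | j <;> rfl

theorem IsStandardForm.linkMatrix_mulVec {M : Matrix (BlockIdx p i) (BlockIdx p i) ℝ}
    (hM : IsStandardForm M) (x : BlockIdx p i → ℝ) :
    (linkMatrix M).mulVec (linkProj x) = linkProj (M.mulVec x) := by
  have h1 : ∀ j k, M (Sum.inl j) (Sum.inr k) = 0 := fun j k => congrFun (congrFun hM.1 j) k
  have h2 : ∀ j k, M (Sum.inr (Sum.inl j)) (Sum.inr (Sum.inr k)) = 0 :=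
    fun j k => congrFun (congrFun hM.2 j) k
  ext j
  rcases j with j | j <;>
  simp [linkMatrix, linkProj, linkIncl, Matrix.mulVec, dotProduct, Fintype.sum_sum_type, h1, h2]

theorem NPCCEnd.mem_linkProj_image {x : (Fin p ⊕ Unit) ⊕ Fin i → ℝ} :
    x ∈ linkProj '' E.nbhd ↔ x ∘ Sum.inl ∈ E.leafSpace :=
  Set.ext_iff.1 E.directions_eq x

/-- A fiber of the space of directions over a point of the leaf space is not covered by finitely
many translates of a compact set, because the translates meet it in bounded sets. -/
theorem NPCCEnd.infinite_translates (h : IsJoinHeight E.leafSpace K'' α)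
    {b : Fin p ⊕ Unit → ℝ} (hb : b ∈ E.leafSpace) {D : Set ((Fin p ⊕ Unit) ⊕ Fin i → ℝ)}
    (hD : D ⊆ linkProj '' E.nbhd) (hDc : IsCompact D)
    (hcov : ∀ x ∈ linkProj '' E.nbhd, ∃ g ∈ E.endGroup, ∃ r : ℝ, 0 < r ∧
      r • (linkMatrix g.val).mulVec x ∈ D) :
    {g | g ∈ E.endGroup ∧ ∃ y : Fin i → ℝ, ∃ r : ℝ, 0 < r ∧
      r • (linkMatrix g.val).mulVec (Sum.elim b y) ∈ D}.Infinite := by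
  intro hfin
  have hbdd : ∀ g ∈ E.endGroup, Bornology.IsBounded {y : Fin i → ℝ | ∃ r : ℝ, 0 < r ∧
      r • (linkMatrix g.val).mulVec (Sum.elim b y) ∈ D} := by
    intro g hg
    set G := linkMatrix (g⁻¹).val
    have hGD : ∀ x ∈ D, (G.mulVec x) ∘ Sum.inl ∈ E.leafSpace := by
      intro x hx
      obtain ⟨u, hu, rfl⟩ := hD hx
      rw [(E.standardForm _ (inv_mem hg)).linkMatrix_mulVec]
      exact E.projK_mem ((E.mulVec_mem_nbhd (inv_mem hg)).2 hu)
    have hinv : ∀ y : Fin i → ℝ, G.mulVec ((linkMatrix g.val).mulVec (Sum.elim b y)) =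
        Sum.elim b y := by
      intro y
      rw [← linkProj_blockVec b y 0, (E.standardForm _ hg).linkMatrix_mulVec,
        (E.standardForm _ (inv_mem hg)).linkMatrix_mulVec, Matrix.mulVec_mulVec, ← Units.val_mul,
        inv_mul_cancel, Units.val_one, Matrix.one_mulVec]
    have hα : Continuous α := α.continuous_of_finiteDimensional
    have hG : Continuous fun x => G.mulVec x :=
      Continuous.matrix_mulVec continuous_const continuous_id
    have hG1 : Continuous fun x => (G.mulVec x) ∘ (Sum.inl : Fin p ⊕ Unit → _) :=
      continuous_pi fun j => (continuous_apply _).comp hG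
    have hG2 : Continuous fun x => (G.mulVec x) ∘ (Sum.inr : Fin i → _) :=
      continuous_pi fun j => (continuous_apply _).comp hG
    have hcont : ContinuousOn (fun x => (α b / α ((G.mulVec x) ∘ Sum.inl)) •
        ((G.mulVec x) ∘ (Sum.inr : Fin i → _))) D :=
      (ContinuousOn.div continuousOn_const (hα.comp hG1).continuousOn
        fun x hx => (h.pos (hGD x hx)).ne').smul hG2.continuousOn
    refine (hDc.image_of_continuousOn hcont).isBounded.subset ?_
    rintro y ⟨r, hr, hy⟩
    refine ⟨_, hy, ?_⟩
    simp only [Matrix.mulVec_smul, hinv]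
    have h1 : (r • (Sum.elim b y : (Fin p ⊕ Unit) ⊕ Fin i → ℝ)) ∘ Sum.inl = r • b := rfl
    have h2 : (r • (Sum.elim b y : (Fin p ⊕ Unit) ⊕ Fin i → ℝ)) ∘ Sum.inr = r • y := rfl
    have hαb := (h.pos hb).ne'
    rw [h1, h2, map_smul, smul_smul, smul_eq_mul]
    have : α b / (r * α b) * r = 1 := by field_simp
    rw [this, one_smul]
  have huniv : Bornology.IsBounded (Set.univ : Set (Fin i → ℝ)) := by
    refine ((Bornology.isBounded_biUnion hfin).2 fun g hg => hbdd g hg.1).subset ?_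
    intro y _
    obtain ⟨g, hg, r, hr, hgr⟩ := hcov (Sum.elim b y) (NPCCEnd.mem_linkProj_image.2 hb)
    exact Set.mem_biUnion (show g ∈ {g | g ∈ E.endGroup ∧ ∃ y : Fin i → ℝ, ∃ r : ℝ, 0 < r ∧
      r • (linkMatrix g.val).mulVec (Sum.elim b y) ∈ D} from ⟨hg, y, r, hr, hgr⟩) ⟨r, hr, hgr⟩
  obtain ⟨R, hR⟩ := huniv.exists_norm_le
  have h1 := hR (fun _ => R + 1) (Set.mem_univ _)
  have h2 := (norm_le_pi_norm (fun _ : Fin i => R + 1) ⟨0, E.fiberDim_pos⟩).trans h1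
  have := (le_abs_self _).trans h2
  linarith

variable {C : (Fin i → ℝ) →ₗ[ℝ] Matrix (Fin i) (Fin p) ℝ} {c : (Fin i → ℝ) → Fin p → ℝ}
  {D : (Fin p ⊕ Unit → ℝ) →ₗ[ℝ] (Fin i → ℝ)}

/-- The end group fixes no point of the fiber: otherwise it would preserve the corresponding
section of the space of directions, on which infinitely many translates of a point stay in a
compact set. -/
theorem IsAdapted.not_exists_fixed (h : IsAdapted E C c K'' α D) (u : Fin i → ℝ) :
    ¬ ∀ g ∈ E.endGroup, lowerY g.val (apex p) + (blockA5 g.val).mulVec u = entryA1 g.val • u := by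
  intro hu
  obtain ⟨D₀, hD₀, hc, hcov⟩ := E.directions_cocompact
  obtain ⟨b, hb⟩ := h.height.properlyConvex.nonempty
  let Φ : (Fin p ⊕ Unit → ℝ) → (Fin p ⊕ Unit) ⊕ Fin i → ℝ := fun b => Sum.elim b (α b • u - D b)
  have hΦ : Continuous Φ := by
    have h1 : Continuous α := α.continuous_of_finiteDimensional
    have h2 : Continuous D := D.continuous_of_finiteDimensional
    refine continuous_pi fun j => ?_
    rcases j with j | j
    · exact continuous_apply j
    · exact (continuous_apply j).comp ((h1.smul continuous_const).sub h2)
  have hΦs : ∀ b, Φ b = linkProj (shearVec D 0 b (α b • u) 0) := fun b => by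
    rw [shearVec, linkProj_blockVec]
  have hΦg : ∀ g ∈ E.endGroup, ∀ b,
      (linkMatrix g.val).mulVec (Φ b) = Φ ((semisimplePart g.val).mulVec b) := by
    intro g hg b
    rw [hΦs, (E.standardForm g hg).linkMatrix_mulVec, h.mulVec g hg, Matrix.mulVec_smul,
      ← smul_add, hu g hg, shearVec, linkProj_blockVec, smul_smul,
      mul_comm (α b), ← h.height_map g hg]
  have hΦr : ∀ (r : ℝ) b, r • Φ b = Φ (r • b) := by
    intro r b
    ext j
    rcases j with j | j
    · rfl
    · simp [Φ]
      ring
  have hπ : Continuous fun x : (Fin p ⊕ Unit) ⊕ Fin i → ℝ => Φ (x ∘ Sum.inl) :=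
    hΦ.comp (continuous_pi fun j => continuous_apply _)
  have hfin := E.directions_properlyDiscontinuous
    ((fun x : (Fin p ⊕ Unit) ⊕ Fin i → ℝ => Φ (x ∘ Sum.inl)) '' D₀ ∪ {Φ b})
    (by
      rintro _ (⟨x, hx, rfl⟩ | rfl)
      · have := NPCCEnd.mem_linkProj_image.1 (hD₀ hx)
        exact NPCCEnd.mem_linkProj_image.2 this
      · exact NPCCEnd.mem_linkProj_image.2 hb)
    ((hc.image hπ).union isCompact_singleton)
  refine E.infinite_translates h.height hb hD₀ hc hcov (hfin.subset ?_)
  rintro g ⟨hg, y, r, hr, hgr⟩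
  refine ⟨hg, Φ b, Or.inr rfl, r, hr, Or.inl ⟨_, hgr, ?_⟩⟩
  rw [← linkProj_blockVec b y 0, (E.standardForm g hg).linkMatrix_mulVec, hΦg g hg, hΦr]
  have := (E.standardForm g hg).semisimplePart_projK (blockVec b y 0)
  exact congrArg (fun x => Φ (r • x)) this

/-- A central element has the same eigenvalue on the apex and on the end vertex: otherwise it acts
on the fiber by a similarity with a unique fixed point, which is fixed by the whole end group. -/
theorem IsAdapted.entryA1_eq_entryA9 (h : IsAdapted E C c K'' α D) {g₀ : GL (BlockIdx p i) ℝ}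
    (hg₀ : g₀ ∈ E.endGroup) (hcomm : ∀ g ∈ E.endGroup, g₀ * g = g * g₀) :
    entryA1 g₀.val = entryA9 g₀.val := by
  by_contra hne
  have h1 := h.entryA1_pos g₀ hg₀
  have h9 := E.entryA9_pos hg₀
  have hinj : Function.Injective ((blockA5 g₀.val).mulVecLin -
      entryA1 g₀.val • (LinearMap.id : (Fin i → ℝ) →ₗ[ℝ] (Fin i → ℝ))) := by
    rw [← LinearMap.ker_eq_bot, LinearMap.ker_eq_bot']
    intro y hy
    rw [LinearMap.sub_apply, sub_eq_zero, Matrix.mulVecLin_apply, LinearMap.smul_apply,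
      LinearMap.id_apply] at hy
    have hs := transpose_mul_self_of_mul_transpose (mul_pos h1 h9).ne' (h.similarity g₀ hg₀)
    have h2 : (blockA5 g₀.val).mulVec y ⬝ᵥ (blockA5 g₀.val).mulVec y =
        (entryA1 g₀.val * entryA9 g₀.val) * (y ⬝ᵥ y) := by
      rw [Matrix.dotProduct_mulVec, Matrix.vecMul_mulVec, ← Matrix.dotProduct_mulVec, hs,
        Matrix.smul_mulVec, Matrix.one_mulVec, dotProduct_smul, smul_eq_mul]
    rw [hy, smul_dotProduct, dotProduct_smul, smul_eq_mul, smul_eq_mul] at h2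
    have h3 : entryA1 g₀.val * (entryA1 g₀.val - entryA9 g₀.val) * (y ⬝ᵥ y) = 0 := by linarith
    rcases mul_eq_zero.1 h3 with h3 | h3
    · exact absurd h3 (mul_ne_zero h1.ne' (sub_ne_zero.2 hne))
    · exact dotProduct_self_eq_zero.1 h3
  obtain ⟨u, hu⟩ := LinearMap.injective_iff_surjective.1 hinj (-lowerY g₀.val (apex p))
  rw [LinearMap.sub_apply, Matrix.mulVecLin_apply, LinearMap.smul_apply, LinearMap.id_apply] at hu
  have hu' : lowerY g₀.val (apex p) + (blockA5 g₀.val).mulVec u = entryA1 g₀.val • u := by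
    rw [← sub_eq_zero, add_sub_assoc, hu, add_neg_cancel]
  refine h.not_exists_fixed u fun g hg => ?_
  have hc := congrArg (fun x : GL (BlockIdx p i) ℝ =>
    x.val.mulVec (shearVec D 0 (apex p) u 0)) (hcomm g hg)
  simp only [Units.val_mul, ← Matrix.mulVec_mulVec, h.mulVec g hg, h.mulVec g₀ hg₀,
    h.height.apply_apex, h.height_map g hg, h.height_map g₀ hg₀, one_smul, mul_one] at hc
  obtain ⟨-, hc, -⟩ := shearVec_inj.1 hc
  rw [hu', Matrix.mulVec_smul] at hc
  apply sub_eq_zero.1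
  apply hinj
  rw [map_zero, LinearMap.sub_apply, Matrix.mulVecLin_apply, LinearMap.smul_apply,
    LinearMap.id_apply, Matrix.mulVec_sub, Matrix.mulVec_smul, ← sub_eq_zero.2 hc]
  have h4 : lowerY g₀.val (apex p) = entryA1 g₀.val • u - (blockA5 g₀.val).mulVec u := by
    rw [← hu']; abel
  rw [h4, Matrix.mulVec_add]
  module

/-! ### Splitting off the end vertex -/

/-- The last coordinate can be sheared so that the end group has vanishing `c₂`: this holds for
the separating central element as its eigenvalue at the end vertex is not an eigenvalue on the span
of `K''`, and then for all elements that commute with it. -/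
theorem IsAdapted.exists_shear (h : IsAdapted E C c K'' α D) {g₀ : GL (BlockIdx p i) ℝ}
    (hg₀ : IsSeparating E K'' α g₀) (hcomm : ∀ g ∈ E.endGroup, g₀ * g = g * g₀) :
    ∃ d : (Fin p ⊕ Unit → ℝ) →ₗ[ℝ] ℝ, d (apex p) = 0 ∧
      ∀ g ∈ E.endGroup, ∀ s, α s = 0 → shearLowerZ D d g.val s = 0 := by
  have ha := h.entryA1_eq_entryA9 hg₀.mem hcomm
  set a := entryA1 g₀.val
  have hapex := h.map_apex g₀ hg₀.mem
  -- On the span of `K''`, this is `Ŝ(g₀) - a`; it fixes the apex.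
  let R : (Fin p ⊕ Unit → ℝ) →ₗ[ℝ] (Fin p ⊕ Unit → ℝ) :=
    (semisimplePart g₀.val).mulVecLin - a • LinearMap.id + α.smulRight (apex p)
  have hR : ∀ b, R b = (semisimplePart g₀.val).mulVec b - a • b + α b • apex p := fun b => rfl
  have hαR : ∀ b, α (R b) = α b := by
    intro b
    rw [hR, map_add, map_sub, map_smul, map_smul, h.height_map g₀ hg₀.mem, h.height.apply_apex]
    simp [a]
  have hRinj : Function.Injective R := by
    rw [← LinearMap.ker_eq_bot, LinearMap.ker_eq_bot']
    intro b hb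
    have h0 : α b = 0 := by rw [← hαR, hb, map_zero]
    rw [hR, h0, zero_smul, add_zero, sub_eq_zero] at hb
    exact hg₀.separated b a h0 hapex hb
  let Re := LinearEquiv.ofInjectiveEndo R hRinj
  have hRe : ∀ b, Re b = R b := fun b => rfl
  let d₀ := shearLowerZ D 0 g₀.val
  let q : (Fin p ⊕ Unit → ℝ) →ₗ[ℝ] ℝ := d₀ ∘ₗ (LinearMap.id - α.smulRight (apex p))
  have hq : ∀ b, q b = d₀ (b - α b • apex p) := fun b => rfl
  let d : (Fin p ⊕ Unit → ℝ) →ₗ[ℝ] ℝ := -(q ∘ₗ Re.symm.toLinearMap)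
  have hd : ∀ b, d (R b) = -q b := by
    intro b
    show -(q (Re.symm (R b))) = _
    rw [← hRe, Re.symm_apply_apply]
  have hshear : ∀ (d : (Fin p ⊕ Unit → ℝ) →ₗ[ℝ] ℝ) (g : GL (BlockIdx p i) ℝ) b,
      shearLowerZ D d g.val b = shearLowerZ D 0 g.val b - entryA9 g.val * d b +
        d ((semisimplePart g.val).mulVec b) := by
    intro d g b
    simp [shearLowerZ]
  have hzero : ∀ s, α s = 0 → shearLowerZ D d g₀.val s = 0 := by
    intro s hs
    have h1 : R s = (semisimplePart g₀.val).mulVec s - a • s := by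
      rw [hR, hs, zero_smul, add_zero]
    have h2 := hd s
    rw [h1, hq, hs, zero_smul, sub_zero, map_sub, map_smul, smul_eq_mul, ha] at h2
    rw [hshear]
    linarith
  refine ⟨d, ?_, fun g hg s hs => ?_⟩
  · have h1 : R (apex p) = apex p := by
      rw [hR, hapex, h.height.apply_apex, sub_self, zero_add, one_smul]
    rw [← h1, hd, hq, h.height.apply_apex, one_smul, sub_self, map_zero, neg_zero]
  · -- `s` is in the image of `Ŝ(g₀) - a`, which is annihilated.
    obtain ⟨t, rfl⟩ : ∃ t, R t = s := LinearMap.injective_iff_surjective.1 hRinj s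
    rw [hαR] at hs
    have hc := congrArg (fun x : GL (BlockIdx p i) ℝ =>
      x.val.mulVec (shearVec D d t 0 0)) (hcomm g hg)
    simp only [Units.val_mul, ← Matrix.mulVec_mulVec, h.mulVec g hg, h.mulVec g₀ hg₀.mem, hs,
      zero_smul, Matrix.mulVec_zero, dotProduct_zero, mul_zero, add_zero, h.height_map g hg,
      hzero t hs] at hc
    obtain ⟨-, -, hc⟩ := shearVec_inj.1 hc
    rw [hzero _ (by rw [h.height_map g hg, hs, mul_zero]), zero_add] at hc
    rw [hR, hs, zero_smul, add_zero, map_sub, map_smul, smul_eq_mul, ← hc, ha, sub_self]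

end Link

/-! ### The convex hull of the p-end neighborhood -/

section Hull

variable {p i : ℕ} {O : ConvexProjectiveOrbifold (BlockIdx p i)}

/-- The closed convex cone generated by the p-end neighborhood. -/
def NPCCEnd.hull (E : NPCCEnd O) : Set (BlockIdx p i → ℝ) := closure (convexHull ℝ E.nbhd)

namespace NPCCEnd

variable (E : NPCCEnd O)

theorem isClosed_hull : IsClosed E.hull := isClosed_closure

theorem nbhd_subset_hull : E.nbhd ⊆ E.hull := (subset_convexHull ℝ _).trans subset_closure

theorem hull_subset : E.hull ⊆ closure O.domain :=
  closure_mono (convexHull_min E.nbhd_subset O.properlyConvex.convex)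

theorem map_mem_hull (f : (BlockIdx p i → ℝ) →ₗ[ℝ] (BlockIdx p i → ℝ))
    (hf : ∀ x ∈ E.nbhd, f x ∈ E.nbhd) {x} (hx : x ∈ E.hull) : f x ∈ E.hull := by
  refine map_mem_closure f.continuous_of_finiteDimensional hx fun y hy => ?_
  have : f y ∈ f '' convexHull ℝ E.nbhd := ⟨y, hy, rfl⟩
  rw [f.image_convexHull] at this
  exact convexHull_mono (Set.image_subset_iff.2 hf) this

theorem smul_mem_hull {r : ℝ} (hr : 0 < r) {x} (hx : x ∈ E.hull) : r • x ∈ E.hull :=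
  E.map_mem_hull (r • LinearMap.id) (fun y hy => E.nbhd_smul r hr y hy) hx

theorem smul_mem_hull_iff {r : ℝ} (hr : 0 < r) {x} : r • x ∈ E.hull ↔ x ∈ E.hull := by
  refine ⟨fun h => ?_, E.smul_mem_hull hr⟩
  have := E.smul_mem_hull (inv_pos.2 hr) h
  rwa [inv_smul_smul₀ hr.ne'] at this

theorem add_mem_hull {x y} (hx : x ∈ E.hull) (hy : y ∈ E.hull) : x + y ∈ E.hull := by
  have h := (convex_convexHull ℝ E.nbhd).closure hx hy (a := 1 / 2) (b := 1 / 2) (by norm_num)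
    (by norm_num) (by norm_num)
  have h2 := E.smul_mem_hull (r := 2) (by norm_num) h
  convert h2 using 1
  module

theorem endVertex_mem_hull : endVertex p i ∈ E.hull :=
  closure_mono (subset_convexHull ℝ _) E.endVertex_mem_closure_nbhd

theorem neg_endVertex_notMem_hull : -endVertex p i ∉ E.hull := fun h =>
  E.neg_endVertex_notMem (E.hull_subset h)

theorem zero_mem_hull : (0 : BlockIdx p i → ℝ) ∈ E.hull := by
  obtain ⟨x, hx⟩ := E.nbhd_connected.nonempty
  have h : Filter.Tendsto (fun n : ℕ => (1 / ((n : ℝ) + 1)) • x) Filter.atTop (nhds ((0 : ℝ) • x)) :=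
    tendsto_one_div_add_atTop_nhds_zero_nat.smul_const x
  rw [zero_smul] at h
  exact E.isClosed_hull.mem_of_tendsto h (Filter.Eventually.of_forall fun n =>
    E.smul_mem_hull (by positivity) (E.nbhd_subset_hull hx))

theorem mulVec_mem_hull {g : GL (BlockIdx p i) ℝ} (hg : g ∈ E.endGroup) {x} :
    g.val.mulVec x ∈ E.hull ↔ x ∈ E.hull := by
  have h : ∀ g ∈ E.endGroup, ∀ x ∈ E.hull, g.val.mulVec x ∈ E.hull := fun g hg x hx =>
    E.map_mem_hull g.val.mulVecLin (fun y hy => (E.mulVec_mem_nbhd hg).2 hy) hx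
  refine ⟨fun hx => ?_, h g hg x⟩
  have := h _ (inv_mem hg) _ hx
  rwa [Matrix.mulVec_mulVec, ← Units.val_mul, inv_mul_cancel, Units.val_one,
    Matrix.one_mulVec] at this

end NPCCEnd

variable {E : NPCCEnd O} {K'' : Set (Fin p ⊕ Unit → ℝ)} {α : (Fin p ⊕ Unit → ℝ) →ₗ[ℝ] ℝ}
  {C : (Fin i → ℝ) →ₗ[ℝ] Matrix (Fin i) (Fin p) ℝ} {c : (Fin i → ℝ) → Fin p → ℝ}
  {D : (Fin p ⊕ Unit → ℝ) →ₗ[ℝ] (Fin i → ℝ)} {d : (Fin p ⊕ Unit → ℝ) →ₗ[ℝ] ℝ}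

theorem continuous_shearVec {X : Type*} [TopologicalSpace X] {b : X → Fin p ⊕ Unit → ℝ}
    {y : X → Fin i → ℝ} {z : X → ℝ} (hb : Continuous b) (hy : Continuous y) (hz : Continuous z) :
    Continuous fun x => shearVec D d (b x) (y x) (z x) := by
  have h1 : Continuous D := D.continuous_of_finiteDimensional
  have h2 : Continuous d := d.continuous_of_finiteDimensional
  refine continuous_pi fun j => ?_
  rcases j with j | j | j
  · exact (continuous_apply j).comp hb
  · exact (continuous_apply j).comp (hy.sub (h1.comp hb))
  · exact hz.sub (h2.comp hb)

theorem mem_hull_of_le {b : Fin p ⊕ Unit → ℝ} {y : Fin i → ℝ} {z z' : ℝ} (hz : z ≤ z')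
    (h : shearVec D d b y z ∈ E.hull) : shearVec D d b y z' ∈ E.hull := by
  rcases hz.eq_or_lt with rfl | hz
  · exact h
  have := E.add_mem_hull h (E.smul_mem_hull (sub_pos.2 hz) E.endVertex_mem_hull)
  rwa [← shearVec_zero_zero D d, shearVec_add, add_zero, add_zero, add_sub_cancel] at this

theorem IsAdapted.cusp_mem_hull (h : IsAdapted E C c K'' α D) (hN : IsNormalizedCuspGroup E C c)
    (v : Fin i → ℝ) (b : Fin p ⊕ Unit → ℝ) (y : Fin i → ℝ) (z : ℝ) :
    shearVec D d b (y + α b • v) (z + v ⬝ᵥ y + (v ⬝ᵥ v) / 2 * α b) ∈ E.hull ↔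
      shearVec D d b y z ∈ E.hull := by
  have key : ∀ v x, x ∈ E.hull → (cuspMatrix (C v) (c v) v).mulVec x ∈ E.hull := fun v x hx =>
    E.map_mem_hull (cuspMatrix (C v) (c v) v).mulVecLin (fun y hy => by
      have := hN.acts v
      rw [Set.ext_iff] at this
      exact (this _).1 ⟨y, hy, rfl⟩) hx
  rw [← h.cusp_mulVec]
  refine ⟨fun hx => ?_, key v _⟩
  have := key (-v) _ hx
  rw [h.cusp_mulVec, h.cusp_mulVec] at this
  convert this using 2
  · simp
  · simp only [neg_dotProduct, dotProduct_add, dotProduct_smul, dotProduct_neg, smul_eq_mul]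
    ring

/-- Modulo the cusp group, `g` acts on the last coordinate by an affine map. -/
theorem IsAdapted.exists_affine (h : IsAdapted E C c K'' α D) (hN : IsNormalizedCuspGroup E C c)
    {g : GL (BlockIdx p i) ℝ} (hg : g ∈ E.endGroup)
    (hd : ∀ s, α s = 0 → shearLowerZ D d g.val s = 0) :
    ∃ β : ℝ, ∀ b z, shearVec D d b 0 z ∈ E.hull ↔
      shearVec D d ((semisimplePart g.val).mulVec b) 0 (α b * β + entryA9 g.val * z) ∈ E.hull := by
  set a := entryA1 g.val
  have ha : a ≠ 0 := (h.entryA1_pos g hg).ne'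
  set v := -(a⁻¹ • lowerY g.val (apex p))
  have hF : ∀ b, shearLowerZ D d g.val b = α b * shearLowerZ D d g.val (apex p) := fun b => by
    have := hd (b - α b • apex p) (by simp [h.height.apply_apex])
    rwa [map_sub, map_smul, sub_eq_zero, smul_eq_mul] at this
  refine ⟨shearLowerZ D d g.val (apex p) + v ⬝ᵥ lowerY g.val (apex p) + (v ⬝ᵥ v) / 2 * a,
    fun b z => ?_⟩
  rw [← E.mulVec_mem_hull hg, h.mulVec g hg, ← h.cusp_mem_hull hN v, h.height_map g hg, hF]
  have h1 : α b • lowerY g.val (apex p) + (blockA5 g.val).mulVec 0 + (a * α b) • v = 0 := by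
    rw [Matrix.mulVec_zero, add_zero, smul_neg, smul_smul, mul_assoc, mul_comm (α b), ← mul_assoc,
      mul_inv_cancel₀ ha, one_mul, add_neg_cancel]
  rw [h1, Matrix.mulVec_zero, add_zero, dotProduct_zero, dotProduct_smul, smul_eq_mul]
  have h2 : α b * shearLowerZ D d g.val (apex p) + 0 + entryA9 g.val * z +
      α b * (v ⬝ᵥ lowerY g.val (apex p)) + v ⬝ᵥ v / 2 * (a * α b) =
      α b * (shearLowerZ D d g.val (apex p) + v ⬝ᵥ lowerY g.val (apex p) + v ⬝ᵥ v / 2 * a) +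
        entryA9 g.val * z := by ring
  rw [h2]

theorem exists_forall_mem_hull (E : NPCCEnd O) {B : Set (Fin p ⊕ Unit → ℝ)} (hB : IsCompact B)
    (hBL : B ⊆ E.leafSpace) : ∃ M : ℝ, ∀ b ∈ B, shearVec D d b 0 M ∈ E.hull := by
  refine hB.induction_on (p := fun B => ∃ M : ℝ, ∀ b ∈ B, shearVec D d b 0 M ∈ E.hull)
    ⟨0, by simp⟩ (fun s t hst ⟨M, hM⟩ => ⟨M, fun b hb => hM b (hst hb)⟩) ?_ ?_
  · rintro s t ⟨M, hM⟩ ⟨M', hM'⟩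
    refine ⟨max M M', fun b hb => ?_⟩
    rcases hb with hb | hb
    · exact mem_hull_of_le (le_max_left _ _) (hM b hb)
    · exact mem_hull_of_le (le_max_right _ _) (hM' b hb)
  · intro b hb
    obtain ⟨z, hz⟩ := E.exists_mem_nbhd (hBL hb) (0 - D b)
    have hz' : shearVec D d b 0 (z + d b) ∈ E.nbhd := by
      rw [shearVec, add_sub_cancel_right]
      exact hz
    have hcont : Continuous fun b' : Fin p ⊕ Unit → ℝ =>
        shearVec D d b' (0 : Fin i → ℝ) (z + d b) :=
      continuous_shearVec continuous_id continuous_const continuous_const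
    refine ⟨_, mem_nhdsWithin_of_mem_nhds
      (hcont.continuousAt.preimage_mem_nhds (E.nbhd_open.mem_nhds hz')), z + d b,
      fun b' hb' => E.nbhd_subset_hull hb'⟩

theorem exists_forall_le_of_mem_hull (E : NPCCEnd O) {B : Set (Fin p ⊕ Unit → ℝ)}
    (hB : Bornology.IsBounded B) :
    ∃ m : ℝ, ∀ b ∈ B, ∀ z, shearVec D d b 0 z ∈ E.hull → m ≤ z := by
  by_contra! hcon
  choose b hb z hz hlt using fun n : ℕ => hcon (-((n : ℝ) + 1))
  obtain ⟨R, hR⟩ := hB.exists_norm_le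
  have hpos : ∀ n : ℕ, 0 < -z n := fun n => by
    have := hlt n
    have : (0 : ℝ) ≤ n := n.cast_nonneg
    linarith
  -- Rescaled to last coordinate `-1`, these vectors converge to the antipode of the end vertex.
  have hmem : ∀ n, shearVec D d ((-z n)⁻¹ • b n) (0 : Fin i → ℝ) (-1) ∈ E.hull := fun n => by
    have h1 := E.smul_mem_hull (inv_pos.2 (hpos n)) (hz n)
    rw [smul_shearVec, smul_zero] at h1
    convert h1 using 2
    have := (hpos n).ne'
    have h2 : z n ≠ 0 := fun h => this (by rw [h, neg_zero])
    field_simp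
  have hinv : Filter.Tendsto (fun n : ℕ => (-z n)⁻¹) Filter.atTop (nhds 0) := by
    refine tendsto_inv_atTop_zero.comp (Filter.tendsto_atTop_mono (fun n => ?_)
      (tendsto_natCast_atTop_atTop (R := ℝ)))
    have := hlt n
    linarith
  have hlim : Filter.Tendsto (fun n : ℕ => (-z n)⁻¹ • b n) Filter.atTop (nhds 0) := by
    refine squeeze_zero_norm (a := fun n => (-z n)⁻¹ * R) (fun n => ?_) (by simpa using hinv.mul_const R)
    rw [norm_smul, Real.norm_of_nonneg (inv_nonneg.2 (hpos n).le)]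
    exact mul_le_mul_of_nonneg_left (hR _ (hb n)) (inv_nonneg.2 (hpos n).le)
  have hcont : Continuous fun b : Fin p ⊕ Unit → ℝ => shearVec D d b (0 : Fin i → ℝ) (-1) :=
    continuous_shearVec continuous_id continuous_const continuous_const
  have h0 := E.isClosed_hull.mem_of_tendsto (hcont.continuousAt.tendsto.comp hlim)
    (Filter.Eventually.of_forall hmem)
  rw [shearVec_zero_zero, neg_one_smul] at h0
  exact E.neg_endVertex_notMem_hull h0

/-- The map that doubles the `K''`-component of `b` and fixes its height. -/
def doubleBase (α : (Fin p ⊕ Unit → ℝ) →ₗ[ℝ] ℝ) : (Fin p ⊕ Unit → ℝ) →ₗ[ℝ] (Fin p ⊕ Unit → ℝ) :=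
  (2 : ℝ) • LinearMap.id - α.smulRight (apex p)

theorem doubleBase_apply (α : (Fin p ⊕ Unit → ℝ) →ₗ[ℝ] ℝ) (b : Fin p ⊕ Unit → ℝ) :
    doubleBase α b = (2 : ℝ) • b - α b • apex p := rfl

theorem IsJoinHeight.doubleBase_mem {L : Set (Fin p ⊕ Unit → ℝ)} (h : IsJoinHeight L K'' α) {b}
    (hb : b ∈ L) : doubleBase α b ∈ L := by
  have h1 := h.properlyConvex.smul_mem 2 (by norm_num) _ (h.scale_mem hb (r := 1 / 2) (by norm_num))
  rw [doubleBase_apply]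
  convert h1 using 1
  module

theorem IsJoinHeight.apply_doubleBase {L : Set (Fin p ⊕ Unit → ℝ)} (h : IsJoinHeight L K'' α) (b) :
    α (doubleBase α b) = α b := by
  rw [doubleBase_apply, map_sub, map_smul, map_smul, h.apply_apex, smul_eq_mul, smul_eq_mul]
  ring

theorem IsProperlyConvexCone.exists_sub_mem {κ : Type*} [Fintype κ] {L B : Set (κ → ℝ)}
    (hL : IsProperlyConvexCone L) (hB : IsCompact B) (hBL : B ⊆ L) (b₀ : κ → ℝ) :
    ∃ ε : ℝ, 0 < ε ∧ ∀ b ∈ B, b - ε • b₀ ∈ L := by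
  obtain ⟨δ, hδ, hsub⟩ := hB.exists_thickening_subset_open hL.isOpen hBL
  refine ⟨δ / (2 * (‖b₀‖ + 1)), by positivity, fun b hb => hsub ?_⟩
  rw [Metric.mem_thickening_iff]
  refine ⟨b, hb, ?_⟩
  rw [dist_eq_norm, sub_sub_cancel_left, norm_neg, norm_smul, Real.norm_of_nonneg (by positivity),
    div_mul_eq_mul_div, div_lt_iff₀ (by positivity)]
  nlinarith [norm_nonneg b₀]

/-- Doubling the `K''`-component of `b ≤ R b₀` raises the lower boundary of the hull by at most a
constant multiple of `R`.  By cocompactness this reduces to a compact set of points `b`; the weak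
middle eigenvalue condition bounds the expansion along the end vertex of the group elements used. -/
theorem IsAdapted.exists_doubling (h : IsAdapted E C c K'' α D) (hN : IsNormalizedCuspGroup E C c)
    (hmec : WeakMiddleEigenvalueCondition E)
    (hK : ActsCocompactly (fun g : GL (BlockIdx p i) ℝ => semisimplePart g.val)
      E.endGroup E.leafSpace)
    (hd : ∀ g ∈ E.endGroup, ∀ s, α s = 0 → shearLowerZ D d g.val s = 0)
    {b₀ : Fin p ⊕ Unit → ℝ} (hb₀ : b₀ ∈ E.leafSpace) :
    ∃ M : ℝ, ∀ b ∈ E.leafSpace, ∀ R : ℝ, 0 < R → R • b₀ - b ∈ closure E.leafSpace →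
      ∀ z, shearVec D d b 0 z ∈ E.hull → shearVec D d (doubleBase α b) 0 (z + R * M) ∈ E.hull := by
  have hL := h.height.properlyConvex
  obtain ⟨B, hBL, hB, hcov⟩ := hK
  obtain ⟨ε, hε, hεB⟩ := hL.exists_sub_mem hB hBL b₀
  obtain ⟨m, hm⟩ := exists_forall_le_of_mem_hull (D := D) (d := d) E hB.isBounded
  obtain ⟨M, hM⟩ := exists_forall_mem_hull (D := D) (d := d) E
    (hB.image (doubleBase α).continuous_of_finiteDimensional) (by
      rintro _ ⟨b, hb, rfl⟩
      exact h.height.doubleBase_mem (hBL hb))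
  refine ⟨max 0 (M - m) * ε⁻¹, fun b hb R hR hbR z hz => ?_⟩
  obtain ⟨g, hg, r, hr, hgr⟩ := hcov b hb
  obtain ⟨β, hβ⟩ := h.exists_affine hN hg (hd g hg)
  have h9 := E.entryA9_pos hg
  -- The bound on `a₉(g⁻¹)`.
  have hinv : r⁻¹ * (entryA9 g.val)⁻¹ ≤ R * ε⁻¹ := by
    have hS : ∀ x, (semisimplePart (g⁻¹).val).mulVec ((semisimplePart g.val).mulVec x) = x := by
      intro x
      rw [← NPCCEnd.projK_elim (i := i) x 0, ← (E.standardForm g hg).semisimplePart_projK,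
        ← (E.standardForm _ (inv_mem hg)).semisimplePart_projK, Matrix.mulVec_mulVec,
        ← Units.val_mul, inv_mul_cancel, Units.val_one, Matrix.one_mulVec]
    have h9' : entryA9 (g⁻¹).val = (entryA9 g.val)⁻¹ := by
      have h1 := NPCCEnd.mulVec_endVertex (E.standardForm _ (inv_mem hg))
      have h2 := NPCCEnd.mulVec_endVertex (E.standardForm _ hg)
      have h3 := congrArg (g⁻¹).val.mulVec h2
      rw [Matrix.mulVec_mulVec, ← Units.val_mul, inv_mul_cancel, Units.val_one,
        Matrix.one_mulVec, Matrix.mulVec_smul, h1, smul_smul] at h3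
      have h4 := congrFun h3 (Sum.inr (Sum.inr ()))
      simp only [endVertex, Pi.single_eq_same, Pi.smul_apply, smul_eq_mul, mul_one] at h4
      exact eq_inv_of_mul_eq_one_right h4.symm
    have hle : entryA9 (g⁻¹).val ≤ ε⁻¹ * (r * R) := by
      refine E.entryA9_le hmec (inv_mem hg) hb₀ (by positivity) ?_
      have h1 := (E.semisimplePart_mem_closure_iff (inv_mem hg)).2
        (subset_closure (hεB _ hgr))
      rw [Matrix.mulVec_sub, Matrix.mulVec_smul, Matrix.mulVec_smul, hS] at h1
      have h2 := hL.closure_add_mem h1 (hL.closure_smul_mem hr hbR)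
      have h3 := hL.closure_smul_mem (inv_pos.2 hε) h2
      convert h3 using 1
      rw [smul_sub, smul_smul r R, sub_add_sub_comm, add_sub_add_comm]
      rw [smul_add, smul_sub, smul_sub, smul_smul, smul_smul, smul_smul, inv_mul_cancel₀ hε.ne']
      module
    rw [← h9']
    calc r⁻¹ * entryA9 (g⁻¹).val ≤ r⁻¹ * (ε⁻¹ * (r * R)) := by gcongr
      _ = R * ε⁻¹ := by field_simp
  have h1 : shearVec D d (r • (semisimplePart g.val).mulVec b) 0
      (r * (α b * β + entryA9 g.val * z)) ∈ E.hull := by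
    have := E.smul_mem_hull hr ((hβ b z).1 hz)
    rwa [smul_shearVec, smul_zero] at this
  have h2 := hm _ hgr _ h1
  have h3 := hM _ ⟨_, hgr, rfl⟩
  have hdouble : doubleBase α (r • (semisimplePart g.val).mulVec b) =
      r • (semisimplePart g.val).mulVec (doubleBase α b) := by
    rw [map_smul, doubleBase_apply, doubleBase_apply, Matrix.mulVec_sub, Matrix.mulVec_smul,
      Matrix.mulVec_smul, h.map_apex g hg, h.height_map g hg]
    module
  rw [hdouble] at h3
  have h4 : shearVec D d (doubleBase α b) 0
      (z + max 0 (M - m) * (r⁻¹ * (entryA9 g.val)⁻¹)) ∈ E.hull := by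
    rw [hβ, ← E.smul_mem_hull_iff hr, smul_shearVec, smul_zero, h.height.apply_doubleBase]
    refine mem_hull_of_le ?_ h3
    have h5 : r * (α b * β + entryA9 g.val * (z + max 0 (M - m) * (r⁻¹ * (entryA9 g.val)⁻¹))) =
        r * (α b * β + entryA9 g.val * z) + max 0 (M - m) := by
      have := h9.ne'
      field_simp
      ring
    rw [h5]
    linarith [le_max_right 0 (M - m)]
  refine mem_hull_of_le ?_ h4
  have := mul_le_mul_of_nonneg_left hinv (le_max_left 0 (M - m))
  linarith

/-- Every vector of `K''` lifts to the hull: iterate the doubling and rescale. -/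
theorem IsAdapted.exists_mem_hull (h : IsAdapted E C c K'' α D) (hN : IsNormalizedCuspGroup E C c)
    (hmec : WeakMiddleEigenvalueCondition E)
    (hK : ActsCocompactly (fun g : GL (BlockIdx p i) ℝ => semisimplePart g.val)
      E.endGroup E.leafSpace)
    (hd : ∀ g ∈ E.endGroup, ∀ s, α s = 0 → shearLowerZ D d g.val s = 0)
    {s : Fin p ⊕ Unit → ℝ} (hs : s ∈ K'') : ∃ z, shearVec D d s 0 z ∈ E.hull := by
  have hL := h.height.properlyConvex
  obtain ⟨b, hb⟩ := hL.nonempty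
  set s₀ := b - α b • apex p
  have hs₀ : s₀ ∈ K'' := h.height.base_mem b (subset_closure hb)
  have hαb := h.height.pos hb
  have hb₀ : s₀ + apex p ∈ E.leafSpace := by
    have := h.height.scale_mem hb (inv_pos.2 hαb)
    rwa [inv_mul_cancel₀ hαb.ne', one_smul] at this
  obtain ⟨M, hM⟩ := h.exists_doubling hN hmec hK hd hb₀
  have key : ∀ s ∈ K'', s + apex p ∈ E.leafSpace → s₀ - s ∈ K'' →
      shearVec D d s 0 M ∈ E.hull := by
    intro s hs hsL hss
    obtain ⟨z, hz⟩ := exists_forall_mem_hull (D := D) (d := d) E (isCompact_singleton)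
      (Set.singleton_subset_iff.2 hsL)
    have hz := hz _ rfl
    have hn : ∀ n : ℕ, (2 ^ n : ℝ) • s + apex p ∈ E.leafSpace ∧
        shearVec D d ((2 ^ n : ℝ) • s + apex p) 0 (z + (2 ^ n - 1) * M) ∈ E.hull := by
      intro n
      induction n with
      | zero => simpa using ⟨hsL, hz⟩
      | succ n ih =>
        have hdb : doubleBase α ((2 ^ n : ℝ) • s + apex p) = (2 ^ (n + 1) : ℝ) • s + apex p := by
          rw [doubleBase_apply, map_add, map_smul, h.height.apply_eq_zero hs, h.height.apply_apex,
            pow_succ]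
          module
        refine ⟨hdb ▸ h.height.doubleBase_mem ih.1, ?_⟩
        have := hM _ ih.1 (2 ^ n) (by positivity) ?_ _ ih.2
        · rw [hdb] at this
          convert this using 2
          ring
        · have h1 := h.height.add_mem _ (h.height.smul_mem (r := 2 ^ n) (by positivity) hss)
            (2 ^ n - 1) (sub_nonneg.2 (one_le_pow₀ (by norm_num)))
          convert h1 using 1
          module
    have hlim : Filter.Tendsto (fun n : ℕ => ((1 / 2 : ℝ)) ^ n) Filter.atTop (nhds 0) :=
      tendsto_pow_atTop_nhds_zero_of_lt_one (by norm_num) (by norm_num)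
    have hcont : Continuous fun t : ℝ =>
        shearVec D d (s + t • apex p) (0 : Fin i → ℝ) (t * z + (1 - t) * M) :=
      continuous_shearVec (by fun_prop) continuous_const (by fun_prop)
    have h0 := E.isClosed_hull.mem_of_tendsto (hcont.continuousAt.tendsto.comp hlim)
      (Filter.Eventually.of_forall fun n => ?_)
    · simpa using h0
    · have h1 := E.smul_mem_hull (r := (1 / 2 : ℝ) ^ n) (by positivity) (hn n).2
      have h2 : ((1 / 2 : ℝ)) ^ n * 2 ^ n = 1 := by rw [← mul_pow]; norm_num
      rw [smul_shearVec, smul_zero, smul_add, smul_smul, h2, one_smul] at h1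
      simp only [Function.comp]
      convert h1 using 2
      rw [mul_add, ← mul_assoc, mul_sub, h2, mul_one]
  -- Points of `K''` below `s₀` are limits of interior ones.
  obtain ⟨t, ht, htL⟩ := hL.exists_sub_mem (B := {s₀ + apex p}) isCompact_singleton
    (Set.singleton_subset_iff.2 hb₀) s
  have hst : s₀ - t • s ∈ K'' := by
    have := h.height.base_mem _ (subset_closure (htL _ rfl))
    have hα : α (s₀ + apex p - t • s) = 1 := by
      simp [h.height.apply_eq_zero hs₀, h.height.apply_eq_zero hs, h.height.apply_apex]
    rw [hα] at this
    convert this using 1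
    module
  have hts : shearVec D d (t • s) 0 M ∈ E.hull := by
    have hcont : Continuous fun u : ℝ =>
        shearVec D d ((1 - u) • t • s + u • s₀) (0 : Fin i → ℝ) M :=
      continuous_shearVec (by fun_prop) continuous_const continuous_const
    have hlim : Filter.Tendsto (fun n : ℕ => ((1 / 2 : ℝ)) ^ n) Filter.atTop (nhds 0) :=
      tendsto_pow_atTop_nhds_zero_of_lt_one (by norm_num) (by norm_num)
    have h0 := E.isClosed_hull.mem_of_tendsto (hcont.continuousAt.tendsto.comp hlim)
      (Filter.Eventually.of_forall fun n => ?_)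
    · simpa using h0
    · have hu : 0 < ((1 / 2 : ℝ)) ^ n := by positivity
      have hu1 : ((1 / 2 : ℝ)) ^ n ≤ 1 := pow_le_one₀ (by norm_num) (by norm_num)
      set u := ((1 / 2 : ℝ)) ^ n
      refine key _ (h.height.add_mem' (h.height.smul_mem (sub_nonneg.2 hu1)
        (h.height.smul_mem ht.le hs)) (h.height.smul_mem hu.le hs₀)) ?_ ?_
      · have h1 : (1 - u) • (t • s + (1 : ℝ) • apex p) ∈ closure E.leafSpace :=
          hL.closure_smul_mem_of_nonneg (sub_nonneg.2 hu1)
            (h.height.add_mem _ (h.height.smul_mem ht.le hs) 1 zero_le_one)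
        have h2 : u • (s₀ + apex p) ∈ E.leafSpace := hL.smul_mem u hu _ hb₀
        have h3 : u • (s₀ + apex p) + (1 - u) • (t • s + (1 : ℝ) • apex p) ∈
            E.leafSpace + closure E.leafSpace := ⟨_, h2, _, h1, rfl⟩
        rw [hL.isOpen.add_closure] at h3
        obtain ⟨x, hx, y, hy, hxy⟩ := h3
        have h4 := hL.add_mem hx hy
        have h5 : x + y = _ := hxy
        rw [h5] at h4
        convert h4 using 1
        module
      · have := h.height.smul_mem (sub_nonneg.2 hu1) hst
        convert this using 1
        module
  have := E.smul_mem_hull (inv_pos.2 ht) hts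
  rw [smul_shearVec, smul_zero, inv_smul_smul₀ ht.ne'] at this
  exact ⟨_, this⟩

theorem zero_mem_of_forall_mul_mem_iff {S : Set ℝ} (hS : IsClosed S) {z θ : ℝ} (hz : z ∈ S)
    (hθ : 0 < θ) (hθ1 : θ ≠ 1) (h : ∀ x, θ * x ∈ S ↔ x ∈ S) : (0 : ℝ) ∈ S := by
  have key : ∀ θ : ℝ, 0 < θ → θ < 1 → (∀ x ∈ S, θ * x ∈ S) → (0 : ℝ) ∈ S := by
    intro θ h0 h1 h
    have hlim : Filter.Tendsto (fun n : ℕ => θ ^ n * z) Filter.atTop (nhds (0 * z)) :=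
      (tendsto_pow_atTop_nhds_zero_of_lt_one h0.le h1).mul_const z
    rw [zero_mul] at hlim
    refine hS.mem_of_tendsto hlim (Filter.Eventually.of_forall fun n => ?_)
    induction n with
    | zero => simpa using hz
    | succ n ih =>
      rw [pow_succ', mul_assoc]
      exact h _ ih
  rcases lt_or_gt_of_ne hθ1 with h1 | h1
  · exact key θ hθ h1 fun x hx => (h x).2 hx
  · refine key θ⁻¹ (inv_pos.2 hθ) (inv_lt_one_of_one_lt₀ h1) fun x hx => ?_
    rw [← h, mul_inv_cancel_left₀ hθ.ne']
    exact hx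

/-- In the sheared coordinates, `K''` itself is in the hull: the separating central element
rescales the last coordinate against the eigenvectors in `K''`. -/
theorem IsAdapted.shearVec_mem_hull (h : IsAdapted E C c K'' α D) (hN : IsNormalizedCuspGroup E C c)
    (hmec : WeakMiddleEigenvalueCondition E)
    (hK : ActsCocompactly (fun g : GL (BlockIdx p i) ℝ => semisimplePart g.val)
      E.endGroup E.leafSpace)
    (hd : ∀ g ∈ E.endGroup, ∀ s, α s = 0 → shearLowerZ D d g.val s = 0)
    {g₀ : GL (BlockIdx p i) ℝ} (hg₀ : IsSeparating E K'' α g₀)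
    (hcomm : ∀ g ∈ E.endGroup, g₀ * g = g * g₀)
    {s : Fin p ⊕ Unit → ℝ} (hs : s ∈ K'') : shearVec D d s (0 : Fin i → ℝ) 0 ∈ E.hull := by
  have ha := h.entryA1_eq_entryA9 hg₀.mem hcomm
  have hapex := h.map_apex g₀ hg₀.mem
  have h9 := E.entryA9_pos hg₀.mem
  have key : ∀ s ∈ K'', ∀ r : ℝ, 0 < r → (semisimplePart g₀.val).mulVec s = r • s →
      shearVec D d s (0 : Fin i → ℝ) 0 ∈ E.hull := by
    intro s hs r hr hsr
    have hαs := h.height.apply_eq_zero hs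
    rcases eq_or_ne (entryA9 g₀.val / r) 1 with hθ | hθ
    · have hra : r = entryA1 g₀.val := by
        rw [div_eq_one_iff_eq hr.ne'] at hθ
        rw [ha, hθ]
      rw [hg₀.separated s _ hαs hapex (hra ▸ hsr), shearVec_zero_zero, zero_smul]
      exact E.zero_mem_hull
    · obtain ⟨z, hz⟩ := h.exists_mem_hull hN hmec hK hd hs
      have hclosed : IsClosed {z : ℝ | shearVec D d s (0 : Fin i → ℝ) z ∈ E.hull} :=
        E.isClosed_hull.preimage (continuous_shearVec continuous_const continuous_const
          continuous_id)
      refine zero_mem_of_forall_mul_mem_iff hclosed hz (div_pos h9 hr) hθ fun x => ?_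
      show shearVec D d s (0 : Fin i → ℝ) (entryA9 g₀.val / r * x) ∈ E.hull ↔
        shearVec D d s (0 : Fin i → ℝ) x ∈ E.hull
      rw [← E.mulVec_mem_hull hg₀.mem (x := shearVec D d s (0 : Fin i → ℝ) x), h.mulVec g₀ hg₀.mem,
        hsr, hαs, hd g₀ hg₀.mem s hαs, zero_smul, zero_add, Matrix.mulVec_zero, dotProduct_zero,
        zero_add, zero_add, ← E.smul_mem_hull_iff hr, smul_shearVec, smul_zero]
      have : r * (entryA9 g₀.val / r * x) = entryA9 g₀.val * x := by field_simp
      rw [this]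
  obtain ⟨l, y, r, rfl, hy⟩ := hg₀.exists_sum s hs
  have hsum : ∀ t : Finset (Fin l), shearVec D d (∑ j ∈ t, y j) (0 : Fin i → ℝ) 0 ∈ E.hull := by
    intro t
    induction t using Finset.induction_on with
    | empty =>
      rw [Finset.sum_empty, shearVec_zero_zero, zero_smul]
      exact E.zero_mem_hull
    | insert j t hj ih =>
      have := E.add_mem_hull (key (y j) (hy j).1 (r j) (hy j).2.1 (hy j).2.2) ih
      rwa [shearVec_add, add_zero, add_zero, ← Finset.sum_insert hj] at this
  exact hsum Finset.univ

end Hull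

/-! ### The lift of `K''` is in the frontier -/

section Frontier

variable {p i : ℕ} {O : ConvexProjectiveOrbifold (BlockIdx p i)} {E : NPCCEnd O}
  {K'' : Set (Fin p ⊕ Unit → ℝ)} {α : (Fin p ⊕ Unit → ℝ) →ₗ[ℝ] ℝ}
  {C : (Fin i → ℝ) →ₗ[ℝ] Matrix (Fin i) (Fin p) ℝ} {c : (Fin i → ℝ) → Fin p → ℝ}
  {D : (Fin p ⊕ Unit → ℝ) →ₗ[ℝ] (Fin i → ℝ)} {d : (Fin p ⊕ Unit → ℝ) →ₗ[ℝ] ℝ}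

theorem IsProperlyConvexCone.add_closure_mem {κ : Type*} {L : Set (κ → ℝ)}
    (hL : IsProperlyConvexCone L) {x y : κ → ℝ} (hx : x ∈ L) (hy : y ∈ closure L) : x + y ∈ L := by
  have h : x + y ∈ L + closure L := ⟨_, hx, _, hy, rfl⟩
  rw [hL.isOpen.add_closure] at h
  obtain ⟨u, hu, v, hv, huv⟩ := h
  rw [← huv]
  exact hL.add_mem hu hv

/-- On the span of `K''`, the end group acts through its semisimple part. -/
theorem IsAdapted.mulVec_base (h : IsAdapted E C c K'' α D)
    (hd : ∀ g ∈ E.endGroup, ∀ s, α s = 0 → shearLowerZ D d g.val s = 0)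
    {g : GL (BlockIdx p i) ℝ} (hg : g ∈ E.endGroup) {s} (hs : α s = 0) :
    g.val.mulVec (shearVec D d s 0 0) = shearVec D d ((semisimplePart g.val).mulVec s) 0 0 := by
  rw [h.mulVec g hg, hs, hd g hg s hs]
  simp

/-- If a point over `K''` were in the domain, then the relative interior of `K''` would lift to
the domain; but infinitely many elements of the end group move a given point of that lift into a
compact subset of it. -/
theorem IsAdapted.shearVec_mem_frontier (h : IsAdapted E C c K'' α D)
    (hd : ∀ g ∈ E.endGroup, ∀ s, α s = 0 → shearLowerZ D d g.val s = 0)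
    (hhull : ∀ s ∈ K'', shearVec D d s (0 : Fin i → ℝ) 0 ∈ E.hull) {s} (hs : s ∈ K'') :
    shearVec D d s (0 : Fin i → ℝ) 0 ∈ frontier O.domain := by
  have hL := h.height.properlyConvex
  rw [O.properlyConvex.isOpen.frontier_eq]
  refine ⟨E.hull_subset (hhull s hs), fun hmem => ?_⟩
  have hint : ∀ t, α t = 0 → t + apex p ∈ E.leafSpace →
      shearVec D d t (0 : Fin i → ℝ) 0 ∈ O.domain := by
    intro t ht htL
    obtain ⟨ε, hε, hεL⟩ := hL.exists_sub_mem (B := {t + apex p}) isCompact_singleton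
      (Set.singleton_subset_iff.2 htL) s
    have hts : t - ε • s ∈ K'' := by
      have := h.height.base_mem _ (subset_closure (hεL _ rfl))
      have hα : α (t + apex p - ε • s) = 1 := by
        simp [ht, h.height.apply_eq_zero hs, h.height.apply_apex]
      rw [hα] at this
      convert this using 1
      module
    have h1 := O.properlyConvex.add_closure_mem (O.properlyConvex.smul_mem ε hε _ hmem)
      (E.hull_subset (hhull _ hts))
    rwa [smul_shearVec, shearVec_add, smul_zero, mul_zero, add_zero, add_zero,
      add_sub_cancel] at h1
  obtain ⟨D₀, hD₀, hc, hcov⟩ := E.directions_cocompact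
  obtain ⟨b, hb⟩ := hL.nonempty
  let base : (Fin p ⊕ Unit → ℝ) →ₗ[ℝ] (Fin p ⊕ Unit → ℝ) := LinearMap.id - α.smulRight (apex p)
  have hbase : ∀ b, base b = b - α b • apex p := fun b => rfl
  have hαbase : ∀ b, α (base b) = 0 := fun b => by
    rw [hbase, map_sub, map_smul, h.height.apply_apex, smul_eq_mul, mul_one, sub_self]
  have hbaseL : ∀ b ∈ E.leafSpace, base b + apex p ∈ E.leafSpace := by
    intro b hb
    have hαb := h.height.pos hb
    have := h.height.scale_mem hb (inv_pos.2 hαb)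
    rwa [inv_mul_cancel₀ hαb.ne', one_smul] at this
  let Ψ : (Fin p ⊕ Unit → ℝ) → BlockIdx p i → ℝ := fun b => shearVec D d (base b) 0 0
  have hΨ : ∀ b ∈ E.leafSpace, Ψ b ∈ O.domain := fun b hb => hint _ (hαbase b) (hbaseL b hb)
  have hΨc : Continuous fun x : (Fin p ⊕ Unit) ⊕ Fin i → ℝ => Ψ (x ∘ Sum.inl) :=
    continuous_shearVec (base.continuous_of_finiteDimensional.comp
      (continuous_pi fun j => continuous_apply _)) continuous_const continuous_const
  have hfin := O.properlyDiscontinuous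
    ((fun x : (Fin p ⊕ Unit) ⊕ Fin i → ℝ => Ψ (x ∘ Sum.inl)) '' D₀ ∪ {Ψ b})
    (by
      rintro _ (⟨x, hx, rfl⟩ | rfl)
      · have := NPCCEnd.mem_linkProj_image.1 (hD₀ hx)
        exact hΨ _ this
      · exact hΨ b hb)
    ((hc.image hΨc).union isCompact_singleton)
  refine E.infinite_translates h.height hb hD₀ hc hcov (hfin.subset ?_)
  rintro g ⟨hg, y, r, hr, hgr⟩
  refine ⟨((E.mem_endGroup g).1 hg).1, Ψ b, Or.inr rfl, r, hr, Or.inl ⟨_, hgr, ?_⟩⟩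
  rw [← linkProj_blockVec b y 0, (E.standardForm g hg).linkMatrix_mulVec]
  have h1 := (E.standardForm g hg).semisimplePart_projK (blockVec b y 0)
  have h2 : Ψ (r • projK p i (g.val.mulVec (blockVec b y 0))) = r • g.val.mulVec (Ψ b) := by
    rw [h1, h.mulVec_base hd hg (hαbase b), smul_shearVec, smul_zero, mul_zero]
    show shearVec D d (base (r • (semisimplePart g.val).mulVec b)) 0 0 = _
    rw [shearVec_inj]
    refine ⟨?_, rfl, rfl⟩
    rw [map_smul, hbase, hbase, h.height_map g hg, Matrix.mulVec_sub, Matrix.mulVec_smul,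
      h.map_apex g hg, smul_smul, mul_comm]
  exact h2

end Frontier

/-! ### The new coordinates -/

section Coordinates

variable {p i : ℕ} (α : (Fin p ⊕ Unit → ℝ) →ₗ[ℝ] ℝ)
  (D : (Fin p ⊕ Unit → ℝ) →ₗ[ℝ] (Fin i → ℝ)) (d : (Fin p ⊕ Unit → ℝ) →ₗ[ℝ] ℝ)

/-- The linear map that replaces the last coordinate by the height `α`. -/
def heightCoord : (Fin p ⊕ Unit → ℝ) →ₗ[ℝ] (Fin p ⊕ Unit → ℝ) :=
  LinearMap.id + (α - LinearMap.proj (Sum.inr ())).smulRight (apex p)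

theorem heightCoord_apply (b : Fin p ⊕ Unit → ℝ) :
    heightCoord α b = b + (α b - b (Sum.inr ())) • apex p := rfl

theorem heightCoord_inr (b : Fin p ⊕ Unit → ℝ) : heightCoord α b (Sum.inr ()) = α b := by
  simp [heightCoord_apply, apex]

/-- The inverse of `heightCoord`. -/
def heightCoordInv : (Fin p ⊕ Unit → ℝ) →ₗ[ℝ] (Fin p ⊕ Unit → ℝ) :=
  LinearMap.id + (LinearMap.proj (Sum.inr ()) - α).smulRight (apex p)

theorem heightCoordInv_apply (b : Fin p ⊕ Unit → ℝ) :
    heightCoordInv α b = b + (b (Sum.inr ()) - α b) • apex p := rfl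

variable {α}

theorem heightCoord_heightCoordInv (hα : α (apex p) = 1) (b : Fin p ⊕ Unit → ℝ) :
    heightCoord α (heightCoordInv α b) = b := by
  have h1 : α (heightCoordInv α b) = b (Sum.inr ()) := by simp [heightCoordInv_apply, hα]
  have h2 : heightCoordInv α b (Sum.inr ()) = 2 * b (Sum.inr ()) - α b := by
    simp [heightCoordInv_apply, apex]
    ring
  rw [heightCoord_apply, h1, h2, heightCoordInv_apply]
  module

theorem heightCoordInv_heightCoord (hα : α (apex p) = 1) (b : Fin p ⊕ Unit → ℝ) :
    heightCoordInv α (heightCoord α b) = b := by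
  have h1 : α (heightCoord α b) = 2 * α b - b (Sum.inr ()) := by
    simp [heightCoord_apply, hα]
    ring
  rw [heightCoordInv_apply, h1, heightCoord_inr, heightCoord_apply]
  module

theorem apply_heightCoordInv (hα : α (apex p) = 1) (b : Fin p ⊕ Unit → ℝ) :
    α (heightCoordInv α b) = b (Sum.inr ()) := by
  rw [← heightCoord_inr, heightCoord_heightCoordInv hα]

variable (α)

/-- The change of coordinates `(b, y, z) ↦ (b', y + D b, z + d b)`, where the last coordinate of
`b'` is the height of `b`. -/
def coordMap : (BlockIdx p i → ℝ) →ₗ[ℝ] (BlockIdx p i → ℝ) where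
  toFun x := blockVec (heightCoord α (projK p i x)) (x ∘ Sum.inr ∘ Sum.inl + D (projK p i x))
    (x (Sum.inr (Sum.inr ())) + d (projK p i x))
  map_add' x x' := by
    rw [blockVec_add, blockVec_inj]
    simp only [map_add, Pi.add_apply]
    exact ⟨trivial, add_add_add_comm _ _ _ _, add_add_add_comm _ _ _ _⟩
  map_smul' r x := by
    rw [RingHom.id_apply, smul_blockVec, blockVec_inj]
    simp only [map_smul, Pi.smul_apply, smul_eq_mul]
    exact ⟨trivial, (smul_add r _ _).symm, (mul_add _ _ _).symm⟩

/-- The inverse of `coordMap`. -/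
def coordMapInv : (BlockIdx p i → ℝ) →ₗ[ℝ] (BlockIdx p i → ℝ) where
  toFun x := shearVec D d (heightCoordInv α (projK p i x)) (x ∘ Sum.inr ∘ Sum.inl)
    (x (Sum.inr (Sum.inr ())))
  map_add' x x' := by
    rw [shearVec_add, map_add, map_add]
    rfl
  map_smul' r x := by
    rw [RingHom.id_apply, smul_shearVec, map_smul, map_smul]
    rfl

theorem coordMap_shearVec (b : Fin p ⊕ Unit → ℝ) (y : Fin i → ℝ) (z : ℝ) :
    coordMap α D d (shearVec D d b y z) = blockVec (heightCoord α b) y z := by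
  show blockVec (heightCoord α b) (y - D b + D b) (z - d b + d b) = _
  rw [sub_add_cancel, sub_add_cancel]

theorem coordMapInv_blockVec (b : Fin p ⊕ Unit → ℝ) (y : Fin i → ℝ) (z : ℝ) :
    coordMapInv α D d (blockVec b y z) = shearVec D d (heightCoordInv α b) y z := rfl

variable {α}

/-- The matrix of the change of coordinates. -/
def coordGL (hα : α (apex p) = 1) : GL (BlockIdx p i) ℝ where
  val := LinearMap.toMatrix' (coordMap α D d)
  inv := LinearMap.toMatrix' (coordMapInv α D d)
  val_inv := by
    rw [← LinearMap.toMatrix'_comp, ← LinearMap.toMatrix'_id]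
    congr 1
    refine LinearMap.ext fun x => ?_
    obtain ⟨y, z, hx⟩ := exists_eq_blockVec x
    rw [hx, LinearMap.comp_apply, coordMapInv_blockVec, coordMap_shearVec,
      heightCoord_heightCoordInv hα]
    rfl
  inv_val := by
    rw [← LinearMap.toMatrix'_comp, ← LinearMap.toMatrix'_id]
    congr 1
    refine LinearMap.ext fun x => ?_
    obtain ⟨y, z, hx⟩ := exists_eq_shearVec D d x
    rw [hx, LinearMap.comp_apply, coordMap_shearVec, coordMapInv_blockVec,
      heightCoordInv_heightCoord hα]
    rfl

theorem coordGL_mulVec (hα : α (apex p) = 1) (b : Fin p ⊕ Unit → ℝ) (y : Fin i → ℝ) (z : ℝ) :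
    (coordGL D d hα).val.mulVec (shearVec D d b y z) = blockVec (heightCoord α b) y z := by
  rw [← coordMap_shearVec α D d]
  exact LinearMap.toMatrix'_mulVec _ _

theorem coordGL_inv_mulVec (hα : α (apex p) = 1) (b : Fin p ⊕ Unit → ℝ) (y : Fin i → ℝ) (z : ℝ) :
    (coordGL D d hα)⁻¹.val.mulVec (blockVec b y z) = shearVec D d (heightCoordInv α b) y z := by
  rw [← coordMapInv_blockVec α D d]
  exact LinearMap.toMatrix'_mulVec _ _

theorem isStandardForm_of_mulVec {M : Matrix (BlockIdx p i) (BlockIdx p i) ℝ}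
    (h1 : ∀ y, ∃ y' z', M.mulVec (blockVec 0 y 0) = blockVec 0 y' z')
    (h2 : ∃ z', M.mulVec (blockVec 0 0 1) = blockVec 0 0 z') : IsStandardForm M := by
  have e1 : ∀ k, blockVec 0 (Pi.single k 1) 0 =
      (Pi.single (Sum.inr (Sum.inl k)) 1 : BlockIdx p i → ℝ) := fun k => by
    ext j
    rcases j with j | j | j <;> simp [blockVec, Pi.single_apply]
  have e2 : blockVec 0 0 1 = (Pi.single (Sum.inr (Sum.inr ())) 1 : BlockIdx p i → ℝ) := by
    ext j
    rcases j with j | j | j <;> simp [blockVec]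
  obtain ⟨z', hz⟩ := h2
  rw [e2, Matrix.mulVec_single_one] at hz
  constructor
  · ext j k
    rcases k with k | k
    · obtain ⟨y', z', h⟩ := h1 (Pi.single k 1)
      rw [e1, Matrix.mulVec_single_one] at h
      exact congrFun h (Sum.inl j)
    · exact congrFun hz (Sum.inl j)
  · ext j k
    exact congrFun hz (Sum.inr (Sum.inl j))

end Coordinates

end

theorem proposition4p4 {p i : ℕ} (O : ConvexProjectiveOrbifold (BlockIdx p i)) (E : NPCCEnd O)
    (C : (Fin i → ℝ) →ₗ[ℝ] Matrix (Fin i) (Fin p) ℝ) (c : (Fin i → ℝ) → Fin p → ℝ)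
    (K'' : Set (Fin p ⊕ Unit → ℝ))
    -- the standing hypothesis
    (hK : ActsCocompactly (fun g : GL (BlockIdx p i) ℝ => semisimplePart g.val)
      E.endGroup E.leafSpace)
    (hmec : WeakMiddleEigenvalueCondition E)
    (hN : IsNormalizedCuspGroup E C c)
    -- the additional assumptions
    (ha : ∀ g ∈ E.endGroup, IsTopA1 g.val →
      numberA5 g.val ≤ entryA1 g.val ∧ entryA9 g.val ≤ entryA1 g.val)
    (hjoin : IsStrictJoin (apexRay p) K'' (closure E.leafSpace))
    (hcenter : ∃ Z : Subgroup E.endGroup, Z ≤ Subgroup.center E.endGroup ∧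
      IsZariskiDenseIn ((fun g : E.endGroup => semisimplePart g.val.val) '' Z)
        (virtualCenter (closure E.leafSpace))) :
    ∃ (σ : Submodule.span ℝ K'' →ₗ[ℝ] (BlockIdx p i → ℝ)) (P : GL (BlockIdx p i) ℝ),
      -- `σ` embeds `K''` in the boundary of the universal cover, over the identity of `K''`
      (∀ s, projK p i (σ s) = s) ∧
      (∀ s : Submodule.span ℝ K'', (s : Fin p ⊕ Unit → ℝ) ∈ K'' → s ≠ 0 →
        σ s ∈ frontier O.domain) ∧
      -- its image is invariant under the end group
      (∀ g ∈ E.endGroup, moveSet g (σ '' {s | (s : Fin p ⊕ Unit → ℝ) ∈ K''}) =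
        σ '' {s | (s : Fin p ⊕ Unit → ℝ) ∈ K''}) ∧
      -- in the coordinates `y = P x`, the image lies in the span of the first `p` coordinates,
      IsStandardForm P.val ∧
      (∀ s, P.val.mulVec (σ s) (Sum.inl (Sum.inr ())) = 0 ∧
        ∀ j, P.val.mulVec (σ s) (Sum.inr j) = 0) ∧
      -- the cusp group is standard, with vanishing `C₁` and `c₂`,
      (∀ v, P.val * cuspMatrix (C v) (c v) v * (P⁻¹).val = cuspMatrix 0 0 v) ∧
      -- and so is every element of the end group, which splits
      ∀ g ∈ E.endGroup, IsStandardForm (P * g * P⁻¹).val ∧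
        blockS1 (P * g * P⁻¹).val = 0 ∧ blockS2 (P * g * P⁻¹).val = 0 ∧
        blockC1 (P * g * P⁻¹).val = 0 ∧ blockC2 (P * g * P⁻¹).val = 0 := by
  obtain ⟨α, hα⟩ := exists_isJoinHeight E.leafSpace_properlyConvex hjoin
  obtain ⟨g₀, hg₀, hcomm⟩ := exists_isSeparating hα hjoin.1 hcenter
  obtain ⟨D, hD⟩ := hN.exists_isAdapted hα hg₀
  obtain ⟨d, -, hd⟩ := hD.exists_shear hg₀ hcomm
  have hhull : ∀ s ∈ K'', shearVec D d s (0 : Fin i → ℝ) 0 ∈ E.hull := fun s hs =>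
    hD.shearVec_mem_hull hN hmec hK hd hg₀ hcomm hs
  let σ : Submodule.span ℝ K'' →ₗ[ℝ] (BlockIdx p i → ℝ) :=
    { toFun := fun s => shearVec D d s 0 0
      map_add' := fun s t => by rw [shearVec_add, add_zero, add_zero]; rfl
      map_smul' := fun r s => by
        rw [RingHom.id_apply, smul_shearVec, smul_zero, mul_zero]; rfl }
  have hσ : ∀ s, σ s = shearVec D d s 0 0 := fun s => rfl
  let P := coordGL D d hα.apply_apex
  have hP : ∀ b y z, P.val.mulVec (shearVec D d b y z) = blockVec (heightCoord α b) y z :=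
    coordGL_mulVec D d hα.apply_apex
  have hPinv : ∀ b y z, (P⁻¹).val.mulVec (blockVec b y z) =
      shearVec D d (heightCoordInv α b) y z := coordGL_inv_mulVec D d hα.apply_apex
  have hconj : ∀ g ∈ E.endGroup, ∀ b y z, (P * g * P⁻¹).val.mulVec (blockVec b y z) =
      blockVec (heightCoord α ((semisimplePart g.val).mulVec (heightCoordInv α b)))
        (b (Sum.inr ()) • lowerY g.val (apex p) + (blockA5 g.val).mulVec y)
        (shearLowerZ D d g.val (heightCoordInv α b) + blockA8 g.val ⬝ᵥ y + entryA9 g.val * z) := by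
    intro g hg b y z
    rw [Units.val_mul, Units.val_mul, ← Matrix.mulVec_mulVec, ← Matrix.mulVec_mulVec, hPinv,
      hD.mulVec g hg, hP, apply_heightCoordInv hα.apply_apex]
  refine ⟨σ, P, fun s => rfl, fun s hs _ => hD.shearVec_mem_frontier hd hhull hs, ?_, ?_, ?_, ?_, ?_⟩
  · intro g hg
    have hmap : ∀ s, (semisimplePart g.val).mulVec s ∈ K'' ↔ s ∈ K'' := fun s => by
      rw [hα.mem_iff, hα.mem_iff, E.semisimplePart_mem_closure_iff hg, hD.height_map g hg,
        mul_eq_zero, or_iff_right (hD.entryA1_pos g hg).ne']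
    have hgσ : ∀ s, α s = 0 → g.val.mulVec (shearVec D d s 0 0) =
        shearVec D d ((semisimplePart g.val).mulVec s) 0 0 := fun s hs => hD.mulVec_base hd hg hs
    ext x
    constructor
    · rintro ⟨_, ⟨s, hs, rfl⟩, rfl⟩
      exact ⟨⟨_, Submodule.subset_span ((hmap s).2 hs)⟩, (hmap s).2 hs,
        (hgσ s (hα.apply_eq_zero hs)).symm⟩
    · rintro ⟨s, hs, rfl⟩
      obtain ⟨t, ht⟩ := (E.semisimpleEquiv hg).surjective s
      rw [E.semisimpleEquiv_apply] at ht
      have htK : t ∈ K'' := by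
        rw [← hmap, ht]
        exact hs
      refine ⟨_, ⟨⟨t, Submodule.subset_span htK⟩, htK, rfl⟩, ?_⟩
      show g.val.mulVec (shearVec D d t 0 0) = shearVec D d s 0 0
      rw [hgσ t (hα.apply_eq_zero htK), ht]
  · have h0 : ∀ (y : Fin i → ℝ) (z : ℝ), P.val.mulVec (blockVec 0 y z) = blockVec 0 y z := by
      intro y z
      have := hP 0 y z
      rwa [shearVec, map_zero, map_zero, map_zero, sub_zero, sub_zero] at this
    exact isStandardForm_of_mulVec (fun y => ⟨_, _, h0 y 0⟩) ⟨_, h0 0 1⟩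
  · intro s
    rw [hσ, hP]
    refine ⟨?_, fun j => ?_⟩
    · show heightCoord α s (Sum.inr ()) = 0
      rw [heightCoord_inr, (hα.mem_span_iff s).1 s.2]
    · rcases j with j | j <;> rfl
  · intro v
    have hPP : P.val * (P⁻¹).val = 1 := by rw [← Units.val_mul, mul_inv_cancel, Units.val_one]
    suffices h : P.val * cuspMatrix (C v) (c v) v = cuspMatrix 0 0 v * P.val by
      rw [h, Matrix.mul_assoc, hPP, mul_one]
    refine Matrix.ext_of_mulVec_single fun j => ?_
    obtain ⟨y, z, hx⟩ := exists_eq_shearVec D d (Pi.single j 1)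
    rw [hx, ← Matrix.mulVec_mulVec, ← Matrix.mulVec_mulVec, hD.cusp_mulVec, hP, hP]
    have h0 := cuspMatrix_mulVec (0 : (Fin i → ℝ) →ₗ[ℝ] Matrix (Fin i) (Fin p) ℝ) (fun _ => 0) v
      (heightCoord α (projK p i (Pi.single j 1))) y z
    rw [cuspForm_mulVec, heightCoord_inr] at h0
    simp only [LinearMap.zero_apply, Matrix.zero_mulVec, zero_add, zero_dotProduct, add_zero] at h0
    exact h0.symm
  · intro g hg
    set M := (P * g * P⁻¹).val
    have hM := hconj g hg
    have hapex : M.mulVec (blockVec (apex p) 0 0) =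
        blockVec (entryA1 g.val • apex p) (lowerY g.val (apex p))
          (shearLowerZ D d g.val (apex p)) := by
      have h1 : heightCoordInv α (apex p) = apex p := by
        rw [heightCoordInv_apply, hα.apply_apex]
        simp [apex]
      have h2 : heightCoord α (apex p) = apex p := by
        rw [heightCoord_apply, hα.apply_apex]
        simp [apex]
      rw [hM, h1, hD.map_apex g hg, map_smul, h2, blockVec_inj]
      refine ⟨rfl, ?_, ?_⟩ <;> simp [apex]
    have hbase : ∀ j : Fin p, ∃ b : Fin p ⊕ Unit → ℝ, b (Sum.inr ()) = 0 ∧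
        M.mulVec (blockVec (Pi.single (Sum.inl j) 1) 0 0) = blockVec b 0 0 := by
      intro j
      have h1 : α (heightCoordInv α (Pi.single (Sum.inl j) 1)) = 0 := by
        rw [apply_heightCoordInv hα.apply_apex]
        simp
      refine ⟨heightCoord α ((semisimplePart g.val).mulVec (heightCoordInv α (Pi.single (Sum.inl j) 1))),
        ?_, (hM _ _ _).trans ?_⟩
      · rw [heightCoord_inr, hD.height_map g hg, h1, mul_zero]
      · rw [blockVec_inj, hd g hg _ h1]
        simp
    have e1 : blockVec (apex p) 0 0 = (Pi.single (Sum.inl (Sum.inr ())) 1 : BlockIdx p i → ℝ) := by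
      ext j
      rcases j with (j | j) | j | j <;> simp [blockVec, apex]
    have e2 : ∀ k : Fin p, blockVec (Pi.single (Sum.inl k) 1) 0 0 =
        (Pi.single (Sum.inl (Sum.inl k)) 1 : BlockIdx p i → ℝ) := fun k => by
      ext j
      rcases j with (j | j) | j | j <;> simp [blockVec, Pi.single_apply]
    rw [e1, Matrix.mulVec_single_one] at hapex
    simp only [e2, Matrix.mulVec_single_one] at hbase
    refine ⟨isStandardForm_of_mulVec (fun y => ?_) ?_, ?_, ?_, ?_, ?_⟩
    · have h0 := hM 0 y 0
      rw [map_zero, Matrix.mulVec_zero, map_zero] at h0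
      exact ⟨_, _, h0⟩
    · have h0 := hM 0 0 1
      rw [map_zero, Matrix.mulVec_zero, map_zero, Matrix.mulVec_zero, Pi.zero_apply, zero_smul,
        add_zero] at h0
      exact ⟨_, h0⟩
    · ext j k
      exact (congrFun hapex (Sum.inl (Sum.inl j))).trans (by simp [blockVec, apex])
    · ext j k
      obtain ⟨b, hb, hbk⟩ := hbase k
      have := congrFun hbk (Sum.inl (Sum.inr ()))
      exact this.trans hb
    · ext j k
      obtain ⟨b, hb, hbk⟩ := hbase k
      exact congrFun hbk (Sum.inr (Sum.inl j))
    · ext j k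
      obtain ⟨b, hb, hbk⟩ := hbase k
      exact congrFun hbk (Sum.inr (Sum.inr ()))
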